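/- Setting. Let $N\ge 0$, spins $s_1,\dots,s_N$ with $2s_n\in\mathbb Z_{>0}$, $\eta\in\mathbb C\setminus\{0\}$, inhomogeneities $\xi=(\xi_1,\dots,\xi_N)\in\mathbb C^N$, and $\mathcal H=\bigotimes_{n=1}^N\mathbb C^{2s_n+1}$. On the $n$-th factor let $S_n^z=\mathrm{diag}(s_n,s_n-1,\dots,-s_n)$, let $S_n^+$ have the superdiagonal entries $\sqrt{j(2s_n+1-j)}$, $j=1,\dots,2s_n$, and zeros elsewhere, and let $S_n^-=(S_n^+)^t$. Put $$L_{0n}(\lambda)=\begin{pmatrix}\lambda+\eta(\tfrac12+S_n^z)&\eta S_n^-\\ \eta S_n^+&\lambda+\eta(\tfrac12-S_n^z)\end{pmatrix}_0,\qquad M_0(\lambda)=K_0L_{0N}(\lambda-\xi_N)\cdots L_{01}(\lambda-\xi_1),$$ where $K\in\mathrm{End}(\mathbb C^2)$ has eigenvalues $k_1,k_2$ (with multiplicity, in either order), and let $T^{(K)}(\lambda)=\mathrm{tr}_0M_0(\lambda)$. For $l\ge1$ let $$T^{(K|l)}(\lambda)=\mathrm{tr}_{V^+}\,P^+M_1(\lambda+(l-1)\eta)\cdots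 M_{l-1}(\lambda+\eta)M_l(\lambda)P^+,$$ where $P^+$ is the symmetrizer of $(\mathbb C^2)^{\otimes l}$ and $V^+$ its image, and $T^{(K|0)}=1$. Put $\xi_n^{(k)}=\xi_n-\frac\eta2+(s_n-k)\eta$, $$a(\lambda)=\prod_n\bigl(\lambda-\xi_n+\tfrac\eta2+s_n\eta\bigr),\qquad d(\lambda)=\prod_n\bigl(\lambda-\xi_n+\tfrac\eta2-s_n\eta\bigr).$$ A function $t:\mathbb C\to\mathbb C$ is an eigenvalue of $T^{(K)}$ if there is a nonzero $v\in\mathcal H$ with $T^{(K)}(\lambda)v=t(\lambda)v$ for all $\lambda$; its eigenspace is the space of all such $v$ together with $0$. Let $\Sigma_T$ be the set of eigenvalues. For a function $t$ let $D_{t,n}$ be the tridiagonal $(2s_n+1)\times(2s_n+1)$ matrix whose row $i=0,\dots,2s_n$ has diagonal entry $t(\xi_n^{(i)})$, entry $-k_1a(\xi_n^{(i)})$ to the right of it and $-k_2d(\xi_n^{(i)})$ to the left of it. Define $t^{(0)}=1$, $t^{(1)}=t$ and $$t^{(l+1)}(\lambda)=t(\lambda+l\eta)\,t^{(l)}(\lambda)-\det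 K\;a(\lambda+l\eta)\,d(\lambda+(l-1)\eta)\,t^{(l-1)}(\lambda).$$ For a covector $\langle S|$ on $\mathcal H$ and $h=(h_1,\dots,h_N)$ with $0\le h_n\le 2s_n$ put $$\langle h|=\langle S|\prod_{n=1}^N\frac{k_2^{h_n-2s_n}\,T^{(K|2s_n-h_n)}(\xi_n^{(2s_n)})}{\prod_{k=0}^{2s_n-h_n-1}d(\xi_n^{(2s_n-k)})}.$$ "For almost all" means: for all points outside the zero set of some nonzero polynomial. Theorem. Let $K$ be invertible and not proportional to the identity. Then for almost all $\xi\in\mathbb C^N$ (for fixed $N$, $s_n$, $\eta$, $K$) the points $\xi_a^{(h)}$, $\xi_b^{(k)}$ ($0\le h\le 2s_a$, $0\le k\le 2s_b$) of different sites $a\ne b$ are distinct, and the following holds. 1. Every eigenvalue of $T^{(K)}$ is simple, i.e. its eigenspace is one-dimensional. If moreover $K$ is diagonalizable (equivalently $k_1\neq k_2$), then $T^{(K)}$ is diagonalizable with simple spectrum: $\mathcal H$ has a basis of common eigenvectors of all $T^{(K)}(\lambda)$, $\lambda\in\mathbb C$, with pairwise different eigenvalues. 2. $\Sigma_T$ is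 exactly the set of the polynomials $$t(\lambda)=\mathrm{tr}K\prod_{a=1}^N(\lambda-\xi_a^{(0)})+\sum_{a=1}^Nx_a\prod_{b\ne a}\frac{\lambda-\xi_b^{(0)}}{\xi_a^{(0)}-\xi_b^{(0)}}$$ (so that $x_a=t(\xi_a^{(0)})$) with $(x_1,\dots,x_N)\in\mathbb C^N$ such that $\det D_{t,n}=0$ for all $n=1,\dots,N$. 3. For almost all covectors $\langle S|$ the covectors $\langle h|$ form a basis of the dual of $\mathcal H$. For every $\langle S|$ for which they do, and every $t\in\Sigma_T$, there is exactly one vector $|t\rangle$ in the eigenspace of $t$ with $\langle S|t\rangle=1$; it satisfies $T^{(K|l)}(\lambda)|t\rangle=t^{(l)}(\lambda)|t\rangle$ for all $l\ge0$, $\lambda\in\mathbb C$, and its wavefunction is $$\langle h|t\rangle=\prod_{n=1}^N\frac{k_2^{h_n-2s_n}\,t^{(2s_n-h_n)}(\xi_n^{(2s_n)})}{\prod_{k=0}^{2s_n-h_n-1}d(\xi_n^{(2s_n-k)})}\qquad\text{for all }h.$$ -/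

import Mathlib

open Matrix Polynomial
open scoped Nat

namespace HigherSpin

noncomputable section

/-- `ForAlmostAll p`: the property `p` holds on `ℂ^ι` outside the zero set of some nonzero
polynomial (in particular, outside a closed set of Lebesgue measure zero). -/
def ForAlmostAll {ι : Type*} (p : (ι → ℂ) → Prop) : Prop :=
  ∃ P : MvPolynomial ι ℂ, P ≠ 0 ∧ ∀ x : ι → ℂ, MvPolynomial.eval x P ≠ 0 → p x

/-! ### Spin representations

Throughout, `m = 2s` is twice the spin; the spin-`s` space has the basis `Fin (m + 1)`. -/

/-- `S^z = diag(s, s - 1, …, -s)`. -/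
def spinZ (m : ℕ) : Matrix (Fin (m + 1)) (Fin (m + 1)) ℂ :=
  Matrix.diagonal fun i => (m : ℂ) / 2 - (i : ℕ)

/-- `S^+`, with superdiagonal entries `x(j) = √(j (2s + 1 - j))`, `j = 1, …, 2s`
(the entry in row `i`, counted from `0`, has `j = i + 1`). -/
def spinPlus (m : ℕ) : Matrix (Fin (m + 1)) (Fin (m + 1)) ℂ :=
  Matrix.of fun i j =>
    if (j : ℕ) = (i : ℕ) + 1 then
      ((Real.sqrt (((i : ℕ) + 1 : ℝ) * ((m : ℝ) + 1 - ((i : ℕ) + 1))) : ℝ) : ℂ)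
    else 0

/-- `S^- = (S^+)ᵗ`. -/
def spinMinus (m : ℕ) : Matrix (Fin (m + 1)) (Fin (m + 1)) ℂ := (spinPlus m)ᵀ

/-! ### The chain -/

variable {N : ℕ}

/-- The index set of the natural basis of `ℋ = ⨂ₙ V_n`, `V_n = ℂ^(2sₙ+1)`. -/
abbrev Conf (m : Fin N → ℕ) : Type := (n : Fin N) → Fin (m n + 1)

/-- Operators on `ℋ`, as matrices in the natural basis. -/
abbrev Op (m : Fin N → ℕ) : Type := Matrix (Conf m) (Conf m) ℂ

/-- The operator on `ℋ` that acts as `Y` on the `n`-th factor and as the identity on the others. -/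
def site (m : Fin N → ℕ) (n : Fin N) (Y : Matrix (Fin (m n + 1)) (Fin (m n + 1)) ℂ) : Op m :=
  open scoped Classical in
  Matrix.of fun h h' => if ∀ j, j ≠ n → h j = h' j then Y (h n) (h' n) else 0

/-- The Lax operator of site `n`, as a `2 × 2` matrix of operators on `ℋ`. -/
def lax (η : ℂ) (m : Fin N → ℕ) (n : Fin N) (u : ℂ) : Matrix (Fin 2) (Fin 2) (Op m) :=
  !![site m n (u • 1 + η • ((1 / 2 : ℂ) • 1 + spinZ (m n))), site m n (η • spinMinus (m n));
     site m n (η • spinPlus (m n)), site m n (u • 1 + η • ((1 / 2 : ℂ) • 1 - spinZ (m n)))]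

/-- A matrix of numbers, regarded as a matrix of scalar operators on `ℋ`. -/
def scalarOps {ι : Type*} (m : Fin N → ℕ) (A : Matrix ι ι ℂ) : Matrix ι ι (Op m) :=
  A.map (algebraMap ℂ (Op m))

/-- The monodromy matrix `K₀ L_{0N}(u - ξ_N) ⋯ L_{01}(u - ξ_1)`. -/
def monodromy (K : Matrix (Fin 2) (Fin 2) ℂ) (η : ℂ) (m : Fin N → ℕ) (ξ : Fin N → ℂ) (u : ℂ) :
    Matrix (Fin 2) (Fin 2) (Op m) :=
  scalarOps m K * (List.ofFn fun k : Fin N => lax η m k.rev (u - ξ k.rev)).prod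

/-- The transfer matrix `T^{(K)}(u)`: the trace of the monodromy matrix over `ℂ²`. -/
def transfer (K : Matrix (Fin 2) (Fin 2) ℂ) (η : ℂ) (m : Fin N → ℕ) (ξ : Fin N → ℂ) (u : ℂ) :
    Op m :=
  (monodromy K η m ξ u).trace

/-! ### Fusion -/

/-- The symmetrizer `P⁺ = (1/l!) ∑_π P_π` of `(ℂ²)^{⊗l}`, where
`P_π (v₁ ⊗ ⋯ ⊗ v_l) = v_{π(1)} ⊗ ⋯ ⊗ v_{π(l)}`. -/
def symmetrizer (l : ℕ) : Matrix (Fin l → Fin 2) (Fin l → Fin 2) ℂ :=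
  ((l ! : ℕ) : ℂ)⁻¹ • ∑ π : Equiv.Perm (Fin l), Matrix.of fun i j => if i = j ∘ π then 1 else 0

/-- `M_1(u + (l-1)η) ⋯ M_{l-1}(u + η) M_l(u)` on `(ℂ²)^{⊗l} ⊗ ℋ`, as a matrix of operators
on `ℋ`; the factor `M_j` acts on the `j`-th copy of `ℂ²`. -/
def monodromyProduct (K : Matrix (Fin 2) (Fin 2) ℂ) (η : ℂ) (m : Fin N → ℕ) (ξ : Fin N → ℂ)
    (l : ℕ) (u : ℂ) : Matrix (Fin l → Fin 2) (Fin l → Fin 2) (Op m) :=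
  Matrix.of fun i j =>
    (List.ofFn fun k : Fin l =>
      monodromy K η m ξ (u + ((l : ℂ) - 1 - (k : ℕ)) * η) (i k) (j k)).prod

/-- The fused monodromy matrix `P⁺ M_1(u + (l-1)η) ⋯ M_l(u) P⁺`. -/
def fusedMonodromy (K : Matrix (Fin 2) (Fin 2) ℂ) (η : ℂ) (m : Fin N → ℕ) (ξ : Fin N → ℂ)
    (l : ℕ) (u : ℂ) : Matrix (Fin l → Fin 2) (Fin l → Fin 2) (Op m) :=
  scalarOps m (symmetrizer l) * monodromyProduct K η m ξ l u * scalarOps m (symmetrizer l)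

/-- The fused transfer matrix `T^{(K|l)}(u)`. The fused monodromy matrix maps into the image `V⁺`
of the projector `P⁺` and vanishes on the kernel of `P⁺`, so its trace over `V⁺` is its trace over
`(ℂ²)^{⊗l}`. For `l = 0` this is the identity. -/
def fusedTransfer (K : Matrix (Fin 2) (Fin 2) ℂ) (η : ℂ) (m : Fin N → ℕ) (ξ : Fin N → ℂ)
    (l : ℕ) (u : ℂ) : Op m :=
  (fusedMonodromy K η m ξ l u).trace

/-! ### Scalar functions -/

/-- `ξ_n^{(k)} = ξ_n - η/2 + (s_n - k) η`. -/
def node (η : ℂ) (m : Fin N → ℕ) (ξ : Fin N → ℂ) (n : Fin N) (k : ℕ) : ℂ :=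
  ξ n - η / 2 + ((m n : ℂ) / 2 - k) * η

/-- `a(u) = ∏ₙ (u - (ξ_n - η/2) + s_n η)`. -/
def aFun (η : ℂ) (m : Fin N → ℕ) (ξ : Fin N → ℂ) (u : ℂ) : ℂ :=
  ∏ n, (u - (ξ n - η / 2) + (m n : ℂ) / 2 * η)

/-- `d(u) = ∏ₙ (u - (ξ_n - η/2) - s_n η)`. -/
def dFun (η : ℂ) (m : Fin N → ℕ) (ξ : Fin N → ℂ) (u : ℂ) : ℂ :=
  ∏ n, (u - (ξ n - η / 2) - (m n : ℂ) / 2 * η)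

/-- The value `det K · a(u) d(u - η)` of the quantum determinant. -/
def qdet (K : Matrix (Fin 2) (Fin 2) ℂ) (η : ℂ) (m : Fin N → ℕ) (ξ : Fin N → ℂ) (u : ℂ) : ℂ :=
  K.det * (aFun η m ξ u * dFun η m ξ (u - η))

/-- The functions `t^{(l)}` generated from `t` by the fusion relations
`t^{(l+1)}(u) = t(u + lη) t^{(l)}(u) - det_q M(u + lη) t^{(l-1)}(u)`, `t^{(0)} = 1`,
`t^{(1)} = t`. -/
def fusedValue (K : Matrix (Fin 2) (Fin 2) ℂ) (η : ℂ) (m : Fin N → ℕ) (ξ : Fin N → ℂ)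
    (t : ℂ → ℂ) : ℕ → ℂ → ℂ
  | 0, _ => 1
  | 1, u => t u
  | l + 2, u =>
      t (u + ((l : ℂ) + 1) * η) * fusedValue K η m ξ t (l + 1) u
        - qdet K η m ξ (u + ((l : ℂ) + 1) * η) * fusedValue K η m ξ t l u

/-- `t(u) = tr K ∏ₐ (u - ξ_a^{(0)}) + ∑ₐ g_a(u) x_a` with
`g_a(u) = ∏_{b ≠ a} (u - ξ_b^{(0)}) / (ξ_a^{(0)} - ξ_b^{(0)})`. -/
def interpolant (K : Matrix (Fin 2) (Fin 2) ℂ) (η : ℂ) (m : Fin N → ℕ) (ξ : Fin N → ℂ)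
    (x : Fin N → ℂ) (u : ℂ) : ℂ :=
  K.trace * ∏ a, (u - node η m ξ a 0)
    + ∑ a, (∏ b ∈ Finset.univ.erase a,
        (u - node η m ξ b 0) / (node η m ξ a 0 - node η m ξ b 0)) * x a

/-- The tridiagonal `(2sₙ+1) × (2sₙ+1)` matrix `D_{t,n}`: row `i` is
`(…, -k₂ d(ξ_n^{(i)}), t(ξ_n^{(i)}), -k₁ a(ξ_n^{(i)}), …)`. -/
def discreteMatrix (k₁ k₂ η : ℂ) (m : Fin N → ℕ) (ξ : Fin N → ℂ) (t : ℂ → ℂ) (n : Fin N) :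
    Matrix (Fin (m n + 1)) (Fin (m n + 1)) ℂ :=
  Matrix.of fun i j =>
    if j = i then t (node η m ξ n i)
    else if (j : ℕ) = (i : ℕ) + 1 then -(k₁ * aFun η m ξ (node η m ξ n i))
    else if (i : ℕ) = (j : ℕ) + 1 then -(k₂ * dFun η m ξ (node η m ξ n i))
    else 0

/-! ### Spectrum and separation of variables -/

/-- The common eigenspace of the transfer matrices `T^{(K)}(u)`, `u ∈ ℂ`, with eigenvalue `t`. -/
def eigenspace (K : Matrix (Fin 2) (Fin 2) ℂ) (η : ℂ) (m : Fin N → ℕ) (ξ : Fin N → ℂ)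
    (t : ℂ → ℂ) : Submodule ℂ (Conf m → ℂ) where
  carrier := {v | ∀ u, transfer K η m ξ u *ᵥ v = t u • v}
  zero_mem' := fun u => by simp
  add_mem' := fun {v w} hv hw u => by
    rw [Matrix.mulVec_add, hv u, hw u, smul_add]
  smul_mem' := fun c v hv u => by
    rw [Matrix.mulVec_smul, hv u, smul_comm]

/-- The set of eigenvalues `t : ℂ → ℂ` of the family `u ↦ T^{(K)}(u)`. -/
def spectrumT (K : Matrix (Fin 2) (Fin 2) ℂ) (η : ℂ) (m : Fin N → ℕ) (ξ : Fin N → ℂ) :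
    Set (ℂ → ℂ) :=
  {t | ∃ v ∈ eigenspace K η m ξ t, v ≠ 0}

/-- The family is a basis of the space of (co)vectors. -/
def IsBasisFamily {m : Fin N → ℕ} (c : Conf m → (Conf m → ℂ)) : Prop :=
  LinearIndependent ℂ c ∧ Submodule.span ℂ (Set.range c) = ⊤

/-- The family `u ↦ T^{(K)}(u)` is diagonalizable with simple spectrum: there is a basis of common
eigenvectors, with pairwise different eigenvalues. -/
def DiagonalizableSimple (K : Matrix (Fin 2) (Fin 2) ℂ) (η : ℂ) (m : Fin N → ℕ)
    (ξ : Fin N → ℂ) : Prop :=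
  ∃ (v : Conf m → (Conf m → ℂ)) (t : Conf m → (ℂ → ℂ)),
    IsBasisFamily v ∧ Function.Injective t ∧ ∀ i, v i ∈ eigenspace K η m ξ (t i)

/-- The scalar `k₂^{2sₙ-h} ∏_{k=0}^{2sₙ-(h+1)} d(ξ_n^{(2sₙ-k)})`. -/
def sovDenominator (k₂ η : ℂ) (m : Fin N → ℕ) (ξ : Fin N → ℂ) (n : Fin N) (h : ℕ) : ℂ :=
  k₂ ^ (m n - h) * ∏ k ∈ Finset.range (m n - h), dFun η m ξ (node η m ξ n (m n - k))

/-- The covector `⟨h| = ⟨S| ∏ₙ k₂^{h_n-2sₙ} T^{(K|2sₙ-h_n)}(ξ_n^{(2sₙ)}) /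
∏_{k=0}^{2sₙ-(h_n+1)} d(ξ_n^{(2sₙ-k)})`. The factors commute; they are taken in the order
`n = 1, …, N`. -/
def sovCovector (K : Matrix (Fin 2) (Fin 2) ℂ) (k₂ η : ℂ) (m : Fin N → ℕ) (ξ : Fin N → ℂ)
    (S : Conf m → ℂ) (h : Conf m) : Conf m → ℂ :=
  S ᵥ* (List.ofFn fun n : Fin N =>
    (sovDenominator k₂ η m ξ n (h n))⁻¹ •
      fusedTransfer K η m ξ (m n - (h n : ℕ)) (node η m ξ n (m n))).prod

end

end HigherSpin

open HigherSpin

/-! The argument is separation of variables in the covectors generated by the fused transfer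
matrices. It rests on three facts about the operators and one genericity argument. (a) Fusion. The
quantum determinant relation `QDet` says that reordering neighbouring columns does not change the
symmetrized product of monodromy matrices. The trace over the symmetric subspace then reduces to a
sum over the number of ones in a word, and `fusedTransfer_eq_fusionSeq` shows that the fused
transfer matrices obey the same three-term recursion as the functions $t^{(l)}$. They therefore act
on an eigenvector with eigenvalue $t$ by $t^{(l)}$. (b) Commutativity. The exchange relation with
the rational $R$-matrix gives `commute_transfer`. (c) Closure. At the last node of site $n$ the
fused transfer matrix of level $2s_n+1$ vanishes (`fusedTransfer_eq_zero`). In the realization of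
spin $s$ on polynomials of degree at most $2s$, each Lax operator in the product raises by one the
order of vanishing at the auxiliary variable $z$, and after $2s+1$ steps nothing is left. On an
eigenvalue this reads $t^{(2s_n+1)}(\xi_n^{(2s_n)})=0$, which is $\det D_{t,n}=0$ by expansion of
the tridiagonal determinant (`det_discreteMatrix`).

Suppose now that the covectors $\langle h|$ form a basis. The wavefunction of an eigenvector is
$\langle S|v\rangle$ times a function of $t$ alone, so eigenspaces are lines and can be normalized
by $\langle S|v\rangle=1$. Conversely, given an interpolant $t$ with all $\det D_{t,n}=0$, let $v$
be the vector with the separated wavefunction. For fixed $h$ the functions $\langle h|T(u)|v\rangle$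
and $t(u)\langle h|v\rangle$ are polynomials of degree at most $N$ with the same coefficient of
$u^N$, and by the fusion recursion they agree at the $N$ points $\xi_n^{(h_n)}$; closure covers the
end $h_n=0$ and the zero of the quantum determinant the end $h_n=2s_n$. This is
`mem_eigenspace_of_dotProduct`.

The basis property and diagonalizability are each the nonvanishing of a polynomial in $\xi$, so one
good point suffices. The points $\xi_j=j/e$ with $e\to0$ provide it: after rescaling, the transfer
matrix near site $n$ tends to an affine function of the $\mathfrak{sl}_2$ element `spinOp` of the
twist on that site alone (`scaledTransfer_zero`). The fused transfer matrices tend to polynomials in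
it of exact degree $l$, and a non-scalar $K$ has a cyclic covector in every spin representation
(`exists_cyclic_covector`), which gives the basis (`exists_det_sovOp_ne_zero`). If $k_1\ne k_2$, the
local operators have simple spectra, and a combination with mixed radix weights has simple spectrum
on the whole chain (`hasSimpleEigenbasis_scaledCombination_zero`). -/

namespace HigherSpin

/-! ### Fusion from the quantum determinant: words in column polynomials -/

section Fusion

variable {R : Type*} [Ring R]

/-- A column of a `2 × 2` matrix as a linear polynomial. -/
noncomputable def colPoly (A : Matrix (Fin 2) (Fin 2) R) (j : Fin 2) : R[X] :=
  C (A 0 j) + C (A 1 j) * X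

/-- The product of the column polynomials of `M (l - 1), …, M 0`, the last `p` of them for the
column `1`. -/
noncomputable def sortedWord (M : ℕ → Matrix (Fin 2) (Fin 2) R) : ℕ → ℕ → R[X]
  | 0, _ => 1
  | l + 1, p => if p ≤ l then colPoly (M l) 0 * sortedWord M l p
      else colPoly (M l) 1 * sortedWord M l (p - 1)

theorem coeff_colPoly_mul_zero (A : Matrix (Fin 2) (Fin 2) R) (j : Fin 2) (F : R[X]) :
    (colPoly A j * F).coeff 0 = A 0 j * F.coeff 0 := by
  simp [colPoly, add_mul, mul_assoc]

theorem coeff_colPoly_mul_succ (A : Matrix (Fin 2) (Fin 2) R) (j : Fin 2) (F : R[X]) (p : ℕ) :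
    (colPoly A j * F).coeff (p + 1) = A 0 j * F.coeff (p + 1) + A 1 j * F.coeff p := by
  simp [colPoly, add_mul, mul_assoc]

theorem natDegree_sortedWord_le (M : ℕ → Matrix (Fin 2) (Fin 2) R) (l p : ℕ) :
    (sortedWord M l p).natDegree ≤ l := by
  induction l generalizing p with
  | zero => simp [sortedWord]
  | succ l ih =>
    have hcol : ∀ j, (colPoly (M l) j).natDegree ≤ 1 := fun j => by
      unfold colPoly
      compute_degree
    rw [sortedWord]
    split_ifs
    · exact natDegree_mul_le.trans (by linarith [hcol 0, ih p])
    · exact natDegree_mul_le.trans (by linarith [hcol 1, ih (p - 1)])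

variable [Algebra ℂ R]

/-- The sequence generated by the fusion recursion from the values `τ l` of a transfer matrix and
`q l` of the quantum determinant. -/
def fusionSeq (τ : ℕ → R) (q : ℕ → ℂ) : ℕ → R
  | 0 => 1
  | 1 => τ 0
  | l + 2 => τ (l + 1) * fusionSeq τ q (l + 1) - q (l + 1) • fusionSeq τ q l

/-- `A` and `B` are the values of a monodromy matrix at `u` and `u - η`, with quantum
determinant `q`. -/
def QDet (A B : Matrix (Fin 2) (Fin 2) R) (q : ℂ) : Prop :=
  ∀ i j, A i 0 * B j 1 - A i 1 * B j 0 = q • (!![0, 1; -1, 0] : Matrix (Fin 2) (Fin 2) R) i j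

/-- The variable of `colPoly` records the number of row indices equal to 1, so the coefficients are
symmetric in the two row indices. The right side of `QDet` is antisymmetric in them and drops out.
-/
theorem colPoly_swap {A B : Matrix (Fin 2) (Fin 2) R} {q : ℂ} (h : QDet A B q) :
    colPoly A 1 * colPoly B 0 = colPoly A 0 * colPoly B 1 := by
  have h00 := h 0 0
  have h01 := h 0 1
  have h10 := h 1 0
  have h11 := h 1 1
  simp at h00 h01 h10 h11
  ext p
  rcases p with _ | _ | p
  · rw [coeff_colPoly_mul_zero, coeff_colPoly_mul_zero]
    simp [colPoly]
    exact (sub_eq_zero.1 h00).symm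
  · rw [coeff_colPoly_mul_succ, coeff_colPoly_mul_succ]
    simp [colPoly]
    -- Only the sum over the two mixed row words occurs in the coefficient of $X$; the contributions
    -- $q$ and $-q$ cancel.
    have : A 0 0 * B 1 1 - A 0 1 * B 1 0 + (A 1 0 * B 0 1 - A 1 1 * B 0 0) = 0 := by
      rw [h01, h10]; abel
    rw [← sub_eq_zero, ← neg_eq_zero, ← this]
    abel
  · rw [coeff_colPoly_mul_succ, coeff_colPoly_mul_succ]
    rcases p with _ | p
    · simp [colPoly]
      exact (sub_eq_zero.1 h11).symm
    · simp [colPoly]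

/-- The antisymmetric counterpart of `colPoly_swap`: with the row index of the left factor fixed at
1, the quantum determinant survives. It is the source of the second term of the fusion recursion. -/
theorem colPoly_qdet {A B : Matrix (Fin 2) (Fin 2) R} {q : ℂ} (h : QDet A B q) :
    C (A 1 1) * colPoly B 0 - C (A 1 0) * colPoly B 1 = C (algebraMap ℂ R q) := by
  have h10 := h 1 0
  have h11 := h 1 1
  simp at h10 h11
  rw [colPoly, colPoly, mul_add, mul_add, ← mul_assoc, ← mul_assoc, ← C_mul, ← C_mul, ← C_mul,
    ← C_mul, add_sub_add_comm, ← C_sub, ← sub_mul, ← C_sub, ← neg_sub (A 1 0 * B 1 1), h11,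
    ← neg_sub (A 1 0 * B 0 1), h10]
  simp [Algebra.smul_def]

variable {M : ℕ → Matrix (Fin 2) (Fin 2) R} {q : ℕ → ℂ}

/-- A leading column 1 is moved to the right past all columns 0 by repeated use of `colPoly_swap`.
-/
theorem colPoly_one_mul_sortedWord (h : ∀ l, QDet (M (l + 1)) (M l) (q (l + 1))) (l p : ℕ)
    (hp : p ≤ l) : colPoly (M l) 1 * sortedWord M l p = sortedWord M (l + 1) (p + 1) := by
  induction l generalizing p with
  | zero =>
    obtain rfl : p = 0 := by omega
    simp [sortedWord]
  | succ l ih =>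
    change _ = if p + 1 ≤ l + 1 then colPoly (M (l + 1)) 0 * sortedWord M (l + 1) (p + 1)
      else colPoly (M (l + 1)) 1 * sortedWord M (l + 1) p
    by_cases hpl : p ≤ l
    · rw [if_pos (by omega), sortedWord, if_pos hpl]
      rw [← mul_assoc, colPoly_swap (h l), mul_assoc, ih p hpl]
    · obtain rfl : p = l + 1 := by omega
      simp

/-- The $p$-th term is the diagonal element of the fused monodromy matrix at weight $p$, so the sum
is its trace over the symmetric subspace. Splitting off the leftmost factor gives the trace of that
factor times the previous sum, up to a mismatch between its entries (1,0) and (1,1), which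
`colPoly_qdet` evaluates. -/
theorem sum_coeff_sortedWord (h : ∀ l, QDet (M (l + 1)) (M l) (q (l + 1))) (l : ℕ) :
    ∑ p ∈ Finset.range (l + 1), (sortedWord M l p).coeff p =
      fusionSeq (fun l => (M l).trace) q l := by
  induction l using Nat.strong_induction_on with
  | _ l ih =>
  match l, ih with
  | 0, _ => simp [sortedWord, fusionSeq]
  | 1, _ =>
    simp [Finset.sum_range_succ, sortedWord, fusionSeq, colPoly, Matrix.trace]
  | l + 2, ih =>
    rw [fusionSeq, ← ih l (by omega), ← ih (l + 1) (by omega), Finset.sum_range_succ]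
    have e1 : ∀ p ∈ Finset.range (l + 1 + 1), (sortedWord M (l + 2) p).coeff p =
        (colPoly (M (l + 1)) 0 * sortedWord M (l + 1) p).coeff p := by
      intro p hp
      rw [sortedWord, if_pos (by simpa [Nat.lt_succ_iff] using hp)]
    rw [Finset.sum_congr rfl e1]
    -- In the word of ones alone, the entry (0,1) would need a coefficient of degree $l+2$ in a word
    -- of length $l+1$.
    have e2 : (sortedWord M (l + 2) (l + 2)).coeff (l + 2) =
        M (l + 1) 1 1 * (sortedWord M (l + 1) (l + 1)).coeff (l + 1) := by
      rw [sortedWord, if_neg (by omega), coeff_colPoly_mul_succ,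
        coeff_eq_zero_of_natDegree_lt (lt_of_le_of_lt (natDegree_sortedWord_le _ _ _) (by omega))]
      simp
    have e3 : ∑ p ∈ Finset.range (l + 1 + 1),
        (colPoly (M (l + 1)) 0 * sortedWord M (l + 1) p).coeff p =
        M (l + 1) 0 0 * ∑ p ∈ Finset.range (l + 1 + 1), (sortedWord M (l + 1) p).coeff p +
        ∑ p ∈ Finset.range (l + 1), M (l + 1) 1 0 * (sortedWord M (l + 1) (p + 1)).coeff p := by
      rw [Finset.sum_range_succ', Finset.sum_range_succ' _ (l + 1)]
      simp only [coeff_colPoly_mul_zero, coeff_colPoly_mul_succ, Finset.sum_add_distrib, mul_add,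
        Finset.mul_sum]
      abel
    -- Both words are the column 0 or 1 of `M l` times the same word of length $l$, so the entries
    -- of `M (l + 1)` combine with these columns to the quantum determinant.
    have e4 : ∑ p ∈ Finset.range (l + 1), M (l + 1) 1 1 * (sortedWord M (l + 1) p).coeff p -
        ∑ p ∈ Finset.range (l + 1), M (l + 1) 1 0 * (sortedWord M (l + 1) (p + 1)).coeff p =
        q (l + 1) • ∑ p ∈ Finset.range (l + 1), (sortedWord M l p).coeff p := by
      rw [← Finset.sum_sub_distrib, Finset.smul_sum]
      refine Finset.sum_congr rfl fun p hp => ?_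
      have hp' : p ≤ l := by simpa [Nat.lt_succ_iff] using hp
      rw [← colPoly_one_mul_sortedWord h l p hp', sortedWord, if_pos hp', ← coeff_C_mul,
        ← coeff_C_mul, ← coeff_sub, ← mul_assoc, ← mul_assoc, ← sub_mul, colPoly_qdet (h l),
        coeff_C_mul, Algebra.smul_def]
    rw [e2, e3, ← e4]
    rw [Matrix.trace_fin_two, add_mul, Finset.sum_range_succ, mul_add, mul_add, Finset.mul_sum,
      Finset.mul_sum]
    abel

/-- The product of the column polynomials along a word depends only on the number of `1`s. -/
theorem sum_word (h : ∀ l, QDet (M (l + 1)) (M l) (q (l + 1))) (l : ℕ) (k : Fin l → Fin 2) :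
    ∑ i : Fin l → Fin 2,
      C ((List.ofFn fun a : Fin l => M (a.rev : ℕ) (i a) (k a)).prod) * X ^ (∑ a, (i a : ℕ)) =
      sortedWord M l (∑ a, (k a : ℕ)) := by
  induction l with
  | zero => simp [sortedWord]
  | succ l ih =>
    have hle : ∑ a : Fin l, (k a.succ : ℕ) ≤ l := by
      calc _ ≤ ∑ a : Fin l, 1 := Finset.sum_le_sum fun a _ => by omega
        _ = l := by simp
    have hw : sortedWord M (l + 1) (∑ a, (k a : ℕ)) =
        colPoly (M l) (k 0) * sortedWord M l (∑ a : Fin l, (k a.succ : ℕ)) := by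
      rw [Fin.sum_univ_succ]
      rcases Fin.exists_fin_two.1 ⟨k 0, rfl⟩ with h0 | h0
      · rw [h0, Fin.val_zero, zero_add, sortedWord, if_pos hle]
      · rw [h0, Fin.val_one, colPoly_one_mul_sortedWord h _ _ hle, add_comm 1]
    rw [hw, ← ih, ← (Fin.consEquiv fun _ => Fin 2).sum_comp, Fintype.sum_prod_type,
      Fin.sum_univ_two, colPoly, add_mul, Finset.mul_sum, Finset.mul_sum]
    congr 1
    · refine Finset.sum_congr rfl fun i _ => ?_
      simp [Fin.consEquiv, List.ofFn_succ, Fin.sum_univ_succ, mul_assoc]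
    · refine Finset.sum_congr rfl fun i _ => ?_
      simp [Fin.consEquiv, List.ofFn_succ, Fin.sum_univ_succ, mul_assoc, pow_add]
      congr 1
      rw [← mul_assoc, ← mul_assoc, X_mul_C]

end Fusion

/-! ### Functoriality, homogeneity and continuity of the fusion recursion -/

section FusionSeq

variable {R R' : Type*} [Ring R] [Algebra ℂ R] [Ring R'] [Algebra ℂ R']

theorem map_fusionSeq (f : R →ₐ[ℂ] R') (τ : ℕ → R) (q : ℕ → ℂ) (l : ℕ) :
    f (fusionSeq τ q l) = fusionSeq (fun l => f (τ l)) q l := by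
  induction l using Nat.strong_induction_on with
  | _ l ih =>
  match l, ih with
  | 0, _ => simp [fusionSeq]
  | 1, _ => simp [fusionSeq]
  | l + 2, ih =>
    simp only [fusionSeq, map_sub, map_mul, map_smul]
    rw [ih l (by omega), ih (l + 1) (by omega)]

theorem fusionSeq_smul (σ : ℂ) (τ : ℕ → R) (q : ℕ → ℂ) (l : ℕ) :
    fusionSeq (fun l => σ • τ l) (fun l => σ ^ 2 * q l) l = σ ^ l • fusionSeq τ q l := by
  induction l using Nat.strong_induction_on with
  | _ l ih =>
  match l, ih with
  | 0, _ => simp [fusionSeq]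
  | 1, _ => simp [fusionSeq]
  | l + 2, ih =>
    simp only [fusionSeq]
    rw [ih l (by omega), ih (l + 1) (by omega), smul_sub, smul_mul_smul_comm, smul_smul, smul_smul]
    congr 2 <;> ring

theorem fusionSeq_congr {τ τ' : ℕ → R} {q q' : ℕ → ℂ} {n : ℕ} (hτ : ∀ l < n, τ l = τ' l)
    (hq : ∀ l < n, q l = q' l) {l : ℕ} (hl : l ≤ n) : fusionSeq τ q l = fusionSeq τ' q' l := by
  induction l using Nat.strong_induction_on with
  | _ l ih =>
  match l, ih with
  | 0, _ => simp [fusionSeq]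
  | 1, _ => simp [fusionSeq, hτ 0 (by omega)]
  | l + 2, ih =>
    simp only [fusionSeq]
    rw [ih l (by omega) (by omega), ih (l + 1) (by omega) (by omega), hτ _ (by omega),
      hq _ (by omega)]

theorem commute_fusionSeq {x : R} {τ : ℕ → R} (h : ∀ l, Commute x (τ l)) (q : ℕ → ℂ) (l : ℕ) :
    Commute x (fusionSeq τ q l) := by
  induction l using Nat.strong_induction_on with
  | _ l ih =>
  match l, ih with
  | 0, _ => exact Commute.one_right x
  | 1, _ => exact h 0
  | l + 2, ih =>
    exact ((h _).mul_right (ih (l + 1) (by omega))).sub_right ((ih l (by omega)).smul_right _)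

theorem fusionSeq_mulVec {ι : Type*} [Fintype ι] [DecidableEq ι] {τ : ℕ → Matrix ι ι ℂ}
    {t : ℕ → ℂ} {v : ι → ℂ} (h : ∀ l, τ l *ᵥ v = t l • v) (q : ℕ → ℂ) (l : ℕ) :
    fusionSeq τ q l *ᵥ v = fusionSeq t q l • v := by
  induction l using Nat.strong_induction_on with
  | _ l ih =>
  match l, ih with
  | 0, _ => simp [fusionSeq]
  | 1, _ => simp [fusionSeq, h]
  | l + 2, ih =>
    simp only [fusionSeq]
    rw [sub_mulVec, ← mulVec_mulVec, ih (l + 1) (by omega), mulVec_smul, h, smul_mulVec,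
      ih l (by omega), smul_smul, smul_smul, ← sub_smul, mul_comm, smul_eq_mul]

theorem continuous_fusionSeq [TopologicalSpace R] [IsTopologicalRing R] [ContinuousConstSMul ℂ R]
    [ContinuousSMul ℂ R] {τ : ℂ → ℕ → R} {q : ℂ → ℕ → ℂ} (hτ : ∀ l, Continuous fun e => τ e l)
    (hq : ∀ l, Continuous fun e => q e l) (l : ℕ) :
    Continuous fun e => fusionSeq (τ e) (q e) l := by
  induction l using Nat.strong_induction_on with
  | _ l ih =>
  match l, ih with
  | 0, _ => exact continuous_const
  | 1, _ => exact hτ 0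
  | l + 2, ih =>
    exact ((hτ _).mul (ih (l + 1) (by omega))).sub ((hq _).smul (ih l (by omega)))

theorem fusedValue_eq_fusionSeq (K : Matrix (Fin 2) (Fin 2) ℂ) (η : ℂ) {N : ℕ} (m : Fin N → ℕ)
    (ξ : Fin N → ℂ) (t : ℂ → ℂ) (l : ℕ) (u : ℂ) :
    fusedValue K η m ξ t l u =
      fusionSeq (fun l => t (u + l * η)) (fun l => qdet K η m ξ (u + l * η)) l := by
  induction l using Nat.strong_induction_on with
  | _ l ih =>
  match l, ih with
  | 0, _ => simp [fusionSeq, fusedValue]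
  | 1, _ => simp [fusionSeq, fusedValue]
  | l + 2, ih =>
    simp only [fusionSeq, fusedValue]
    rw [ih l (by omega), ih (l + 1) (by omega)]
    simp

end FusionSeq

/-! ### Exchange relations -/

section Exchange

variable {R R' : Type*} [Ring R] [Ring R']

/-- All entries of `A` commute with all entries of `B`. -/
def EntriesCommute {ι κ ι' κ' : Type*} (A : Matrix ι κ R) (B : Matrix ι' κ' R) : Prop :=
  ∀ i j k l, Commute (A i j) (B k l)

theorem EntriesCommute.symm {ι κ ι' κ' : Type*} {A : Matrix ι κ R} {B : Matrix ι' κ' R}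
    (h : EntriesCommute A B) : EntriesCommute B A := fun i j k l => (h k l i j).symm

theorem EntriesCommute.mul_right {ι κ ι' κ' κ'' : Type*} [Fintype κ'] {A : Matrix ι κ R}
    {B : Matrix ι' κ' R} {C : Matrix κ' κ'' R} (hB : EntriesCommute A B)
    (hC : EntriesCommute A C) : EntriesCommute A (B * C) := fun i j k l => by
  rw [Matrix.mul_apply]
  exact Commute.sum_right _ _ _ fun x _ => (hB i j k x).mul_right (hC i j x l)

theorem EntriesCommute.one_right {ι κ ι' : Type*} [DecidableEq ι'] (A : Matrix ι κ R) :
    EntriesCommute A (1 : Matrix ι' ι' R) := fun i j k l => by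
  rw [Matrix.one_apply]
  split_ifs
  · exact Commute.one_right _
  · exact Commute.zero_right _

/-- Over a noncommutative ring the trace is not cyclic; this is the substitute. It serves for scalar
matrices and for monodromy matrices of disjoint sets of sites. -/
theorem EntriesCommute.trace_mul_comm {ι : Type*} [Fintype ι] {A B : Matrix ι ι R}
    (h : EntriesCommute A B) : (A * B).trace = (B * A).trace := by
  simp only [Matrix.trace, Matrix.diag, Matrix.mul_apply]
  rw [Finset.sum_comm]
  exact Finset.sum_congr rfl fun i _ => Finset.sum_congr rfl fun j _ => h j i i j

/-- The products of the entries of `A` and `B`, as a matrix on `ℂ² ⊗ ℂ²`. -/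
def entryProd (A B : Matrix (Fin 2) (Fin 2) R) : Matrix (Fin 2 × Fin 2) (Fin 2 × Fin 2) R :=
  Matrix.of fun i j => A i.1 j.1 * B i.2 j.2

theorem entryProd_mul {A A' B B' : Matrix (Fin 2) (Fin 2) R} (h : EntriesCommute B A') :
    entryProd (A * B) (A' * B') = entryProd A A' * entryProd B B' := by
  ext i j
  simp only [entryProd, Matrix.of_apply, Matrix.mul_apply, Finset.sum_mul_sum,
    Fintype.sum_prod_type]
  exact Finset.sum_congr rfl fun c _ => Finset.sum_congr rfl fun d _ =>
    (h c j.1 i.2 d).mul_mul_mul_comm _ _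

theorem trace_entryProd (A B : Matrix (Fin 2) (Fin 2) R) :
    (entryProd A B).trace = A.trace * B.trace := by
  simp [Matrix.trace, entryProd, Fintype.sum_prod_type, mul_add, add_mul]
  abel

variable [Algebra ℂ R] [Algebra ℂ R']

theorem entriesCommute_algebraMap {ι κ ι' κ' : Type*} (A : Matrix ι κ R) (B : Matrix ι' κ' ℂ) :
    EntriesCommute A (B.map (algebraMap ℂ R)) := fun i j k l =>
  (Algebra.commutes (B k l) (A i j)).symm

theorem QDet.mul {A A' B B' : Matrix (Fin 2) (Fin 2) R} {p q : ℂ} (hA : QDet A A' p)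
    (hB : QDet B B' q) (h : EntriesCommute B A') : QDet (A * B) (A' * B') (p * q) := by
  intro i j
  have e1 : ∀ c a d b, A i c * B c a * (A' j d * B' d b) = A i c * A' j d * (B c a * B' d b) :=
    fun c a d b => (h c a j d).mul_mul_mul_comm _ _
  have e2 : (A * B) i 0 * (A' * B') j 1 - (A * B) i 1 * (A' * B') j 0 =
      ∑ c, ∑ d, A i c * A' j d * (B c 0 * B' d 1 - B c 1 * B' d 0) := by
    simp only [Matrix.mul_apply, Finset.sum_mul_sum, e1, mul_sub, Finset.sum_sub_distrib]
  have hA' := hA i j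
  simp only [hB _ _] at e2
  rw [e2, mul_comm, mul_smul, ← hA']
  simp [Fin.sum_univ_two, sub_eq_add_neg, add_comm]

theorem QDet.map {A B : Matrix (Fin 2) (Fin 2) R} {q : ℂ} (h : QDet A B q) (f : R →ₐ[ℂ] R') :
    QDet (A.map f) (B.map f) q := by
  intro i j
  have := congrArg f (h i j)
  simp only [map_sub, map_mul, map_smul] at this
  simp only [Matrix.map_apply, this]
  congr 1
  fin_cases i <;> fin_cases j <;> simp

/-- The braid form `η + c P` of the rational `R`-matrix. -/
def braid (η c : ℂ) : Matrix (Fin 2 × Fin 2) (Fin 2 × Fin 2) ℂ :=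
  η • 1 + c • Matrix.of fun i j => if i = j.swap then 1 else 0

theorem braid_mul_braid (η c : ℂ) : braid η c * braid η (-c) = (η ^ 2 - c ^ 2) • 1 := by
  have h : (Matrix.of fun i j => if i = j.swap then 1 else 0 :
      Matrix (Fin 2 × Fin 2) (Fin 2 × Fin 2) ℂ) *
      (Matrix.of fun i j => if i = j.swap then 1 else 0) = 1 := by
    ext i j
    rw [Matrix.mul_apply, Finset.sum_eq_single j.swap]
    · simp [Matrix.one_apply]
    · intro b _ hb
      simp [hb]
    · simp
  simp only [braid, add_mul, mul_add, Matrix.smul_mul, Matrix.mul_smul, h, one_mul, mul_one,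
    smul_smul]
  module

/-- The exchange relation of the values of a monodromy matrix at two points with difference `c`. -/
def Exchange (η c : ℂ) (A B : Matrix (Fin 2) (Fin 2) R) : Prop :=
  (braid η c).map (algebraMap ℂ R) * entryProd A B =
    entryProd B A * (braid η c).map (algebraMap ℂ R)

theorem exchange_iff (η c : ℂ) (A B : Matrix (Fin 2) (Fin 2) R) : Exchange η c A B ↔
    ∀ i k j l, η • (A i j * B k l) + c • (A k j * B i l) =
      η • (B i j * A k l) + c • (B i l * A k j) := by
  have e1 : ∀ X : Matrix (Fin 2 × Fin 2) (Fin 2 × Fin 2) R, ∀ i j,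
      ((braid η c).map (algebraMap ℂ R) * X) i j = η • X i j + c • X i.swap j := by
    intro X i j
    rw [Matrix.mul_apply]
    have : ∀ x, (braid η c).map (algebraMap ℂ R) i x * X x j =
        (if i = x then η • X x j else 0) + (if i.swap = x then c • X x j else 0) := by
      intro x
      have hx : i = x.swap ↔ i.swap = x := ⟨fun h => by simp [h], fun h => by simp [← h]⟩
      simp only [braid, Matrix.map_apply, Matrix.add_apply, Matrix.smul_apply, Matrix.one_apply,
        Matrix.of_apply, hx, map_add, add_mul, smul_eq_mul, Algebra.smul_def (A := R)]
      congr 1 <;> split_ifs <;> simp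
    simp only [this, Finset.sum_add_distrib, Finset.sum_ite_eq, Finset.mem_univ, if_true]
  have e2 : ∀ X : Matrix (Fin 2 × Fin 2) (Fin 2 × Fin 2) R, ∀ i j,
      (X * (braid η c).map (algebraMap ℂ R)) i j = η • X i j + c • X i j.swap := by
    intro X i j
    rw [Matrix.mul_apply]
    have : ∀ x, X i x * (braid η c).map (algebraMap ℂ R) x j =
        (if x = j then η • X i x else 0) + (if x = j.swap then c • X i x else 0) := by
      intro x
      simp only [braid, Matrix.map_apply, Matrix.add_apply, Matrix.smul_apply, Matrix.one_apply,
        Matrix.of_apply, map_add, mul_add, smul_eq_mul, Algebra.smul_def (A := R)]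
      congr 1 <;> split_ifs <;> simp [Algebra.commutes]
    simp only [this, Finset.sum_add_distrib, Finset.sum_ite_eq', Finset.mem_univ, if_true]
  rw [Exchange, ← Matrix.ext_iff]
  simp only [e1, e2, Prod.forall, entryProd, Matrix.of_apply, Prod.swap]

theorem Exchange.mul {η c : ℂ} {A A' B B' : Matrix (Fin 2) (Fin 2) R} (hA : Exchange η c A A')
    (hB : Exchange η c B B') (h : EntriesCommute B A') (h' : EntriesCommute B' A) :
    Exchange η c (A * B) (A' * B') := by
  unfold Exchange at *
  rw [entryProd_mul h, entryProd_mul h', ← Matrix.mul_assoc, hA, Matrix.mul_assoc, hB,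
    Matrix.mul_assoc]

theorem Exchange.map {η c : ℂ} {A B : Matrix (Fin 2) (Fin 2) R} (h : Exchange η c A B)
    (f : R →ₐ[ℂ] R') : Exchange η c (A.map f) (B.map f) := by
  rw [exchange_iff] at *
  intro i k j l
  have := congrArg f (h i k j l)
  simpa only [map_add, map_mul, map_smul, Matrix.map_apply] using this

theorem exchange_algebraMap (η c : ℂ) (A : Matrix (Fin 2) (Fin 2) ℂ) :
    Exchange η c (A.map (algebraMap ℂ R)) (A.map (algebraMap ℂ R)) := by
  rw [exchange_iff]
  intro i k j l
  simp only [Matrix.map_apply, ← map_mul]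
  rw [mul_comm (A i l)]

theorem qdet_algebraMap (A : Matrix (Fin 2) (Fin 2) ℂ) :
    QDet (A.map (algebraMap ℂ R)) (A.map (algebraMap ℂ R)) A.det := by
  intro i j
  simp only [Matrix.map_apply, ← map_mul, ← map_sub]
  rw [Matrix.det_fin_two]
  fin_cases i <;> fin_cases j <;> simp [Algebra.smul_def, -map_sub, -map_mul, ← map_neg,
    mul_comm]

/-- Conjugation by the braid matrix turns one product of monodromy matrices into the other, and its
entries are scalars, so the trace does not see it. The condition on $c$ is the invertibility of the
braid matrix. -/
theorem Exchange.commute_trace {η c : ℂ} {A B : Matrix (Fin 2) (Fin 2) R}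
    (h : Exchange η c A B) (hc : η ^ 2 ≠ c ^ 2) : Commute A.trace B.trace := by
  have hb : ∀ c, (braid η c).map (algebraMap ℂ R) * (braid η (-c)).map (algebraMap ℂ R) =
      (η ^ 2 - c ^ 2) • 1 := by
    intro c
    rw [← Matrix.map_mul, braid_mul_braid]
    ext i j
    simp only [Matrix.map_apply, Matrix.smul_apply, Matrix.one_apply]
    split_ifs <;> simp [Algebra.smul_def (A := R)]
  have h1 : ((braid η (-c)).map (algebraMap ℂ R) *
      ((braid η c).map (algebraMap ℂ R) * entryProd A B)).trace =
      (η ^ 2 - c ^ 2) • (A.trace * B.trace) := by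
    have := hb (-c)
    rw [neg_neg, neg_sq] at this
    rw [← Matrix.mul_assoc, this, Matrix.smul_mul, Matrix.one_mul, Matrix.trace_smul,
      trace_entryProd]
  rw [h, ← ((entriesCommute_algebraMap _ _).trace_mul_comm), Matrix.mul_assoc, hb,
    Matrix.mul_smul, Matrix.mul_one, Matrix.trace_smul, trace_entryProd] at h1
  exact ((smul_right_injective R (sub_ne_zero.2 hc)) h1).symm

end Exchange

/-! ### Spin operators -/

section Spin

theorem spinPlus_mul_spinMinus (m : ℕ) : spinPlus m * spinMinus m =
    Matrix.diagonal fun i : Fin (m + 1) => ((i : ℕ) + 1 : ℂ) * ((m : ℂ) - (i : ℕ)) := by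
  ext i k
  rw [Matrix.mul_apply, Matrix.diagonal_apply]
  by_cases hi : (i : ℕ) + 1 < m + 1
  · rw [Finset.sum_eq_single ⟨(i : ℕ) + 1, hi⟩]
    · by_cases hik : i = k
      · subst hik
        simp only [spinPlus, spinMinus, Matrix.of_apply, Matrix.transpose_apply, if_true]
        rw [← Complex.ofReal_mul, Real.mul_self_sqrt]
        · push_cast; ring
        · have : ((i : ℕ) : ℝ) + 1 < m + 1 := by exact_mod_cast hi
          exact mul_nonneg (by positivity) (by linarith)
      · have : ¬ ((i : ℕ) = k) := fun h => hik (Fin.ext h)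
        simp [spinPlus, spinMinus, hik, this]
    · intro b _ hb
      have : ¬ ((b : ℕ) = i + 1) := fun h => hb (Fin.ext h)
      simp [spinPlus, this]
    · simp
  · have him : (i : ℕ) = m := by omega
    rw [Finset.sum_eq_zero]
    · split_ifs <;> simp [him]
    · intro b _
      have : ¬ ((b : ℕ) = i + 1) := by omega
      simp [spinPlus, this]

theorem spinMinus_mul_spinPlus (m : ℕ) : spinMinus m * spinPlus m =
    Matrix.diagonal fun i : Fin (m + 1) => ((i : ℕ) : ℂ) * ((m : ℂ) + 1 - (i : ℕ)) := by
  ext i k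
  rw [Matrix.mul_apply, Matrix.diagonal_apply]
  rcases Nat.eq_zero_or_pos (i : ℕ) with hi | hi
  · rw [Finset.sum_eq_zero]
    · split_ifs <;> simp [hi]
    · intro b _
      have : ¬ ((i : ℕ) = b + 1) := by omega
      simp [spinPlus, spinMinus, this]
  · rw [Finset.sum_eq_single ⟨(i : ℕ) - 1, by omega⟩]
    · have h1 : (i : ℕ) = (i : ℕ) - 1 + 1 := by omega
      by_cases hik : i = k
      · subst hik
        simp only [spinPlus, spinMinus, Matrix.of_apply, Matrix.transpose_apply, if_pos h1]
        rw [← Complex.ofReal_mul, Real.mul_self_sqrt]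
        · push_cast [Nat.cast_sub hi]; simp
        · have : ((i : ℕ) : ℝ) < m + 1 := by exact_mod_cast i.2
          push_cast [Nat.cast_sub hi]
          exact mul_nonneg (by simp) (by linarith)
      · have : ¬ ((k : ℕ) = (i : ℕ) - 1 + 1) := fun h => hik (Fin.ext (by omega))
        simp [spinPlus, spinMinus, hik, this]
    · intro b _ hb
      have : ¬ ((i : ℕ) = b + 1) := fun h => hb (Fin.ext (by simp; omega))
      simp [spinPlus, spinMinus, this]
    · simp

theorem spinZ_mul_spinPlus (m : ℕ) : spinZ m * spinPlus m = spinPlus m * spinZ m + spinPlus m := by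
  ext i j
  rw [spinZ, Matrix.diagonal_mul, Matrix.add_apply, Matrix.mul_diagonal]
  simp only [spinPlus, Matrix.of_apply]
  split_ifs with h
  · rw [h]; push_cast; ring
  · simp

theorem spinZ_mul_spinMinus (m : ℕ) :
    spinZ m * spinMinus m = spinMinus m * spinZ m - spinMinus m := by
  have h := congrArg Matrix.transpose (spinZ_mul_spinPlus m)
  have hz : (spinZ m)ᵀ = spinZ m := Matrix.diagonal_transpose _
  simp only [Matrix.transpose_mul, Matrix.transpose_add, hz] at h
  simp only [spinMinus, h]
  abel

/-- The local Lax operator, as a matrix of operators on the spin space. -/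
noncomputable def localLax (η : ℂ) (m : ℕ) (u : ℂ) :
    Matrix (Fin 2) (Fin 2) (Matrix (Fin (m + 1)) (Fin (m + 1)) ℂ) :=
  !![u • 1 + η • ((1 / 2 : ℂ) • 1 + spinZ m), η • spinMinus m;
     η • spinPlus m, u • 1 + η • ((1 / 2 : ℂ) • 1 - spinZ m)]

theorem localLax_eq (η : ℂ) (m : ℕ) (u : ℂ) : localLax η m u = u • 1 + localLax η m 0 := by
  ext1 i j
  fin_cases i <;> fin_cases j <;> simp [localLax]

/-- The commutation relations of `gl₂`. -/
theorem localLax_zero_comm (η : ℂ) (m : ℕ) (i j k l : Fin 2) :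
    localLax η m 0 i j * localLax η m 0 k l - localLax η m 0 k l * localLax η m 0 i j =
      η • ((if i = l then localLax η m 0 k j else 0) -
        (if k = j then localLax η m 0 i l else 0)) := by
  have h1 := spinZ_mul_spinPlus m
  have h2 := spinZ_mul_spinMinus m
  have h3 : spinPlus m * spinMinus m - spinMinus m * spinPlus m = (2 : ℂ) • spinZ m := by
    rw [spinPlus_mul_spinMinus, spinMinus_mul_spinPlus, spinZ, Matrix.diagonal_sub,
      ← Matrix.diagonal_smul]
    congr 1
    ext i
    simp
    ring
  have h4 : spinPlus m * spinMinus m = spinMinus m * spinPlus m + (2 : ℂ) • spinZ m := by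
    rw [← h3]; abel
  fin_cases i <;> fin_cases j <;> fin_cases k <;> fin_cases l <;>
    simp [localLax, mul_add, add_mul, mul_sub, sub_mul, h1, h2, h4, smul_smul] <;> module

/-- Since the Lax operator is $u$ plus a constant matrix of $\mathfrak{gl}_2$ generators, the
exchange relation is $(u-v)$ times the commutation relation of the generators. -/
theorem exchange_localLax (η : ℂ) (m : ℕ) (u v : ℂ) :
    Exchange η (u - v) (localLax η m u) (localLax η m v) := by
  rw [exchange_iff]
  intro i k j l
  have h := localLax_zero_comm η m k j i l
  rw [localLax_eq η m u, localLax_eq η m v]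
  simp only [Matrix.add_apply, Matrix.smul_apply, Matrix.one_apply]
  generalize localLax η m 0 = L at *
  have h' := congrArg (fun X => (u - v) • X) h
  simp only [smul_sub] at h'
  rw [← sub_eq_zero] at h' ⊢
  refine Eq.trans ?_ h'
  split_ifs <;> simp [mul_add, add_mul, smul_add, smul_smul] <;> module

theorem qdet_localLax (η : ℂ) (m : ℕ) (u : ℂ) :
    QDet (localLax η m u) (localLax η m (u - η))
      ((u + η / 2 + (m : ℂ) / 2 * η) * (u - η / 2 - (m : ℂ) / 2 * η)) := by
  have h1 := spinZ_mul_spinPlus m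
  have h2 := spinZ_mul_spinMinus m
  have h3 := spinPlus_mul_spinMinus m
  have h4 := spinMinus_mul_spinPlus m
  intro i j
  fin_cases i <;> fin_cases j
  · simp [localLax, mul_add, add_mul, mul_sub, sub_mul, h2, smul_smul]
    module
  · simp [localLax, mul_add, add_mul, mul_sub, sub_mul, h4, smul_smul]
    simp only [spinZ, ← Matrix.diagonal_smul, ← Matrix.diagonal_one, Matrix.diagonal_mul_diagonal,
      Matrix.diagonal_add, Matrix.diagonal_sub]
    congr 1
    ext i
    simp
    ring
  · simp [localLax, mul_add, add_mul, mul_sub, sub_mul, h3, smul_smul]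
    simp only [spinZ, ← Matrix.diagonal_smul, ← Matrix.diagonal_one, Matrix.diagonal_mul_diagonal,
      Matrix.diagonal_add, Matrix.diagonal_sub, Matrix.diagonal_neg]
    congr 1
    ext i
    simp
    ring
  · simp [localLax, mul_add, add_mul, mul_sub, sub_mul, h1, smul_smul]
    module

end Spin

/-! ### Operators on the chain -/

section Chain

variable {N : ℕ} (m : Fin N → ℕ)

/-- The tensor product of operators on the factors. -/
def tensor (B : (n : Fin N) → Matrix (Fin (m n + 1)) (Fin (m n + 1)) ℂ) : Op m :=
  Matrix.of fun h h' => ∏ n, B n (h n) (h' n)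

theorem tensor_mul (A B : (n : Fin N) → Matrix (Fin (m n + 1)) (Fin (m n + 1)) ℂ) :
    tensor m (A * B) = tensor m A * tensor m B := by
  ext h h'
  simp only [tensor, Matrix.of_apply, Matrix.mul_apply, Pi.mul_apply, ← Finset.prod_mul_distrib]
  rw [Finset.prod_univ_sum, Fintype.piFinset_univ]

theorem tensor_one : tensor m 1 = 1 := by
  ext h h'
  simp only [tensor, Matrix.of_apply, Pi.one_apply, Matrix.one_apply]
  rw [Finset.prod_ite_zero]
  simp [funext_iff]

/-- With this, multiplicativity and the commutation of different sites follow from the corresponding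
facts about `Pi.mulSingle`. -/
theorem site_eq_tensor (n : Fin N) (Y : Matrix (Fin (m n + 1)) (Fin (m n + 1)) ℂ) :
    site m n Y = tensor m (Pi.mulSingle n Y) := by
  classical
  ext h h'
  simp only [site, tensor, Matrix.of_apply]
  rw [← Finset.mul_prod_erase _ _ (Finset.mem_univ n), Pi.mulSingle_eq_same]
  have : ∀ j ∈ Finset.univ.erase n, (Pi.mulSingle n Y : (n : Fin N) →
      Matrix (Fin (m n + 1)) (Fin (m n + 1)) ℂ) j (h j) (h' j) = if h j = h' j then 1 else 0 := by
    intro j hj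
    rw [Pi.mulSingle_eq_of_ne (Finset.ne_of_mem_erase hj), Matrix.one_apply]
  rw [Finset.prod_congr rfl this, Finset.prod_ite_zero]
  simp

/-- `site` as a homomorphism of algebras. -/
def siteHom (n : Fin N) : Matrix (Fin (m n + 1)) (Fin (m n + 1)) ℂ →ₐ[ℂ] Op m :=
  AlgHom.ofLinearMap
    { toFun := site m n
      map_add' := fun X Y => by
        ext h h'
        simp only [site, Matrix.of_apply, Matrix.add_apply]
        split_ifs <;> simp
      map_smul' := fun c X => by
        ext h h'
        simp only [site, Matrix.of_apply, Matrix.smul_apply, RingHom.id_apply]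
        split_ifs <;> simp }
    (by simp only [LinearMap.coe_mk, AddHom.coe_mk, site_eq_tensor, Pi.mulSingle_one, tensor_one])
    (fun X Y => by
      simp only [LinearMap.coe_mk, AddHom.coe_mk, site_eq_tensor, Pi.mulSingle_mul, tensor_mul])

theorem siteHom_apply (n : Fin N) (Y : Matrix (Fin (m n + 1)) (Fin (m n + 1)) ℂ) :
    siteHom m n Y = site m n Y := rfl

theorem commute_siteHom {n n' : Fin N} (h : n ≠ n') (X : Matrix (Fin (m n + 1)) (Fin (m n + 1)) ℂ)
    (Y : Matrix (Fin (m n' + 1)) (Fin (m n' + 1)) ℂ) :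
    Commute (siteHom m n X) (siteHom m n' Y) := by
  rw [siteHom_apply, siteHom_apply, site_eq_tensor, site_eq_tensor]
  have := Pi.mulSingle_commute (f := fun n : Fin N => Matrix (Fin (m n + 1)) (Fin (m n + 1)) ℂ)
    h X Y
  rw [Commute, SemiconjBy, ← tensor_mul, ← tensor_mul, this.eq]

theorem lax_eq_map (η : ℂ) (n : Fin N) (u : ℂ) :
    lax η m n u = (localLax η (m n) u).map (siteHom m n) := by
  ext1 i j
  fin_cases i <;> fin_cases j <;> rfl

theorem lax_eq (η : ℂ) (n : Fin N) (u : ℂ) : lax η m n u = u • 1 + lax η m n 0 := by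
  rw [lax_eq_map, lax_eq_map, localLax_eq]
  ext1 i j
  simp only [Matrix.map_apply, Matrix.add_apply, Matrix.smul_apply, map_add, map_smul,
    Matrix.one_apply]
  split_ifs <;> simp

theorem entriesCommute_lax (η : ℂ) {n n' : Fin N} (h : n ≠ n') (u v : ℂ) :
    EntriesCommute (lax η m n u) (lax η m n' v) := by
  rw [lax_eq_map, lax_eq_map]
  exact fun i j k l => commute_siteHom m h _ _

variable {R : Type*} [Ring R] {ι : Type*}

theorem EntriesCommute.list_prod_right {A : Matrix (Fin 2) (Fin 2) R}
    {B : ι → Matrix (Fin 2) (Fin 2) R} {l : List ι} (h : ∀ n ∈ l, EntriesCommute A (B n)) :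
    EntriesCommute A (l.map B).prod := by
  induction l with
  | nil => exact EntriesCommute.one_right A
  | cons n l ih =>
    rw [List.map_cons, List.prod_cons]
    exact (h n (by simp)).mul_right (ih fun k hk => h k (by simp [hk]))

variable [Algebra ℂ R]

theorem qdet_list_prod {A B : ι → Matrix (Fin 2) (Fin 2) R} {q : ι → ℂ}
    (h : ∀ n, QDet (A n) (B n) (q n)) (hc : ∀ n n', n ≠ n' → EntriesCommute (A n) (B n'))
    {l : List ι} (hl : l.Nodup) : QDet (l.map A).prod (l.map B).prod (l.map q).prod := by
  induction l with
  | nil =>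
    intro i j
    fin_cases i <;> fin_cases j <;> simp
  | cons n l ih =>
    rw [List.nodup_cons] at hl
    simp only [List.map_cons, List.prod_cons]
    refine (h n).mul (ih hl.2) (EntriesCommute.symm (EntriesCommute.list_prod_right ?_))
    exact fun k hk => (hc k n fun e => hl.1 (e ▸ hk)).symm

theorem exchange_list_prod {η c : ℂ} {A B : ι → Matrix (Fin 2) (Fin 2) R}
    (h : ∀ n, Exchange η c (A n) (B n)) (hc : ∀ n n', n ≠ n' → EntriesCommute (A n) (B n'))
    {l : List ι} (hl : l.Nodup) : Exchange η c (l.map A).prod (l.map B).prod := by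
  induction l with
  | nil =>
    rw [exchange_iff]
    intro i k j l
    simp only [List.map_nil, List.prod_nil, Matrix.one_apply]
    split_ifs <;> simp
  | cons n l ih =>
    rw [List.nodup_cons] at hl
    simp only [List.map_cons, List.prod_cons]
    refine (h n).mul (ih hl.2) (EntriesCommute.symm (EntriesCommute.list_prod_right ?_))
      (EntriesCommute.symm (EntriesCommute.list_prod_right ?_))
    · exact fun k hk => (hc k n fun e => hl.1 (e ▸ hk)).symm
    · exact fun k hk => hc n k fun e => hl.1 (e ▸ hk)

end Chain

/-! ### The monodromy matrix -/

section Monodromy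

variable {N : ℕ} (K : Matrix (Fin 2) (Fin 2) ℂ) (η : ℂ) (m : Fin N → ℕ) (ξ : Fin N → ℂ)

theorem nodup_ofFn_rev : (List.ofFn fun k : Fin N => k.rev).Nodup :=
  List.nodup_ofFn.2 Fin.rev_injective

theorem monodromy_eq (u : ℂ) : monodromy K η m ξ u = K.map (algebraMap ℂ (Op m)) *
    ((List.ofFn fun k : Fin N => k.rev).map fun n => lax η m n (u - ξ n)).prod := by
  rw [List.map_ofFn]
  rfl

theorem prod_map_ofFn_rev {M : Type*} [CommMonoid M] (f : Fin N → M) :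
    ((List.ofFn fun k : Fin N => k.rev).map f).prod = ∏ n, f n := by
  rw [List.map_ofFn, List.prod_ofFn]
  exact Equiv.prod_comp Fin.revPerm f

theorem commute_transfer_of_ne {u v : ℂ} (h : η ^ 2 ≠ (u - v) ^ 2) :
    Commute (transfer K η m ξ u) (transfer K η m ξ v) := by
  refine Exchange.commute_trace (η := η) (c := u - v) ?_ h
  rw [monodromy_eq, monodromy_eq]
  refine (exchange_algebraMap η (u - v) K).mul (exchange_list_prod (fun n => ?_) (fun n n' hn => ?_)
    nodup_ofFn_rev) (entriesCommute_algebraMap _ _) (entriesCommute_algebraMap _ _)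
  · rw [lax_eq_map, lax_eq_map, ← sub_sub_sub_cancel_right u v (ξ n)]
    exact (exchange_localLax η (m n) _ _).map (siteHom m n)
  · exact entriesCommute_lax m η hn _ _

theorem continuous_transfer : Continuous (transfer K η m ξ) := by
  have h : transfer K η m ξ = fun u => (K.map (algebraMap ℂ (Op m)) *
      ((List.ofFn fun k : Fin N => k.rev).map fun n => lax η m n (u - ξ n)).prod).trace := by
    funext u
    rw [transfer, monodromy_eq]
  rw [h]
  refine Continuous.matrix_trace ?_
  refine continuous_const.matrix_mul ?_
  have : ∀ n, Continuous fun u => lax η m n (u - ξ n) := by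
    intro n
    simp_rw [lax_eq m η n (_ - _)]
    fun_prop
  exact continuous_list_prod _ fun n _ => this n

theorem commute_transfer (u v : ℂ) : Commute (transfer K η m ξ u) (transfer K η m ξ v) := by
  have hc : IsClosed {v | Commute (transfer K η m ξ u) (transfer K η m ξ v)} :=
    isClosed_eq (continuous_const.mul (continuous_transfer K η m ξ))
      ((continuous_transfer K η m ξ).mul continuous_const)
  -- The braid matrix is singular only at $v=u\pm\eta$; these two points are reached by continuity.
  have hd : Dense ({u - η, u + η}ᶜ : Set ℂ) :=
    Set.Countable.dense_compl ℂ (by simp)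
  have hs : ({u - η, u + η}ᶜ : Set ℂ) ⊆
      {v | Commute (transfer K η m ξ u) (transfer K η m ξ v)} := by
    intro w hw
    simp only [Set.mem_compl_iff, Set.mem_insert_iff, Set.mem_singleton_iff, not_or] at hw
    refine commute_transfer_of_ne K η m ξ fun e => ?_
    rcases sq_eq_sq_iff_eq_or_eq_neg.1 e with e | e
    · exact hw.1 (by rw [e]; ring)
    · exact hw.2 (by rw [e]; ring)
  exact (hc.closure_subset_iff.2 hs) (hd v)

theorem qdet_lax (n : Fin N) (u : ℂ) : QDet (lax η m n u) (lax η m n (u - η))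
    ((u + η / 2 + (m n : ℂ) / 2 * η) * (u - η / 2 - (m n : ℂ) / 2 * η)) := by
  rw [lax_eq_map, lax_eq_map]
  exact (qdet_localLax η (m n) u).map (siteHom m n)

theorem qdet_eq_prod (u : ℂ) : qdet K η m ξ u = K.det * ∏ n,
    ((u - ξ n + η / 2 + (m n : ℂ) / 2 * η) * (u - ξ n - η / 2 - (m n : ℂ) / 2 * η)) := by
  rw [qdet, aFun, dFun, ← Finset.prod_mul_distrib]
  congr 1
  exact Finset.prod_congr rfl fun n _ => by ring

theorem qdet_monodromy (u : ℂ) :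
    QDet (monodromy K η m ξ u) (monodromy K η m ξ (u - η)) (qdet K η m ξ u) := by
  rw [monodromy_eq, monodromy_eq, qdet_eq_prod, ← prod_map_ofFn_rev]
  refine (qdet_algebraMap K).mul (qdet_list_prod (fun n => ?_) (fun n n' hn => ?_)
    nodup_ofFn_rev) (entriesCommute_algebraMap _ _).symm.symm
  · rw [sub_right_comm]
    exact qdet_lax η m n (u - ξ n)
  · exact entriesCommute_lax m η hn _ _

theorem qdet_monodromy_succ (u : ℂ) (l : ℕ) :
    QDet (monodromy K η m ξ (u + (l + 1 : ℕ) * η)) (monodromy K η m ξ (u + l * η))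
      (qdet K η m ξ (u + (l + 1 : ℕ) * η)) := by
  have h := qdet_monodromy K η m ξ (u + (l + 1 : ℕ) * η)
  rwa [show u + (l + 1 : ℕ) * η - η = u + l * η by push_cast; ring] at h

end Monodromy

/-! ### The symmetrizer and the fusion relations -/

section Symmetrizer

theorem exists_perm_of_sum_eq {l : ℕ} {i k : Fin l → Fin 2}
    (h : ∑ a, (i a : ℕ) = ∑ a, (k a : ℕ)) : ∃ σ : Equiv.Perm (Fin l), i = k ∘ σ := by
  have hcard : ∀ f : Fin l → Fin 2, Fintype.card {a // f a = 1} = ∑ a, (f a : ℕ) := by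
    intro f
    rw [Fintype.card_subtype, Finset.card_filter]
    refine Finset.sum_congr rfl fun a _ => ?_
    generalize f a = c
    fin_cases c <;> simp
  have hcard0 : ∀ f : Fin l → Fin 2, Fintype.card {a // f a = 0} = l - ∑ a, (f a : ℕ) := by
    intro f
    rw [Fintype.card_subtype, Finset.card_filter]
    refine Nat.eq_sub_of_add_eq ?_
    rw [← Finset.sum_add_distrib]
    calc _ = ∑ a : Fin l, 1 := Finset.sum_congr rfl fun a _ => by
          generalize f a = c
          fin_cases c <;> simp
      _ = l := by simp
  have he : ∀ c, Nonempty ({a // i a = c} ≃ {a // k a = c}) := by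
    intro c
    rw [← Fintype.card_eq]
    fin_cases c
    · exact (hcard0 i).trans (h ▸ (hcard0 k).symm)
    · exact (hcard i).trans (h ▸ (hcard k).symm)
  refine ⟨Equiv.ofFiberEquiv fun c => (he c).some, ?_⟩
  ext1 a
  exact (Equiv.ofFiberEquiv_map _ a).symm

/-- The number of permutations that carry one word to another. -/
def permCount {l : ℕ} (i k : Fin l → Fin 2) : ℕ :=
  (Finset.univ.filter fun τ : Equiv.Perm (Fin l) => i = k ∘ τ).card

theorem permCount_eq_zero {l : ℕ} {i k : Fin l → Fin 2}
    (h : ∑ a, (i a : ℕ) ≠ ∑ a, (k a : ℕ)) : permCount i k = 0 := by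
  rw [permCount, Finset.card_eq_zero, Finset.filter_eq_empty_iff]
  rintro τ - rfl
  exact h (Equiv.sum_comp τ fun a => (k a : ℕ))

theorem permCount_comp {l : ℕ} (i k : Fin l → Fin 2) (σ : Equiv.Perm (Fin l)) :
    permCount (i ∘ σ) k = permCount i k := by
  refine Finset.card_bij (fun τ _ => τ * σ⁻¹) ?_ ?_ ?_
  · intro τ hτ
    simp only [Finset.mem_filter, Finset.mem_univ, true_and] at hτ ⊢
    rw [Equiv.Perm.coe_mul, ← Function.comp_assoc, ← hτ]
    ext a; simp
  · intro τ _ τ' _ h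
    exact mul_right_cancel h
  · intro τ hτ
    simp only [Finset.mem_filter, Finset.mem_univ, true_and] at hτ
    exact ⟨τ * σ, by simp [hτ, Function.comp_assoc], by simp⟩

theorem sum_permCount {l : ℕ} (k : Fin l → Fin 2) : ∑ i, permCount i k = l ! := by
  have := Finset.card_eq_sum_card_fiberwise (s := Finset.univ) (t := Finset.univ)
    (f := fun τ : Equiv.Perm (Fin l) => k ∘ τ) (fun _ _ => Finset.mem_coe.2 (Finset.mem_univ _))
  rw [Finset.card_univ, Fintype.card_perm, Fintype.card_fin] at this
  rw [this]
  refine Finset.sum_congr rfl fun i _ => ?_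
  rw [permCount]
  congr 1
  ext τ
  simp [eq_comm]

theorem permCount_eq {l : ℕ} {i k : Fin l → Fin 2} (h : ∑ a, (i a : ℕ) = ∑ a, (k a : ℕ)) :
    permCount i k = permCount k k := by
  obtain ⟨σ, rfl⟩ := exists_perm_of_sum_eq h
  exact permCount_comp k k σ

theorem permCount_comm {l : ℕ} (i k : Fin l → Fin 2) : permCount i k = permCount k i := by
  refine Finset.card_equiv (Equiv.inv (Equiv.Perm (Fin l))) fun τ => ?_
  simp only [Finset.mem_filter, Finset.mem_univ, true_and, Equiv.inv_apply]
  constructor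
  · rintro rfl
    ext a; simp
  · rintro rfl
    ext a; simp

/-- Within a weight class `permCount` is constant in either argument, so the diagonal sum is the sum
over one column of `permCount`, where every permutation is counted once. -/
theorem sum_permCount_of_sum_eq {l p : ℕ} (hp : p ≤ l) :
    ∑ k : Fin l → Fin 2 with ∑ a, (k a : ℕ) = p, permCount k k = l ! := by
  obtain ⟨k₀, hk₀⟩ : ∃ k : Fin l → Fin 2, ∑ a, (k a : ℕ) = p := by
    refine ⟨fun a => if (a : ℕ) < p then 1 else 0, ?_⟩
    simp only [apply_ite Fin.val, Fin.val_one, Fin.val_zero]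
    rw [Fin.sum_univ_eq_sum_range (fun a => if a < p then 1 else 0) l, ← Finset.card_filter]
    have : (Finset.range l).filter (· < p) = Finset.range p := by
      ext a
      simp
      omega
    rw [this, Finset.card_range]
  rw [← sum_permCount k₀, Finset.sum_filter]
  refine Finset.sum_congr rfl fun k _ => ?_
  split_ifs with h
  · rw [permCount_comm k k₀, permCount_eq (hk₀.trans h.symm)]
  · rw [permCount_eq_zero (hk₀ ▸ h)]

/-- For a fixed column word the weight depends on the row word only through its number of ones, so
the inner sum is one coefficient of the product of column polynomials. That product depends only on
the weight of the column word, and each weight class has total weight $l!$. -/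
theorem sum_permCount_smul_word {R : Type*} [Ring R] [Algebra ℂ R]
    {M : ℕ → Matrix (Fin 2) (Fin 2) R} {q : ℕ → ℂ}
    (h : ∀ l, QDet (M (l + 1)) (M l) (q (l + 1))) (l : ℕ) :
    ∑ k : Fin l → Fin 2, ∑ i : Fin l → Fin 2, permCount i k •
      (List.ofFn fun a : Fin l => M (a.rev : ℕ) (i a) (k a)).prod =
      l ! • fusionSeq (fun l => (M l).trace) q l := by
  have hwt : ∀ k : Fin l → Fin 2, ∑ a, (k a : ℕ) < l + 1 := fun k => by
    have : ∑ a, (k a : ℕ) ≤ ∑ a : Fin l, 1 := Finset.sum_le_sum fun a _ => by omega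
    simp at this
    omega
  have h1 : ∀ k : Fin l → Fin 2, ∑ i : Fin l → Fin 2, permCount i k •
      (List.ofFn fun a : Fin l => M (a.rev : ℕ) (i a) (k a)).prod =
      permCount k k • (sortedWord M l (∑ a, (k a : ℕ))).coeff (∑ a, (k a : ℕ)) := by
    intro k
    rw [← sum_word h l k, finsetSum_coeff, Finset.smul_sum]
    refine Finset.sum_congr rfl fun i _ => ?_
    rw [coeff_C_mul, coeff_X_pow]
    split_ifs with h
    · rw [permCount_eq h.symm, mul_one]
    · rw [permCount_eq_zero (Ne.symm h), zero_smul, mul_zero, smul_zero]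
  rw [← sum_coeff_sortedWord h, Finset.sum_congr rfl fun k _ => h1 k,
    ← Finset.sum_fiberwise_of_maps_to (s := Finset.univ) (t := Finset.range (l + 1))
      (g := fun k : Fin l → Fin 2 => ∑ a, (k a : ℕ)) (fun k _ => Finset.mem_range.2 (hwt k)),
    Finset.smul_sum]
  refine Finset.sum_congr rfl fun p hp => ?_
  rw [← sum_permCount_of_sum_eq (Nat.lt_succ_iff.1 (Finset.mem_range.1 hp)), Finset.sum_smul]
  refine Finset.sum_congr rfl fun k hk => ?_
  rw [(Finset.mem_filter.1 hk).2]

theorem symmetrizer_apply {l : ℕ} (i k : Fin l → Fin 2) :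
    symmetrizer l i k = ((l ! : ℕ) : ℂ)⁻¹ * permCount i k := by
  simp [symmetrizer, Matrix.sum_apply, permCount]

theorem symmetrizer_mul_symmetrizer (l : ℕ) : symmetrizer l * symmetrizer l = symmetrizer l := by
  have hl : ((l ! : ℕ) : ℂ) ≠ 0 := by exact_mod_cast l.factorial_ne_zero
  have h1 : ∀ π σ : Equiv.Perm (Fin l),
      (Matrix.of fun i j => if i = j ∘ π then 1 else 0 :
        Matrix (Fin l → Fin 2) (Fin l → Fin 2) ℂ) *
      (Matrix.of fun i j => if i = j ∘ σ then 1 else 0) =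
      Matrix.of fun i j => if i = j ∘ (σ * π : Equiv.Perm (Fin l)) then 1 else 0 := by
    intro π σ
    ext i k
    rw [Matrix.mul_apply, Finset.sum_eq_single (k ∘ σ)]
    · rw [Matrix.of_apply, Matrix.of_apply, Matrix.of_apply, if_pos rfl, mul_one]
      exact if_congr (by rw [Function.comp_assoc]; rfl) rfl rfl
    · intro b _ hb
      simp [hb]
    · simp
  have h2 : ∀ π : Equiv.Perm (Fin l), ∑ σ : Equiv.Perm (Fin l),
      (Matrix.of fun i j => if i = j ∘ (σ * π : Equiv.Perm (Fin l)) then 1 else 0 :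
        Matrix (Fin l → Fin 2) (Fin l → Fin 2) ℂ) =
      ∑ σ : Equiv.Perm (Fin l), Matrix.of fun i j => if i = j ∘ σ then 1 else 0 := fun π =>
    Equiv.sum_comp (Equiv.mulRight π) fun σ : Equiv.Perm (Fin l) =>
      (Matrix.of fun i j => if i = j ∘ σ then 1 else 0 : Matrix (Fin l → Fin 2) (Fin l → Fin 2) ℂ)
  rw [symmetrizer, Matrix.smul_mul, Matrix.mul_smul, Finset.sum_mul_sum]
  simp only [h1, h2, Finset.sum_const, Finset.card_univ, Fintype.card_perm, Fintype.card_fin]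
  rw [← Nat.cast_smul_eq_nsmul ℂ, smul_smul (l ! : ℂ)⁻¹ (l ! : ℂ), inv_mul_cancel₀ hl, one_smul]

variable {N : ℕ} (K : Matrix (Fin 2) (Fin 2) ℂ) (η : ℂ) (m : Fin N → ℕ) (ξ : Fin N → ℂ)

theorem fusedTransfer_eq_sum (l : ℕ) (u : ℂ) : fusedTransfer K η m ξ l u =
    ((l ! : ℕ) : ℂ)⁻¹ • ∑ k, ∑ i, permCount i k • monodromyProduct K η m ξ l u i k := by
  have h1 : fusedTransfer K η m ξ l u =
      (scalarOps m (symmetrizer l) * monodromyProduct K η m ξ l u).trace := by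
    rw [fusedTransfer, fusedMonodromy]
    -- The right projector has scalar entries, so it can be moved around the trace and absorbed by
    -- the left one.
    have := (entriesCommute_algebraMap (scalarOps m (symmetrizer l) *
      monodromyProduct K η m ξ l u) (symmetrizer l)).trace_mul_comm
    rw [scalarOps] at *
    rw [this, ← Matrix.mul_assoc, ← Matrix.map_mul, symmetrizer_mul_symmetrizer]
  rw [h1, Matrix.trace, Finset.smul_sum]
  refine Finset.sum_congr rfl fun k _ => ?_
  rw [Matrix.diag_apply, Matrix.mul_apply, Finset.smul_sum]
  refine Finset.sum_congr rfl fun i _ => ?_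
  rw [scalarOps, Matrix.map_apply, ← Algebra.smul_def, symmetrizer_apply, permCount_comm, mul_smul,
    Nat.cast_smul_eq_nsmul]

/-- The fusion relations. -/
theorem fusedTransfer_eq_fusionSeq (l : ℕ) (u : ℂ) : fusedTransfer K η m ξ l u =
    fusionSeq (fun l => transfer K η m ξ (u + l * η)) (fun l => qdet K η m ξ (u + l * η)) l := by
  have hX : ∀ i k, monodromyProduct K η m ξ l u i k =
      (List.ofFn fun a : Fin l => monodromy K η m ξ (u + (a.rev : ℕ) * η) (i a) (k a)).prod := by
    intro i k
    rw [monodromyProduct, Matrix.of_apply]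
    refine congrArg List.prod (congrArg List.ofFn (funext fun a => ?_))
    rw [Fin.val_rev, Nat.cast_sub (by omega)]
    push_cast
    rw [sub_sub, add_comm (1 : ℂ)]
  have hl : ((l ! : ℕ) : ℂ) ≠ 0 := by exact_mod_cast l.factorial_ne_zero
  rw [fusedTransfer_eq_sum, inv_smul_eq_iff₀ hl, Nat.cast_smul_eq_nsmul]
  simp only [hX]
  exact sum_permCount_smul_word (M := fun l : ℕ => monodromy K η m ξ (u + l * η))
    (q := fun l : ℕ => qdet K η m ξ (u + l * η)) (qdet_monodromy_succ K η m ξ u) l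

end Symmetrizer

/-! ### The spin representation on polynomials -/

section PolynomialModel

variable {m : ℕ}

/-- The vector of the coefficients of a polynomial, normalized so that the spin operators act as
differential operators. -/
noncomputable def toVec (m : ℕ) : ℂ[X] →ₗ[ℂ] (Fin (m + 1) → ℂ) where
  toFun f j := (((√(m.choose j))⁻¹ : ℝ) : ℂ) * f.coeff j
  map_add' f g := by ext j; simp [mul_add]
  map_smul' c f := by ext j; simp; ring

theorem toVec_apply (f : ℂ[X]) (j : Fin (m + 1)) :
    toVec m f j = (((√(m.choose j))⁻¹ : ℝ) : ℂ) * f.coeff j := rfl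

theorem sqrt_mul_sqrt_choose {j : ℕ} (hj : j < m) :
    √(((j : ℝ) + 1) * ((m : ℝ) + 1 - (j + 1))) * √(m.choose j) =
      (j + 1) * √(m.choose (j + 1)) := by
  have h : (m.choose (j + 1) : ℝ) * (j + 1) = m.choose j * (m - j) := by
    have := Nat.choose_succ_right_eq m j
    rw [← Nat.cast_sub hj.le]
    exact_mod_cast this
  have hm : (j : ℝ) < m := by exact_mod_cast hj
  rw [← Real.sqrt_mul (mul_nonneg (by positivity) (by linarith)),
    show ((j : ℝ) + 1) * ((m : ℝ) + 1 - (j + 1)) * (m.choose j : ℝ) =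
      ((j : ℝ) + 1) ^ 2 * (m.choose (j + 1) : ℝ) by linear_combination -((j : ℝ) + 1) * h,
    Real.sqrt_mul (by positivity), Real.sqrt_sq (by positivity)]

theorem sqrt_mul_sqrt_choose_succ {j : ℕ} (hj : j < m) :
    √(((j : ℝ) + 1) * ((m : ℝ) + 1 - (j + 1))) * √(m.choose (j + 1)) =
      (m - j) * √(m.choose j) := by
  have h : (m.choose (j + 1) : ℝ) * (j + 1) = m.choose j * (m - j) := by
    have := Nat.choose_succ_right_eq m j
    rw [← Nat.cast_sub hj.le]
    exact_mod_cast this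
  have hm : (j : ℝ) < m := by exact_mod_cast hj
  rw [← Real.sqrt_mul (mul_nonneg (by positivity) (by linarith)),
    show ((j : ℝ) + 1) * ((m : ℝ) + 1 - (j + 1)) * (m.choose (j + 1) : ℝ) =
      ((m : ℝ) - j) ^ 2 * (m.choose j : ℝ) by linear_combination ((m : ℝ) - j) * h,
    Real.sqrt_mul (by positivity), Real.sqrt_sq (by linarith)]

theorem sqrt_choose_pos {j : ℕ} (hj : j ≤ m) : 0 < √(m.choose j : ℝ) :=
  Real.sqrt_pos.2 (by exact_mod_cast Nat.choose_pos hj)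

theorem coeff_X_mul_derivative (f : ℂ[X]) (j : ℕ) :
    (X * derivative f).coeff j = j * f.coeff j := by
  rcases j with _ | k
  · simp
  · rw [coeff_X_mul, coeff_derivative]
    push_cast
    ring

theorem spinZ_mulVec_toVec (f : ℂ[X]) :
    spinZ m *ᵥ toVec m f = toVec m (C ((m : ℂ) / 2) * f - X * derivative f) := by
  ext j
  rw [spinZ, Matrix.mulVec_diagonal, toVec_apply, toVec_apply, coeff_sub, coeff_C_mul]
  rw [coeff_X_mul_derivative]
  ring

theorem spinPlus_mulVec_toVec {f : ℂ[X]} (hf : f.natDegree ≤ m) :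
    spinPlus m *ᵥ toVec m f = toVec m (derivative f) := by
  ext i
  rw [Matrix.mulVec, dotProduct, toVec_apply, coeff_derivative]
  by_cases hi : (i : ℕ) < m
  · rw [Finset.sum_eq_single ⟨(i : ℕ) + 1, by omega⟩]
    · have h := sqrt_mul_sqrt_choose hi
      have h0 := (sqrt_choose_pos hi.le).ne'
      have h1 := (sqrt_choose_pos (m := m) (j := (i : ℕ) + 1) hi).ne'
      have h2 : √((((i : ℕ) : ℝ) + 1) * ((m : ℝ) + 1 - ((i : ℕ) + 1))) *
          (√(m.choose ((i : ℕ) + 1)))⁻¹ = ((i : ℕ) + 1) * (√(m.choose i))⁻¹ := by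
        field_simp
        linarith
      have h3 := congrArg (fun x : ℝ => (x : ℂ)) h2
      simp only [spinPlus, Matrix.of_apply, if_true, toVec_apply]
      rw [← mul_assoc, ← Complex.ofReal_mul, h2]
      push_cast
      ring
    · intro b _ hb
      have : ¬ ((b : ℕ) = i + 1) := fun h => hb (Fin.ext h)
      simp [spinPlus, this]
    · simp
  · rw [coeff_eq_zero_of_natDegree_lt (by omega), Finset.sum_eq_zero]
    · simp
    · intro b _
      have : ¬ ((b : ℕ) = i + 1) := by omega
      simp [spinPlus, this]

theorem spinMinus_mulVec_toVec (f : ℂ[X]) :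
    spinMinus m *ᵥ toVec m f = toVec m (X * (C (m : ℂ) * f - X * derivative f)) := by
  ext i
  rw [Matrix.mulVec, dotProduct, toVec_apply]
  rcases hi : (i : ℕ) with _ | k
  · rw [Finset.sum_eq_zero]
    · simp
    · intro b _
      have : ¬ ((i : ℕ) = b + 1) := by omega
      simp [spinMinus, spinPlus, this]
  · have hk : k < m := by omega
    rw [Finset.sum_eq_single ⟨k, by omega⟩]
    · have h := sqrt_mul_sqrt_choose_succ hk
      have h0 := (sqrt_choose_pos hk.le).ne'
      have h1 := (sqrt_choose_pos (m := m) (j := k + 1) hk).ne'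
      have h2 : √(((k : ℝ) + 1) * ((m : ℝ) + 1 - (k + 1))) *
          (√(m.choose k))⁻¹ = (m - k) * (√(m.choose (k + 1)))⁻¹ := by
        field_simp
        linarith
      simp only [spinMinus, spinPlus, Matrix.transpose_apply, Matrix.of_apply, hi, if_true,
        toVec_apply]
      rw [← mul_assoc, ← Complex.ofReal_mul, h2, coeff_X_mul, coeff_sub, coeff_C_mul,
        coeff_X_mul_derivative]
      push_cast
      ring
    · intro b _ hb
      have : ¬ ((i : ℕ) = b + 1) := fun h => hb (Fin.ext (by simp; omega))
      simp [spinMinus, spinPlus, this]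
    · simp

theorem toVec_surjective (v : Fin (m + 1) → ℂ) : ∃ f : ℂ[X], f.natDegree ≤ m ∧ toVec m f = v := by
  refine ⟨∑ j : Fin (m + 1), monomial j ((√(m.choose j) : ℝ) * v j), ?_, ?_⟩
  · exact natDegree_sum_le_of_forall_le _ _ fun j _ => (natDegree_monomial_le _).trans (by omega)
  · ext i
    have h := (sqrt_choose_pos (m := m) (j := (i : ℕ)) (by omega)).ne'
    rw [toVec_apply, finsetSum_coeff, Finset.sum_eq_single i]
    · rw [coeff_monomial, if_pos rfl, ← mul_assoc, ← Complex.ofReal_mul, inv_mul_cancel₀ h]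
      simp
    · intro b _ hb
      rw [coeff_monomial, if_neg fun e => hb (Fin.ext e)]
    · simp

theorem toVec_injective {f : ℂ[X]} (hf : f.natDegree ≤ m) (h : toVec m f = 0) : f = 0 := by
  ext j
  by_cases hj : j ≤ m
  · have h1 := congrFun h ⟨j, by omega⟩
    have h0 := (sqrt_choose_pos hj).ne'
    rw [toVec_apply] at h1
    simpa [h0] using h1
  · rw [coeff_eq_zero_of_natDegree_lt (by omega), coeff_zero]

/-- The vectors of the polynomials of degree at most `m` that vanish at `z` to order `l`. -/
def InFlag (m : ℕ) (z : ℂ) (l : ℕ) (v : Fin (m + 1) → ℂ) : Prop :=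
  ∃ f : ℂ[X], f.natDegree ≤ m ∧ (X - C z) ^ l ∣ f ∧ toVec m f = v

theorem inFlag_zero (z : ℂ) (v : Fin (m + 1) → ℂ) : InFlag m z 0 v := by
  obtain ⟨f, hf, rfl⟩ := toVec_surjective v
  exact ⟨f, hf, by simp, rfl⟩

/-- The order of vanishing exceeds the degree. -/
theorem InFlag.eq_zero {z : ℂ} {v : Fin (m + 1) → ℂ} (h : InFlag m z (m + 1) v) : v = 0 := by
  obtain ⟨f, hf, hd, rfl⟩ := h
  rw [eq_zero_of_dvd_of_natDegree_lt hd (by simp; omega), map_zero]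

theorem InFlag.smul {z : ℂ} {l : ℕ} {v : Fin (m + 1) → ℂ} (h : InFlag m z l v) (c : ℂ) :
    InFlag m z l (c • v) := by
  obtain ⟨f, hf, hd, rfl⟩ := h
  exact ⟨c • f, (natDegree_smul_le _ _).trans hf, smul_eq_C_mul (R := ℂ) c ▸ hd.mul_left _,
    map_smul _ _ _⟩

/-- On polynomials the operator is $\eta\,(l-(X-z)\partial)$, which annihilates the leading term
$(X-z)^l$ of the expansion at $z$. -/
theorem InFlag.localLax_zero {z η : ℂ} {l : ℕ} {v : Fin (m + 1) → ℂ} (h : InFlag m z l v) :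
    InFlag m z (l + 1) ((localLax η m (-η / 2 - (m : ℂ) / 2 * η + l * η) 0 0 +
      z • localLax η m (-η / 2 - (m : ℂ) / 2 * η + l * η) 1 0) *ᵥ v) := by
  obtain ⟨f, hf, ⟨g, rfl⟩, rfl⟩ := h
  have e : (localLax η m (-η / 2 - (m : ℂ) / 2 * η + l * η) 0 0 +
      z • localLax η m (-η / 2 - (m : ℂ) / 2 * η + l * η) 1 0) =
      η • (((l : ℂ) - (m : ℂ) / 2) • 1 + spinZ m + z • spinPlus m) := by
    simp [localLax]
    module
  rw [e, Matrix.smul_mulVec, Matrix.add_mulVec, Matrix.add_mulVec, Matrix.smul_mulVec,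
    Matrix.smul_mulVec, Matrix.one_mulVec, spinZ_mulVec_toVec, spinPlus_mulVec_toVec hf,
    ← map_smul, ← map_smul, ← map_add, ← map_add]
  refine InFlag.smul ⟨_, ?_, ?_, rfl⟩ _
  · rw [natDegree_le_iff_coeff_eq_zero] at hf ⊢
    intro j hj
    simp only [coeff_add, coeff_sub, coeff_smul, coeff_C_mul, coeff_X_mul_derivative,
      coeff_derivative, hf j hj, hf (j + 1) (by omega)]
    simp
  -- From $l(X-z)^lg-(X-z)\,\partial\bigl((X-z)^lg\bigr)=-(X-z)^{l+1}g'$.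
  · refine ⟨-derivative g, ?_⟩
    rw [derivative_mul, derivative_X_sub_C_pow]
    simp only [smul_eq_C_mul, map_sub]
    rcases l with _ | l
    · simp; ring
    · simp; ring

/-- Here the operator is $\eta\,\bigl(m(X-z)+lz-X(X-z)\partial\bigr)$. On $(X-z)^lg$ the derivative
of the power contributes $-lX$, which turns $lz$ into $-l(X-z)$. -/
theorem InFlag.localLax_one {z η : ℂ} {l : ℕ} {v : Fin (m + 1) → ℂ} (h : InFlag m z l v) :
    InFlag m z (l + 1) ((localLax η m (-η / 2 - (m : ℂ) / 2 * η + l * η) 0 1 +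
      z • localLax η m (-η / 2 - (m : ℂ) / 2 * η + l * η) 1 1) *ᵥ v) := by
  obtain ⟨f, hf, ⟨g, rfl⟩, rfl⟩ := h
  have e : (localLax η m (-η / 2 - (m : ℂ) / 2 * η + l * η) 0 1 +
      z • localLax η m (-η / 2 - (m : ℂ) / 2 * η + l * η) 1 1) =
      η • (spinMinus m + z • (((l : ℂ) - (m : ℂ) / 2) • 1 - spinZ m)) := by
    simp [localLax]
    module
  rw [e, Matrix.smul_mulVec, Matrix.add_mulVec, Matrix.smul_mulVec, Matrix.sub_mulVec,
    Matrix.smul_mulVec, Matrix.one_mulVec, spinZ_mulVec_toVec, spinMinus_mulVec_toVec,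
    ← map_smul, ← map_sub, ← map_smul, ← map_add]
  refine InFlag.smul ⟨_, ?_, ?_, rfl⟩ _
  · rw [natDegree_le_iff_coeff_eq_zero] at hf ⊢
    intro j hj
    obtain ⟨k, rfl⟩ : ∃ k, j = k + 1 := ⟨j - 1, by omega⟩
    rw [coeff_add, coeff_X_mul]
    simp only [coeff_sub, coeff_smul, coeff_C_mul, coeff_X_mul_derivative, hf (k + 1) hj]
    -- The only possible overflow is at degree $m+1$, where $m-X\partial$ annihilates the monomial
    -- $X^m$.
    rcases (Nat.lt_succ_iff.1 hj).eq_or_lt with rfl | hk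
    · simp
    · simp [hf k hk]
  · refine ⟨C ((m : ℂ) - l) * g - X * derivative g, ?_⟩
    rw [derivative_mul, derivative_X_sub_C_pow]
    have hz : z • (X : ℂ[X]) = C z * X := smul_eq_C_mul z
    simp only [smul_eq_C_mul, map_sub]
    rcases l with _ | l
    · have : (C (m : ℂ) : ℂ[X]) = C ((m : ℂ) / 2) + C ((m : ℂ) / 2) := by
        rw [← C_add]; congr 1; ring
      simp [this]; ring
    · have : (C (m : ℂ) : ℂ[X]) = C ((m : ℂ) / 2) + C ((m : ℂ) / 2) := by
        rw [← C_add]; congr 1; ring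
      simp [this]; ring

theorem InFlag.localLax {z η : ℂ} {l : ℕ} {v : Fin (m + 1) → ℂ} (h : InFlag m z l v) (d : Fin 2) :
    InFlag m z (l + 1) ((localLax η m (-η / 2 - (m : ℂ) / 2 * η + l * η) 0 d +
      z • localLax η m (-η / 2 - (m : ℂ) / 2 * η + l * η) 1 d) *ᵥ v) := by
  fin_cases d
  · exact h.localLax_zero
  · exact h.localLax_one

end PolynomialModel

/-! ### Closure of the fusion hierarchy at a site -/

section Vanishing

/-- Evaluation of a polynomial with matrix coefficients at a scalar. -/
noncomputable def evalScalar {ι : Type*} [Fintype ι] [DecidableEq ι] (z : ℂ) :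
    (Matrix ι ι ℂ)[X] →+* Matrix ι ι ℂ :=
  (evalRingHom z).mapMatrix.comp (matPolyEquiv.symm : (Matrix ι ι ℂ)[X] ≃ₐ[ℂ] _).toRingHom

theorem evalScalar_C {ι : Type*} [Fintype ι] [DecidableEq ι] (z : ℂ) (A : Matrix ι ι ℂ) :
    evalScalar z (C A) = A := by
  ext i j
  simp [evalScalar]

theorem evalScalar_X {ι : Type*} [Fintype ι] [DecidableEq ι] (z : ℂ) :
    evalScalar z (X : (Matrix ι ι ℂ)[X]) = z • 1 := by
  ext i j
  by_cases h : i = j <;> simp [evalScalar, h]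

theorem eq_zero_of_evalScalar {ι : Type*} [Fintype ι] [DecidableEq ι] {P : (Matrix ι ι ℂ)[X]}
    (h : ∀ z, evalScalar z P = 0) : P = 0 := by
  have : matPolyEquiv.symm P = 0 := by
    ext1 i j
    refine Polynomial.funext fun z => ?_
    simpa [evalScalar] using congrFun (congrFun (h z) i) j
  simpa using this

variable {N : ℕ} (K : Matrix (Fin 2) (Fin 2) ℂ) (η : ℂ) (m : Fin N → ℕ) (ξ : Fin N → ℂ)

/-- The operators `∑ Y b`, with `Y` acting on the site `n` with range in the flag of `z`, and `b`
acting on the other sites. -/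
def flagOps (n : Fin N) (z : ℂ) (l : ℕ) : Submodule ℂ (Op m) :=
  Submodule.span ℂ {F | ∃ Y b, (∀ v, InFlag (m n) z l (Y *ᵥ v)) ∧
    (∀ Z, Commute (siteHom m n Z) b) ∧ F = siteHom m n Y * b}

theorem one_mem_flagOps (n : Fin N) (z : ℂ) : 1 ∈ flagOps m n z 0 :=
  Submodule.subset_span ⟨1, 1, fun _ => inFlag_zero _ _, fun _ => Commute.one_right _, by simp⟩

theorem flagOps_eq_zero {n : Fin N} {z : ℂ} {F : Op m} (h : F ∈ flagOps m n z (m n + 1)) :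
    F = 0 := by
  induction h using Submodule.span_induction with
  | mem F hF =>
    obtain ⟨Y, b, hY, -, rfl⟩ := hF
    have : Y = 0 := by
      refine Matrix.ext_of_mulVec_single fun i => ?_
      rw [(hY _).eq_zero, Matrix.zero_mulVec]
    rw [this, map_zero, zero_mul]
  | zero => rfl
  | add _ _ _ _ h1 h2 => rw [h1, h2, add_zero]
  | smul c _ _ h1 => rw [h1, smul_zero]

theorem mul_mem_flagOps {n : Fin N} {z : ℂ} {l : ℕ} {F : Op m} (h : F ∈ flagOps m n z l)
    {Z : Matrix (Fin (m n + 1)) (Fin (m n + 1)) ℂ}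
    (hZ : ∀ v, InFlag (m n) z l v → InFlag (m n) z (l + 1) (Z *ᵥ v)) {b : Op m}
    (hb : ∀ Z, Commute (siteHom m n Z) b) : siteHom m n Z * b * F ∈ flagOps m n z (l + 1) := by
  induction h using Submodule.span_induction with
  | mem F hF =>
    obtain ⟨Y, b', hY, hb', rfl⟩ := hF
    refine Submodule.subset_span ⟨Z * Y, b * b', fun v => ?_, fun W => (hb W).mul_right (hb' W), ?_⟩
    · rw [← Matrix.mulVec_mulVec]
      exact hZ _ (hY v)
    · rw [map_mul]
      exact (hb Y).symm.mul_mul_mul_comm _ _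
  | zero => simp
  | add _ _ _ _ h1 h2 =>
    rw [mul_add]
    exact Submodule.add_mem _ h1 h2
  | smul c _ _ h1 =>
    rw [mul_smul_comm]
    exact Submodule.smul_mem _ c h1

theorem evalScalar_colPoly_mul_mem {n : Fin N} {z : ℂ} {l : ℕ} {F : Op m}
    (h : F ∈ flagOps m n z l) {B : Matrix (Fin 2) (Fin 2) (Op m)}
    (hB : ∀ i j Z, Commute (siteHom m n Z) (B i j)) (j : Fin 2) :
    evalScalar z (colPoly (lax η m n (-η / 2 - (m n : ℂ) / 2 * η + l * η) * B) j) * F ∈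
      flagOps m n z (l + 1) := by
  have e : evalScalar z (colPoly (lax η m n (-η / 2 - (m n : ℂ) / 2 * η + l * η) * B) j) =
      ∑ d, siteHom m n (localLax η (m n) (-η / 2 - (m n : ℂ) / 2 * η + l * η) 0 d +
      z • localLax η (m n) (-η / 2 - (m n : ℂ) / 2 * η + l * η) 1 d) * B d j := by
    rw [colPoly, map_add, map_mul, evalScalar_C, evalScalar_C, evalScalar_X, mul_smul_comm,
      mul_one, Matrix.mul_apply, Matrix.mul_apply, Finset.smul_sum, ← Finset.sum_add_distrib]
    refine Finset.sum_congr rfl fun d _ => ?_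
    rw [lax_eq_map, map_add, map_smul, Matrix.map_apply, Matrix.map_apply, add_mul, smul_mul_assoc]
  rw [e, Finset.sum_mul]
  exact Submodule.sum_mem _ fun d _ => mul_mem_flagOps m h (fun v hv => hv.localLax d) (hB d j)

/-- Evaluated at $X=z$, each column polynomial is $\sum_d(L_{0d}+zL_{1d})B_{dj}$, and each
$L_{0d}+zL_{1d}$ moves the flag of $z$ up by one step. The word of length $2s_n+1$ therefore
vanishes at every $z$, hence as a polynomial. -/
theorem sortedWord_eq_zero {n : Fin N} {M B : ℕ → Matrix (Fin 2) (Fin 2) (Op m)}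
    (hM : ∀ l : ℕ, M l = lax η m n (-η / 2 - (m n : ℂ) / 2 * η + l * η) * B l)
    (hB : ∀ l i j Z, Commute (siteHom m n Z) (B l i j)) (p : ℕ) :
    sortedWord M (m n + 1) p = 0 := by
  refine eq_zero_of_evalScalar fun z => ?_
  have : ∀ l p, evalScalar z (sortedWord M l p) ∈ flagOps m n z l := by
    intro l
    induction l with
    | zero =>
      intro p
      rw [sortedWord, map_one]
      exact one_mem_flagOps m n z
    | succ l ih =>
      intro p
      rw [sortedWord]
      split_ifs
      · rw [map_mul, hM]
        exact evalScalar_colPoly_mul_mem η m (ih _) (hB l) _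
      · rw [map_mul, hM]
        exact evalScalar_colPoly_mul_mem η m (ih _) (hB l) _
  exact flagOps_eq_zero m (this _ p)

/-- The fusion hierarchy of the site `n` is closed. -/
theorem fusedTransfer_eq_zero (n : Fin N) :
    fusedTransfer K η m ξ (m n + 1) (node η m ξ n (m n)) = 0 := by
  obtain ⟨l₁, l₂, hl⟩ := List.append_of_mem
    (show n ∈ List.ofFn fun k : Fin N => k.rev from List.mem_ofFn.2 ⟨n.rev, Fin.rev_rev n⟩)
  have hnd := nodup_ofFn_rev (N := N)
  rw [hl] at hnd
  set A : Fin N → ℂ → Matrix (Fin 2) (Fin 2) (Op m) := fun n u => lax η m n (u - ξ n) with hA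
  set K' : Matrix (Fin 2) (Fin 2) (Op m) := K.map (algebraMap ℂ (Op m))
  set P₁ : ℂ → Matrix (Fin 2) (Fin 2) (Op m) := fun u => (l₁.map fun n => A n u).prod with hP₁
  set P₂ : ℂ → Matrix (Fin 2) (Fin 2) (Op m) := fun u => (l₂.map fun n => A n u).prod with hP₂
  have hn₁ : n ∉ l₁ := by
    intro h
    simp [List.nodup_append] at hnd
    exact (hnd.2.2 n h).1 rfl
  have hn₂ : n ∉ l₂ := by
    intro h
    simp [List.nodup_append] at hnd
    exact hnd.2.1.1 h
  have hnd₁ : l₁.Nodup := hnd.of_append_left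
  have hnd₂ : l₂.Nodup := (List.nodup_cons.1 hnd.of_append_right).2
  have hdisj : ∀ k ∈ l₁, ∀ k' ∈ l₂, k ≠ k' := by
    rintro k hk k' hk' rfl
    simp [List.nodup_append] at hnd
    exact (hnd.2.2 k hk).2 k hk' rfl
  have hAc : ∀ k k' u v, k ≠ k' → EntriesCommute (A k u) (A k' v) := fun k k' u v h =>
    entriesCommute_lax m η h _ _
  have hc1 : ∀ u v, EntriesCommute (A n u) (P₁ v) := fun u v =>
    EntriesCommute.list_prod_right fun k hk => hAc _ _ _ _ fun e => hn₁ (e ▸ hk)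
  have hc2 : ∀ u v, EntriesCommute (A n u) (P₂ v) := fun u v =>
    EntriesCommute.list_prod_right fun k hk => hAc _ _ _ _ fun e => hn₂ (e ▸ hk)
  have hc12 : ∀ u v, EntriesCommute (P₂ u) (P₁ v) := fun u v =>
    EntriesCommute.list_prod_right fun k hk => EntriesCommute.symm <|
      EntriesCommute.list_prod_right fun k' hk' => hAc _ _ _ _ (hdisj k hk k' hk')
  have hK : ∀ X : Matrix (Fin 2) (Fin 2) (Op m), EntriesCommute X K' := fun X =>
    entriesCommute_algebraMap X K
  -- The Lax operator of the site $n$ is rotated to the front. The fused transfer matrix depends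
  -- only on the trace and the quantum determinant, and both are unchanged by the rotation.
  set Mt : ℂ → Matrix (Fin 2) (Fin 2) (Op m) := fun u => A n u * (P₂ u * (K' * P₁ u)) with hMt
  have htr : ∀ u, transfer K η m ξ u = (Mt u).trace := by
    intro u
    rw [transfer, monodromy_eq, hl, List.map_append, List.map_cons, List.prod_append,
      List.prod_cons]
    have : EntriesCommute (K' * P₁ u) (A n u * P₂ u) :=
      EntriesCommute.mul_right ((hK _).mul_right (hc1 u u)).symm
        ((hK _).mul_right (hc12 u u)).symm
    change (K' * (P₁ u * (A n u * P₂ u))).trace = _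
    rw [← Matrix.mul_assoc, this.trace_mul_comm, hMt, Matrix.mul_assoc]
  have hq : ∀ u, QDet (Mt u) (Mt (u - η)) (qdet K η m ξ u) := by
    intro u
    have hA' : ∀ k, QDet (A k u) (A k (u - η)) ((u - ξ k + η / 2 + (m k : ℂ) / 2 * η) *
        (u - ξ k - η / 2 - (m k : ℂ) / 2 * η)) := by
      intro k
      simp only [hA]
      rw [sub_right_comm]
      exact qdet_lax η m k (u - ξ k)
    have h := (hA' n).mul ((qdet_list_prod hA' (fun k k' h => hAc k k' _ _ h) hnd₂).mul
      ((qdet_algebraMap K).mul (qdet_list_prod hA' (fun k k' h => hAc k k' _ _ h) hnd₁) (hK _))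
      ((hK _).mul_right (hc12 (u - η) u)).symm)
      ((hc2 (u - η) u).mul_right ((hK _).mul_right (hc1 (u - η) u))).symm
    rw [qdet_eq_prod, ← prod_map_ofFn_rev, hl, List.map_append, List.map_cons, List.prod_append,
      List.prod_cons]
    convert h using 1
    ring
  rw [fusedTransfer_eq_fusionSeq]
  simp only [htr]
  rw [← sum_coeff_sortedWord (M := fun l : ℕ => Mt (node η m ξ n (m n) + l * η))]
  · refine Finset.sum_eq_zero fun p _ => ?_
    rw [sortedWord_eq_zero η m (n := n)
      (B := fun l : ℕ => P₂ (node η m ξ n (m n) + l * η) *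
        (K' * P₁ (node η m ξ n (m n) + l * η))), coeff_zero]
    · intro l
      simp only [hMt, hA]
      congr 2
      rw [node]
      ring
    · intro l i j Z
      -- A matrix with all entries equal, so that the lemmas on `EntriesCommute` apply to a single
      -- operator.
      let S : Matrix (Fin 2) (Fin 2) (Op m) := Matrix.of fun _ _ => siteHom m n Z
      have hS : ∀ (L : List (Fin N)) (u : ℂ), n ∉ L →
          EntriesCommute S (L.map fun k => A k u).prod := fun L u hL =>
        EntriesCommute.list_prod_right fun k hk i j i' j' => by
          simp only [hA, lax_eq_map]
          exact commute_siteHom m (fun e : n = k => hL (e.symm ▸ hk)) _ _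
      exact ((hS l₂ _ hn₂).mul_right ((hK S).mul_right (hS l₁ _ hn₁))) 0 0 i j
  · intro l
    have h := hq (node η m ξ n (m n) + (l + 1 : ℕ) * η)
    rwa [show node η m ξ n (m n) + (l + 1 : ℕ) * η - η = node η m ξ n (m n) + l * η by
      push_cast; ring] at h

end Vanishing

/-! ### Tridiagonal determinants -/

section Tridiagonal

/-- A tridiagonal matrix with diagonal `α`, superdiagonal `b` and subdiagonal `c` (indexed by
rows), starting from the index `s`. -/
def tridiag (α b c : ℕ → ℂ) (s l : ℕ) : Matrix (Fin l) (Fin l) ℂ :=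
  Matrix.of fun i j => if j = i then α (s + i) else if (j : ℕ) = (i : ℕ) + 1 then b (s + i)
    else if (i : ℕ) = (j : ℕ) + 1 then c (s + i) else 0

theorem det_tridiag_succ_succ (α b c : ℕ → ℂ) (s l : ℕ) :
    (tridiag α b c s (l + 2)).det = α s * (tridiag α b c (s + 1) (l + 1)).det -
      b s * c (s + 1) * (tridiag α b c (s + 2) l).det := by
  rw [Matrix.det_succ_row_zero, Fin.sum_univ_succ, Fin.sum_univ_succ, Finset.sum_eq_zero]
  · have e1 : (tridiag α b c s (l + 2)).submatrix Fin.succ (Fin.succAbove 0) =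
        tridiag α b c (s + 1) (l + 1) := by
      ext i j
      simp [tridiag, add_assoc, add_comm 1]
    have e2 : ((tridiag α b c s (l + 2)).submatrix Fin.succ (Fin.succAbove (Fin.succ 0))).det =
        c (s + 1) * (tridiag α b c (s + 2) l).det := by
      rw [Matrix.det_succ_column_zero, Fin.sum_univ_succ, Finset.sum_eq_zero]
      · have e3 : ((tridiag α b c s (l + 2)).submatrix Fin.succ
            (Fin.succAbove (Fin.succ 0))).submatrix (Fin.succAbove 0) Fin.succ =
            tridiag α b c (s + 2) l := by
          ext i j
          have : (Fin.succ 0 : Fin (l + 2)).succAbove j.succ = j.succ.succ := by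
            simp
          simp only [Matrix.submatrix_apply, this, Fin.succAbove_zero]
          simp [tridiag, add_assoc, add_comm 2]
        rw [e3]
        simp [tridiag]
      · intro i _
        have : ¬ (0 : Fin (l + 2)) = i.succ.succ := fun h => by simpa using congrArg Fin.val h
        simp [tridiag, this]
    rw [e1, e2]
    simp [tridiag]
    ring
  · intro i _
    simp [tridiag]

/-- Expansion along the first row of the lower right blocks: the fusion recursion builds the
determinant from the bottom row upwards. -/
theorem det_tridiag (α b c : ℕ → ℂ) (n l : ℕ) (hl : l ≤ n + 1) :
    (tridiag α b c (n + 1 - l) l).det =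
      fusionSeq (fun k => α (n - k)) (fun k => b (n - k) * c (n - k + 1)) l := by
  induction l using Nat.strong_induction_on with
  | _ l ih =>
  match l, ih with
  | 0, _ => simp [fusionSeq]
  | 1, _ => simp [fusionSeq, tridiag]
  | l + 2, ih =>
    have h1 := ih (l + 1) (by omega) (by omega)
    have h2 := ih l (by omega) (by omega)
    rw [det_tridiag_succ_succ, fusionSeq, ← h1, ← h2, smul_eq_mul]
    rw [show n + 1 - (l + 2) + 1 = n + 1 - (l + 1) by omega,
      show n + 1 - (l + 2) + 2 = n + 1 - l by omega,
      show n - (l + 1) = n + 1 - (l + 2) by omega,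
      show n + 1 - (l + 2) + 1 = n + 1 - (l + 1) by omega]

variable {N : ℕ} (K : Matrix (Fin 2) (Fin 2) ℂ) (η : ℂ) (m : Fin N → ℕ) (ξ : Fin N → ℂ)

theorem node_eq_add (n : Fin N) {k : ℕ} (hk : k ≤ m n) :
    node η m ξ n (m n - k) = node η m ξ n (m n) + k * η := by
  rw [node, node, Nat.cast_sub hk]
  ring

theorem det_discreteMatrix {k₁ k₂ : ℂ} (hk : k₁ * k₂ = K.det) (t : ℂ → ℂ) (n : Fin N) :
    (discreteMatrix k₁ k₂ η m ξ t n).det =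
      fusedValue K η m ξ t (m n + 1) (node η m ξ n (m n)) := by
  have h := det_tridiag (fun i => t (node η m ξ n i)) (fun i => -(k₁ * aFun η m ξ (node η m ξ n i)))
    (fun i => -(k₂ * dFun η m ξ (node η m ξ n i))) (m n) (m n + 1) le_rfl
  have e : discreteMatrix k₁ k₂ η m ξ t n = tridiag (fun i => t (node η m ξ n i))
      (fun i => -(k₁ * aFun η m ξ (node η m ξ n i)))
      (fun i => -(k₂ * dFun η m ξ (node η m ξ n i))) (m n + 1 - (m n + 1)) (m n + 1) := by
    ext i j
    simp [discreteMatrix, tridiag]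
  rw [e, h, fusedValue_eq_fusionSeq]
  refine fusionSeq_congr (n := m n + 1) (fun l hl => ?_) (fun l hl => ?_) le_rfl
  · rw [node_eq_add η m ξ n (by omega)]
  · have h1 : node η m ξ n (m n - l + 1) = node η m ξ n (m n) + l * η - η := by
      rw [← node_eq_add η m ξ n (by omega), node, node]
      push_cast
      ring
    rw [h1, node_eq_add η m ξ n (by omega), qdet, ← hk]
    ring

/-- The other end of the hierarchy: the recursion at this node also holds at level 0, whatever value
is assigned to level $-1$. -/
theorem qdet_node_last (n : Fin N) : qdet K η m ξ (node η m ξ n (m n)) = 0 := by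
  have : aFun η m ξ (node η m ξ n (m n)) = 0 := by
    rw [aFun, Finset.prod_eq_zero (Finset.mem_univ n)]
    rw [node]
    ring
  rw [qdet, this, zero_mul, mul_zero]

end Tridiagonal

/-! ### Dependence on the spectral parameter -/

section Degree

variable {E F : Type*} [AddCommGroup E] [Module ℂ E] [AddCommGroup F] [Module ℂ F]

/-- `f` is a polynomial function of degree at most `n`, with coefficient `r` of degree `n`. -/
def HasLeading (n : ℕ) (r : E) (f : ℂ → E) : Prop :=
  ∃ c : ℕ → E, c n = r ∧ ∀ u, f u = ∑ k ∈ Finset.range (n + 1), u ^ k • c k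

theorem HasLeading.map {n : ℕ} {r : E} {f : ℂ → E} (h : HasLeading n r f) (g : E →ₗ[ℂ] F) :
    HasLeading n (g r) fun u => g (f u) := by
  obtain ⟨c, rfl, hf⟩ := h
  exact ⟨fun k => g (c k), rfl, fun u => by simp [hf]⟩

theorem HasLeading.sub {n : ℕ} {r s : E} {f g : ℂ → E} (hf : HasLeading n r f)
    (hg : HasLeading n s g) : HasLeading n (r - s) fun u => f u - g u := by
  obtain ⟨c, rfl, hf⟩ := hf
  obtain ⟨d, rfl, hg⟩ := hg
  exact ⟨c - d, rfl, fun u => by simp [hf, hg, smul_sub]⟩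

theorem HasLeading.add {n : ℕ} {r s : E} {f g : ℂ → E} (hf : HasLeading n r f)
    (hg : HasLeading n s g) : HasLeading n (r + s) fun u => f u + g u := by
  obtain ⟨c, rfl, hf⟩ := hf
  obtain ⟨d, rfl, hg⟩ := hg
  exact ⟨c + d, rfl, fun u => by simp [hf, hg, smul_add, Finset.sum_add_distrib]⟩

theorem HasLeading.linear_mul {R : Type*} [Ring R] [Algebra ℂ R] {n : ℕ} {r : R} {f : ℂ → R}
    (h : HasLeading n r f) (a b : R) :
    HasLeading (n + 1) (a * r) fun u => (u • a + b) * f u := by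
  obtain ⟨c, rfl, hf⟩ := h
  -- The second condition is needed because `c` is unconstrained above degree $n$.
  refine ⟨fun k => (if k = 0 then 0 else a * c (k - 1)) + if k ≤ n then b * c k else 0,
    by simp, fun u => ?_⟩
  simp only [smul_add, Finset.sum_add_distrib]
  rw [Finset.sum_range_succ', Finset.sum_range_succ _ (n + 1), hf, add_mul, Finset.mul_sum,
    Finset.mul_sum]
  simp
  congr 1
  · refine Finset.sum_congr rfl fun k _ => ?_
    rw [smul_smul, pow_succ]
  · refine Finset.sum_congr rfl fun k hk => ?_
    rw [if_pos (by simpa [Nat.lt_succ_iff] using hk)]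

theorem HasLeading.const {R : Type*} [Ring R] [Algebra ℂ R] (r : R) :
    HasLeading 0 r fun _ => r := ⟨fun _ => r, rfl, fun u => by simp⟩

theorem hasLeading_list_prod {R ι : Type*} [Ring R] [Algebra ℂ R] (b : ι → R) (l : List ι) :
    HasLeading l.length (1 : R) fun u => (l.map fun n => u • 1 + b n).prod := by
  induction l with
  | nil => simpa using HasLeading.const (1 : R)
  | cons n l ih => simpa using ih.linear_mul 1 (b n)

/-- The coefficients of $u^N$ cancel in the difference, which has degree below $N$ and $N$ distinct
zeros. -/
theorem HasLeading.eq_of_eq {N : ℕ} {r : ℂ} {f g : ℂ → ℂ} (hf : HasLeading N r f)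
    (hg : HasLeading N r g) {z : Fin N → ℂ} (hz : Function.Injective z)
    (h : ∀ n, f (z n) = g (z n)) : f = g := by
  obtain ⟨c, hc, hd⟩ := hf.sub hg
  rw [sub_self] at hc
  simp only [Finset.sum_range_succ, hc, smul_zero, add_zero] at hd
  set P : ℂ[X] := ∑ k ∈ Finset.range N, C (c k) * X ^ k with hP
  have hev : ∀ u, P.eval u = f u - g u := fun u => by
    rw [hd, hP, eval_finsetSum]
    exact Finset.sum_congr rfl fun k _ => by
      rw [eval_mul, eval_C, eval_pow, eval_X, smul_eq_mul, mul_comm]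
  have hdeg : P.degree < (Finset.univ : Finset (Fin N)).card := by
    rw [Finset.card_univ, Fintype.card_fin]
    refine (degree_sum_le _ _).trans_lt
      ((Finset.sup_lt_iff (WithBot.bot_lt_coe _)).2 fun k hk => ?_)
    exact (degree_C_mul_X_pow_le _ _).trans_lt (by exact_mod_cast Finset.mem_range.1 hk)
  have : P = 0 := Polynomial.eq_zero_of_degree_lt_of_eval_index_eq_zero Finset.univ
    (v := z) hz.injOn hdeg fun n _ => by rw [hev, h, sub_self]
  funext u
  have := hev u
  rw [‹P = 0›, eval_zero] at this
  exact (sub_eq_zero.1 this.symm)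

variable {N : ℕ} (K : Matrix (Fin 2) (Fin 2) ℂ) (η : ℂ) (m : Fin N → ℕ) (ξ : Fin N → ℂ)

theorem hasLeading_transfer :
    HasLeading N (K.trace • (1 : Op m)) (transfer K η m ξ) := by
  have h := hasLeading_list_prod (R := Matrix (Fin 2) (Fin 2) (Op m))
    (fun n : Fin N => -ξ n • 1 + lax η m n 0) (List.ofFn fun k : Fin N => k.rev)
  rw [List.length_ofFn] at h
  have h2 := h.map ((Matrix.traceLinearMap (Fin 2) ℂ (Op m)).comp
    (LinearMap.mulLeft ℂ (K.map (algebraMap ℂ (Op m)))))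
  convert h2 using 1
  · simp [Matrix.trace, Algebra.smul_def]
  · funext u
    rw [transfer, monodromy_eq]
    simp only [LinearMap.comp_apply, LinearMap.mulLeft_apply, Matrix.traceLinearMap_apply]
    congr 4
    funext n
    rw [lax_eq, ← add_assoc, ← add_smul, sub_eq_add_neg]

theorem HasLeading.raise {n : ℕ} {r : E} {f : ℂ → E} (h : HasLeading n r f) :
    HasLeading (n + 1) (0 : E) f := by
  obtain ⟨c, rfl, hf⟩ := h
  refine ⟨fun k => if k ≤ n then c k else 0, by simp, fun u => ?_⟩
  rw [hf, Finset.sum_range_succ _ (n + 1)]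
  simp only [Nat.succ_le_iff, lt_irrefl, if_false, smul_zero, add_zero]
  exact Finset.sum_congr rfl fun k hk => by
    rw [if_pos (Nat.lt_succ_iff.1 (Finset.mem_range.1 hk))]

theorem hasLeading_prod {ι : Type*} (z : ι → ℂ) (s : Finset ι) :
    HasLeading s.card (1 : ℂ) fun u => ∏ a ∈ s, (u - z a) := by
  classical
  induction s using Finset.induction_on with
  | empty => simpa using HasLeading.const (1 : ℂ)
  | insert a s ha ih =>
    simpa [ha, sub_eq_add_neg] using ih.linear_mul 1 (-z a)

theorem HasLeading.sum {ι : Type*} {n : ℕ} {r : ι → E} {f : ι → ℂ → E} {s : Finset ι}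
    (h : ∀ a ∈ s, HasLeading n (r a) (f a)) :
    HasLeading n (∑ a ∈ s, r a) fun u => ∑ a ∈ s, f a u := by
  classical
  induction s using Finset.induction_on with
  | empty => exact ⟨0, rfl, fun u => by simp⟩
  | insert a s ha ih =>
    simp only [Finset.sum_insert ha]
    exact (h a (by simp)).add (ih fun b hb => h b (by simp [hb]))

theorem hasLeading_interpolant (x : Fin N → ℂ) :
    HasLeading N K.trace (interpolant K η m ξ x) := by
  have h1 := (hasLeading_prod (fun a => node η m ξ a 0) Finset.univ).map
    (LinearMap.mulLeft ℂ K.trace)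
  rw [Finset.card_univ, Fintype.card_fin] at h1
  have h2 : HasLeading N (∑ a : Fin N, (0 : ℂ)) fun u => ∑ a, (∏ b ∈ Finset.univ.erase a,
      (u - node η m ξ b 0) / (node η m ξ a 0 - node η m ξ b 0)) * x a := by
    refine HasLeading.sum fun a _ => ?_
    have h := ((hasLeading_prod (fun a => node η m ξ a 0) (Finset.univ.erase a)).map
      (LinearMap.mulLeft ℂ ((∏ b ∈ Finset.univ.erase a,
        (node η m ξ a 0 - node η m ξ b 0))⁻¹ * x a))).raise
    rw [Finset.card_erase_add_one (Finset.mem_univ a), Finset.card_univ, Fintype.card_fin] at h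
    convert h using 2 with u
    rw [Finset.prod_div_distrib, LinearMap.mulLeft_apply]
    ring
  have h3 := h1.add h2
  simp only [Finset.sum_const_zero, add_zero, LinearMap.mulLeft_apply, mul_one] at h3
  exact h3

theorem interpolant_node {x : Fin N → ℂ}
    (hinj : Function.Injective fun n => node η m ξ n 0) (n : Fin N) :
    interpolant K η m ξ x (node η m ξ n 0) = x n := by
  rw [interpolant, Finset.prod_eq_zero (Finset.mem_univ n) (sub_self _), mul_zero, zero_add,
    Finset.sum_eq_single n]
  · rw [Finset.prod_eq_one, one_mul]
    intro b hb
    exact div_self (sub_ne_zero.2 fun e => (Finset.ne_of_mem_erase hb).symm (hinj e))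
  · intro b _ hb
    rw [Finset.prod_eq_zero (i := n) (by simp [Ne.symm hb]) (by simp), zero_mul]
  · simp

end Degree

/-! ### Separation of variables in a given basis -/

section ListProd

variable {N : ℕ} {R : Type*}

/-- Isolates one factor of an ordered product. The right remainder inherits commutation relations,
so that a further operator can be moved next to the isolated factor. -/
theorem exists_prod_ofFn_update [Monoid R] (Q : Fin N → R) (n : Fin N) :
    ∃ A B : R, (∀ X, (List.ofFn (Function.update Q n X)).prod = A * X * B) ∧
      ∀ T, (∀ j, Commute T (Q j)) → Commute T B := by
  obtain ⟨l₁, l₂, hl⟩ := List.append_of_mem (List.mem_finRange n)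
  have hnd := List.nodup_finRange N
  rw [hl] at hnd
  have hn₁ : n ∉ l₁ := by
    intro h
    simp [List.nodup_append] at hnd
    exact (hnd.2.2 n h).1 rfl
  have hn₂ : n ∉ l₂ := by
    intro h
    simp [List.nodup_append] at hnd
    exact hnd.2.1.1 h
  refine ⟨(l₁.map Q).prod, (l₂.map Q).prod, fun X => ?_, fun T hT => ?_⟩
  · have h₁ : l₁.map (Function.update Q n X) = l₁.map Q := List.map_congr_left fun k hk =>
      Function.update_of_ne (fun e => hn₁ (by rwa [← e])) _ _
    have h₂ : l₂.map (Function.update Q n X) = l₂.map Q := List.map_congr_left fun k hk =>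
      Function.update_of_ne (fun e => hn₂ (by rwa [← e])) _ _
    rw [List.ofFn_eq_map, hl, List.map_append, List.map_cons, List.prod_append, List.prod_cons,
      Function.update_self, ← mul_assoc, h₁, h₂]
  · refine (Commute.list_prod_left (l₂.map Q) T fun x hx => ?_).symm
    obtain ⟨k, -, rfl⟩ := List.mem_map.1 hx
    exact (hT k).symm

theorem prod_ofFn_smul [Ring R] [Algebra ℂ R] (c : Fin N → ℂ) (Q : Fin N → R) :
    (List.ofFn fun n => c n • Q n).prod = (∏ n, c n) • (List.ofFn Q).prod := by
  induction N with
  | zero => simp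
  | succ N ih =>
    rw [List.ofFn_succ, List.prod_cons, ih (fun n => c n.succ) fun n => Q n.succ,
      List.ofFn_succ, List.prod_cons, smul_mul_smul_comm, Fin.prod_univ_succ]

theorem prod_ofFn_mulVec {ι : Type*} [Fintype ι] [DecidableEq ι] {Q : Fin N → Matrix ι ι ℂ}
    {f : Fin N → ℂ} {v : ι → ℂ} (h : ∀ n, Q n *ᵥ v = f n • v) :
    (List.ofFn Q).prod *ᵥ v = (∏ n, f n) • v := by
  induction N with
  | zero => simp
  | succ N ih =>
    rw [List.ofFn_succ, List.prod_cons, ← Matrix.mulVec_mulVec,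
      ih (f := fun n => f n.succ) fun n => h n.succ, Matrix.mulVec_smul, h, smul_smul,
      Fin.prod_univ_succ, mul_comm]

end ListProd

/-! ### The spectral problem tested against the separation of variables covectors -/

section Basis

theorem isBasisFamily_iff {N : ℕ} {m : Fin N → ℕ} (c : Conf m → (Conf m → ℂ)) :
    IsBasisFamily c ↔ (Matrix.of c).det ≠ 0 := by
  rw [IsBasisFamily, ← isUnit_iff_ne_zero, ← Matrix.isUnit_iff_isUnit_det,
    ← Matrix.linearIndependent_rows_iff_isUnit]
  refine ⟨fun h => h.1, fun h => ⟨h, ?_⟩⟩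
  exact LinearIndependent.span_eq_top_of_card_eq_finrank' h (by simp)

theorem IsBasisFamily.eq_of_dotProduct {N : ℕ} {m : Fin N → ℕ} {c : Conf m → (Conf m → ℂ)}
    (hc : IsBasisFamily c) {v w : Conf m → ℂ} (h : ∀ i, c i ⬝ᵥ v = c i ⬝ᵥ w) : v = w := by
  rw [isBasisFamily_iff] at hc
  have : Matrix.of c *ᵥ v = Matrix.of c *ᵥ w := funext h
  exact Matrix.mulVec_injective_of_isUnit
    ((Matrix.isUnit_iff_isUnit_det _).2 (isUnit_iff_ne_zero.2 hc)) this

theorem IsBasisFamily.exists_dotProduct {N : ℕ} {m : Fin N → ℕ} {c : Conf m → (Conf m → ℂ)}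
    (hc : IsBasisFamily c) (w : Conf m → ℂ) : ∃ v, ∀ i, c i ⬝ᵥ v = w i := by
  rw [isBasisFamily_iff] at hc
  refine ⟨(Matrix.of c)⁻¹ *ᵥ w, fun i => ?_⟩
  have : Matrix.of c *ᵥ ((Matrix.of c)⁻¹ *ᵥ w) = w := by
    rw [Matrix.mulVec_mulVec, Matrix.mul_nonsing_inv _ (isUnit_iff_ne_zero.2 hc),
      Matrix.one_mulVec]
  exact congrFun this i

variable {N : ℕ} (K : Matrix (Fin 2) (Fin 2) ℂ) (η : ℂ) (m : Fin N → ℕ) (ξ : Fin N → ℂ)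

theorem fusedTransfer_mulVec {t : ℂ → ℂ} {v : Conf m → ℂ} (hv : v ∈ eigenspace K η m ξ t) (l : ℕ)
    (u : ℂ) : fusedTransfer K η m ξ l u *ᵥ v = fusedValue K η m ξ t l u • v := by
  rw [fusedTransfer_eq_fusionSeq, fusedValue_eq_fusionSeq]
  exact fusionSeq_mulVec (fun l => hv _) _ l

theorem commute_fusedTransfer (u v : ℂ) (l : ℕ) :
    Commute (transfer K η m ξ u) (fusedTransfer K η m ξ l v) := by
  rw [fusedTransfer_eq_fusionSeq]
  exact commute_fusionSeq (fun l => commute_transfer K η m ξ _ _) _ l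

theorem sovCovector_dotProduct (k₂ : ℂ) (S : Conf m → ℂ) {t : ℂ → ℂ} {v : Conf m → ℂ}
    (hv : v ∈ eigenspace K η m ξ t) (h : Conf m) :
    sovCovector K k₂ η m ξ S h ⬝ᵥ v =
      (∏ n, fusedValue K η m ξ t (m n - (h n : ℕ)) (node η m ξ n (m n)) /
        sovDenominator k₂ η m ξ n (h n)) * S ⬝ᵥ v := by
  rw [sovCovector, ← Matrix.dotProduct_mulVec, prod_ofFn_mulVec (f := fun n =>
    fusedValue K η m ξ t (m n - (h n : ℕ)) (node η m ξ n (m n)) /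
        sovDenominator k₂ η m ξ n (h n)) fun n => ?_, dotProduct_smul, smul_eq_mul]
  rw [Matrix.smul_mulVec, fusedTransfer_mulVec K η m ξ hv, smul_smul, div_eq_inv_mul]

theorem eq_interpolant_of_mem_spectrumT (hinj : Function.Injective fun n => node η m ξ n 0)
    {t : ℂ → ℂ} (ht : t ∈ spectrumT K η m ξ) :
    t = interpolant K η m ξ fun a => t (node η m ξ a 0) := by
  obtain ⟨v, hv, hv0⟩ := ht
  obtain ⟨i, hi⟩ := Function.ne_iff.1 hv0
  have h1 : HasLeading N K.trace t := by
    -- Reads the eigenvalue off a nonzero component of $v$, so that $t$ inherits the polynomial form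
    -- of the transfer matrix.
    let g : Op m →ₗ[ℂ] ℂ :=
      (v i)⁻¹ • (LinearMap.proj i).comp ((Matrix.mulVecBilin ℂ ℂ).flip v)
    have hg : ∀ A : Op m, g A = (v i)⁻¹ * (A *ᵥ v) i := fun A => rfl
    have h := (hasLeading_transfer K η m ξ).map g
    convert h using 1
    · rw [hg, Matrix.smul_mulVec, Matrix.one_mulVec, Pi.smul_apply, smul_eq_mul, mul_left_comm,
        inv_mul_cancel₀ hi, mul_one]
    · funext u
      rw [hg, hv u, Pi.smul_apply, smul_eq_mul, mul_left_comm, inv_mul_cancel₀ hi, mul_one]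
  refine h1.eq_of_eq (hasLeading_interpolant K η m ξ _) hinj fun n => ?_
  exact (interpolant_node K η m ξ (x := fun a => t (node η m ξ a 0)) hinj n).symm

theorem det_discreteMatrix_eq_zero {k₁ k₂ : ℂ} (hk : k₁ * k₂ = K.det) {t : ℂ → ℂ}
    (ht : t ∈ spectrumT K η m ξ) (n : Fin N) : (discreteMatrix k₁ k₂ η m ξ t n).det = 0 := by
  obtain ⟨v, hv, hv0⟩ := ht
  rw [det_discreteMatrix K η m ξ hk]
  have h := fusedTransfer_mulVec K η m ξ hv (m n + 1) (node η m ξ n (m n))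
  rw [fusedTransfer_eq_zero, Matrix.zero_mulVec] at h
  exact (smul_eq_zero.1 h.symm).resolve_right hv0

/-- The fusion recursion solved for the product. The case $l=0$, with the truncated $l-1=0$, is
included because the quantum determinant vanishes there. -/
theorem fusedTransfer_mul_transfer (n : Fin N) (l : ℕ) :
    fusedTransfer K η m ξ l (node η m ξ n (m n)) *
        transfer K η m ξ (node η m ξ n (m n) + l * η) =
      fusedTransfer K η m ξ (l + 1) (node η m ξ n (m n)) +
        qdet K η m ξ (node η m ξ n (m n) + l * η) •
          fusedTransfer K η m ξ (l - 1) (node η m ξ n (m n)) := by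
  rw [← (commute_fusedTransfer K η m ξ _ _ l).eq]
  simp only [fusedTransfer_eq_fusionSeq]
  rcases l with _ | l
  · simp [fusionSeq, qdet_node_last]
  · simp only [fusionSeq, Nat.add_sub_cancel]
    abel

theorem fusedValue_mul (t : ℂ → ℂ) (n : Fin N) (l : ℕ) :
    fusedValue K η m ξ t l (node η m ξ n (m n)) * t (node η m ξ n (m n) + l * η) =
      fusedValue K η m ξ t (l + 1) (node η m ξ n (m n)) +
        qdet K η m ξ (node η m ξ n (m n) + l * η) *
          fusedValue K η m ξ t (l - 1) (node η m ξ n (m n)) := by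
  simp only [fusedValue_eq_fusionSeq]
  rcases l with _ | l
  · simp [fusionSeq, qdet_node_last]
  · simp only [fusionSeq, Nat.add_sub_cancel, smul_eq_mul]
    ring

theorem sovCovector_eq_smul (k₂ : ℂ) (S : Conf m → ℂ) (h : Conf m) :
    sovCovector K k₂ η m ξ S h = (∏ n, (sovDenominator k₂ η m ξ n (h n))⁻¹) •
      (S ᵥ* (List.ofFn fun n =>
        fusedTransfer K η m ξ (m n - (h n : ℕ)) (node η m ξ n (m n))).prod) := by
  rw [sovCovector, prod_ofFn_smul, Matrix.vecMul_smul]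

theorem sovDenominator_ne_zero
    (hdist : ∀ a b : Fin N, a ≠ b → ∀ h ≤ m a, ∀ k ≤ m b, node η m ξ a h ≠ node η m ξ b k)
    (hη : η ≠ 0) {k₂ : ℂ} (hk₂ : k₂ ≠ 0) (n : Fin N) {h : ℕ}
    (hh : h ≤ m n) : sovDenominator k₂ η m ξ n h ≠ 0 := by
  refine mul_ne_zero (pow_ne_zero _ hk₂) (Finset.prod_ne_zero_iff.2 fun k hk => ?_)
  rw [Finset.mem_range] at hk
  refine Finset.prod_ne_zero_iff.2 fun b _ => ?_
  -- The zeros of $d$ are the nodes of index 0, while the index $2s_n-k$ is at least 1 here.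
  have e : node η m ξ n (m n - k) - (ξ b - η / 2) - (m b : ℂ) / 2 * η =
      node η m ξ n (m n - k) - node η m ξ b 0 := by
    rw [node, node]; push_cast; ring
  rw [e, sub_ne_zero]
  by_cases hb : n = b
  · subst hb
    intro e
    have : ((m n - k : ℕ) : ℂ) * η = 0 := by
      rw [node, node] at e
      linear_combination -e
    rcases mul_eq_zero.1 this with h0 | h0
    · have : m n - k = 0 := by exact_mod_cast h0
      omega
    · exact hη h0
  · exact hdist n b hb _ (by omega) _ (by omega)

/-- The discrete spectral problem suffices: for each $h$ the eigenvalue equation is an identity of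
polynomials of degree at most $N$ in $u$ with a common coefficient of $u^N$, and it is checked at
one point per site, chosen according to $h$. -/
theorem mem_eigenspace_of_dotProduct
    (hdist : ∀ a b : Fin N, a ≠ b → ∀ h ≤ m a, ∀ k ≤ m b, node η m ξ a h ≠ node η m ξ b k)
    (hη : η ≠ 0) {k₂ : ℂ} (hk₂ : k₂ ≠ 0) {S : Conf m → ℂ}
    (hS : IsBasisFamily (sovCovector K k₂ η m ξ S)) {t : ℂ → ℂ} (ht : HasLeading N K.trace t)
    (ht0 : ∀ n, fusedValue K η m ξ t (m n + 1) (node η m ξ n (m n)) = 0) {v : Conf m → ℂ}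
    (hv : ∀ h, sovCovector K k₂ η m ξ S h ⬝ᵥ v =
      ∏ n, fusedValue K η m ξ t (m n - (h n : ℕ)) (node η m ξ n (m n)) /
        sovDenominator k₂ η m ξ n (h n)) : v ∈ eigenspace K η m ξ t := by
  set F : (n : Fin N) → ℕ → Op m := fun n l => fusedTransfer K η m ξ l (node η m ξ n (m n)) with hF
  set f : (n : Fin N) → ℕ → ℂ := fun n l => fusedValue K η m ξ t l (node η m ξ n (m n)) with hf
  have hv' : ∀ l : Fin N → ℕ, (∀ n, l n ≤ m n) →
      S ⬝ᵥ ((List.ofFn fun n => F n (l n)).prod *ᵥ v) = ∏ n, f n (l n) := by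
    intro l hl
    have h := hv fun n => ⟨m n - l n, by omega⟩
    have e : ∀ n, m n - (m n - l n) = l n := fun n => by have := hl n; omega
    rw [sovCovector_eq_smul, smul_dotProduct, ← Matrix.dotProduct_mulVec,
      Finset.prod_div_distrib, Finset.prod_inv_distrib, smul_eq_mul, div_eq_inv_mul] at h
    have h' := mul_left_cancel₀ (inv_ne_zero (Finset.prod_ne_zero_iff.2 fun n _ =>
      sovDenominator_ne_zero η m ξ hdist hη hk₂ n (by simp))) h
    simpa only [e] using h'
  intro u
  refine hS.eq_of_dotProduct fun h => ?_
  set l : Fin N → ℕ := fun n => m n - (h n : ℕ) with hl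
  have hlm : ∀ n, l n ≤ m n := fun n => Nat.sub_le _ _
  set P : Op m := (List.ofFn fun n => F n (l n)).prod with hP
  suffices hs : (fun u => S ⬝ᵥ (P *ᵥ (transfer K η m ξ u *ᵥ v))) = fun u => t u * S ⬝ᵥ (P *ᵥ v) by
    rw [sovCovector_eq_smul, smul_dotProduct, smul_dotProduct, ← Matrix.dotProduct_mulVec,
      ← Matrix.dotProduct_mulVec, Matrix.mulVec_smul, dotProduct_smul, smul_eq_mul (t u)]
    exact congrArg _ (congrFun hs u)
  have h1 : HasLeading N (K.trace * S ⬝ᵥ (P *ᵥ v))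
      fun u => S ⬝ᵥ (P *ᵥ (transfer K η m ξ u *ᵥ v)) := by
    let g : Op m →ₗ[ℂ] ℂ :=
      { toFun := fun A => S ⬝ᵥ (P *ᵥ (A *ᵥ v))
        map_add' := fun A B => by simp [Matrix.add_mulVec, Matrix.mulVec_add]
        map_smul' := fun c A => by simp [Matrix.smul_mulVec, Matrix.mulVec_smul] }
    have := (hasLeading_transfer K η m ξ).map g
    rw [map_smul, smul_eq_mul] at this
    simpa [g] using this
  have h2 : HasLeading N (K.trace * S ⬝ᵥ (P *ᵥ v)) fun u => t u * S ⬝ᵥ (P *ᵥ v) :=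
    ht.map (LinearMap.mulRight ℂ (S ⬝ᵥ (P *ᵥ v)))
  -- At $\xi_n^{(h_n)}$ the transfer matrix moves the level $l_n=2s_n-h_n$ of the site $n$ to its
  -- neighbours and leaves the other sites alone.
  refine h1.eq_of_eq h2 (z := fun n => node η m ξ n (h n)) (fun a b hab => ?_) fun n => ?_
  · by_contra hne
    exact hdist a b hne _ (Nat.lt_succ_iff.1 (h a).2) _ (Nat.lt_succ_iff.1 (h b).2) hab
  have hnode : node η m ξ n (h n) = node η m ξ n (m n) + l n * η := by
    rw [← node_eq_add η m ξ n (hlm n)]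
    congr 1
    simp only [hl]
    omega
  obtain ⟨A, B, hAB, hB⟩ := exists_prod_ofFn_update (fun n => F n (l n)) n
  have hup : ∀ k, (fun j => F j (Function.update l n k j)) =
      Function.update (fun j => F j (l j)) n (F n k) := by
    intro k
    funext j
    by_cases hj : j = n
    · subst hj; simp
    · simp [hj]
  have hprod : ∀ k, ∏ j, f j (Function.update l n k j) =
      f n k * ∏ j ∈ Finset.univ.erase n, f j (l j) := by
    intro k
    rw [← Finset.mul_prod_erase _ _ (Finset.mem_univ n), Function.update_self]
    congr 1
    exact Finset.prod_congr rfl fun j hj => by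
      rw [Function.update_of_ne (Finset.ne_of_mem_erase hj)]
  -- The prescribed wavefunction extends by one level beyond the basis: at $k=2s_n+1$ the operator
  -- vanishes by closure, the function by hypothesis.
  have key : ∀ k ≤ m n + 1, S ⬝ᵥ ((A * F n k * B) *ᵥ v) =
      f n k * ∏ j ∈ Finset.univ.erase n, f j (l j) := by
    intro k hk
    rcases hk.lt_or_eq with hk | rfl
    · have := hv' (Function.update l n k) fun j => by
        by_cases hj : j = n
        · subst hj; simpa using Nat.lt_succ_iff.1 hk
        · simpa [hj] using hlm j
      rw [hup, hAB, hprod] at this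
      exact this
    · simp [hF, hf, fusedTransfer_eq_zero, ht0]
  have hPA : P = A * F n (l n) * B := by
    rw [← hAB, Function.update_eq_self]
  have hPT : P * transfer K η m ξ (node η m ξ n (h n)) = A * F n (l n + 1) * B +
      qdet K η m ξ (node η m ξ n (m n) + l n * η) • (A * F n (l n - 1) * B) := by
    rw [hPA, mul_assoc, ← (hB (transfer K η m ξ (node η m ξ n (h n)))
      fun j => commute_fusedTransfer K η m ξ _ _ _).eq, ← mul_assoc, mul_assoc A, hnode,
      fusedTransfer_mul_transfer, mul_add, add_mul, mul_smul_comm, smul_mul_assoc]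
  rw [Matrix.mulVec_mulVec, hPT, Matrix.add_mulVec, Matrix.smul_mulVec, dotProduct_add,
    dotProduct_smul, key _ (by have := hlm n; omega), key _ (by have := hlm n; omega), hPA,
    key _ (by have := hlm n; omega), hnode, ← mul_assoc, mul_comm (t _), fusedValue_mul,
    smul_eq_mul]
  ring

end Basis

/-! ### Generic points -/

section Generic

variable {ι : Type*}

theorem ForAlmostAll.mono {p q : (ι → ℂ) → Prop} (hp : ForAlmostAll p) (h : ∀ x, p x → q x) :
    ForAlmostAll q := by
  obtain ⟨P, hP, hx⟩ := hp
  exact ⟨P, hP, fun x hxP => h x (hx x hxP)⟩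

theorem ForAlmostAll.and {p q : (ι → ℂ) → Prop} (hp : ForAlmostAll p) (hq : ForAlmostAll q) :
    ForAlmostAll fun x => p x ∧ q x := by
  obtain ⟨P, hP, hx⟩ := hp
  obtain ⟨Q, hQ, hy⟩ := hq
  refine ⟨P * Q, mul_ne_zero hP hQ, fun x h => ?_⟩
  rw [map_mul] at h
  exact ⟨hx x (left_ne_zero_of_mul h), hy x (right_ne_zero_of_mul h)⟩

theorem forAlmostAll_of_forall {p : (ι → ℂ) → Prop} (h : ∀ x, p x) : ForAlmostAll p :=
  ⟨1, one_ne_zero, fun x _ => h x⟩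

theorem forAlmostAll_forall_finset {κ : Type*} {p : κ → (ι → ℂ) → Prop} (s : Finset κ)
    (h : ∀ k ∈ s, ForAlmostAll (p k)) : ForAlmostAll fun x => ∀ k ∈ s, p k x := by
  classical
  induction s using Finset.induction_on with
  | empty => exact forAlmostAll_of_forall fun x => by simp
  | insert a s ha ih =>
    refine ((h a (by simp)).and (ih fun k hk => h k (by simp [hk]))).mono fun x hx => ?_
    simpa using hx

/-- Polynomial functions on `ℂ^ι` with values in a vector space. -/
def IsPolyFn {E : Type*} [AddCommGroup E] [Module ℂ E] (f : (ι → ℂ) → E) : Prop :=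
  f ∈ Submodule.span ℂ {g : (ι → ℂ) → E |
    ∃ (p : MvPolynomial ι ℂ) (r : E), g = fun x => MvPolynomial.eval x p • r}

section

variable {E F : Type*} [AddCommGroup E] [Module ℂ E] [AddCommGroup F] [Module ℂ F]

theorem isPolyFn_const (r : E) : IsPolyFn fun _ : ι → ℂ => r :=
  Submodule.subset_span ⟨1, r, by simp⟩

theorem IsPolyFn.add {f g : (ι → ℂ) → E} (hf : IsPolyFn f) (hg : IsPolyFn g) :
    IsPolyFn fun x => f x + g x := Submodule.add_mem _ hf hg

theorem IsPolyFn.sub {f g : (ι → ℂ) → E} (hf : IsPolyFn f) (hg : IsPolyFn g) :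
    IsPolyFn fun x => f x - g x := Submodule.sub_mem _ hf hg

theorem IsPolyFn.const_smul {f : (ι → ℂ) → E} (hf : IsPolyFn f) (c : ℂ) :
    IsPolyFn fun x => c • f x := Submodule.smul_mem _ c hf

theorem isPolyFn_sum {κ : Type*} {s : Finset κ} {f : κ → (ι → ℂ) → E}
    (h : ∀ k ∈ s, IsPolyFn (f k)) : IsPolyFn fun x => ∑ k ∈ s, f k x := by
  classical
  induction s using Finset.induction_on with
  | empty => simpa using isPolyFn_const (0 : E)
  | insert a s ha ih =>
    simp only [Finset.sum_insert ha]
    exact (h a (by simp)).add (ih fun k hk => h k (by simp [hk]))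

theorem IsPolyFn.map {f : (ι → ℂ) → E} (hf : IsPolyFn f) (T : E →ₗ[ℂ] F) :
    IsPolyFn fun x => T (f x) := by
  induction hf using Submodule.span_induction with
  | mem g hg =>
    obtain ⟨p, r, rfl⟩ := hg
    exact Submodule.subset_span ⟨p, T r, by simp⟩
  | zero => simpa using isPolyFn_const (0 : F)
  | add f g _ _ h1 h2 => simpa using h1.add h2
  | smul c f _ h1 => simpa using h1.const_smul c

theorem isPolyFn_iff {f : (ι → ℂ) → ℂ} :
    IsPolyFn f ↔ ∃ p : MvPolynomial ι ℂ, ∀ x, f x = MvPolynomial.eval x p := by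
  refine ⟨fun hf => ?_, fun ⟨p, hp⟩ => Submodule.subset_span ⟨p, 1, by funext x; simp [hp]⟩⟩
  induction hf using Submodule.span_induction with
  | mem g hg =>
    obtain ⟨p, r, rfl⟩ := hg
    exact ⟨p * MvPolynomial.C r, fun x => by simp⟩
  | zero => exact ⟨0, fun x => by simp⟩
  | add f g _ _ h1 h2 =>
    obtain ⟨p, hp⟩ := h1
    obtain ⟨q, hq⟩ := h2
    exact ⟨p + q, fun x => by simp [hp, hq]⟩
  | smul c f _ h1 =>
    obtain ⟨p, hp⟩ := h1
    exact ⟨MvPolynomial.C c * p, fun x => by simp [hp]⟩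

theorem IsPolyFn.smul {f : (ι → ℂ) → ℂ} {g : (ι → ℂ) → E} (hf : IsPolyFn f) (hg : IsPolyFn g) :
    IsPolyFn fun x => f x • g x := by
  obtain ⟨p, hp⟩ := isPolyFn_iff.1 hf
  induction hg using Submodule.span_induction with
  | mem g hg =>
    obtain ⟨q, r, rfl⟩ := hg
    exact Submodule.subset_span ⟨p * q, r, by funext x; simp [hp, smul_smul]⟩
  | zero => simpa using isPolyFn_const (0 : E)
  | add g g' _ _ h1 h2 => simpa using h1.add h2
  | smul c g _ h1 =>
    change IsPolyFn fun x => f x • c • g x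
    simp_rw [smul_comm (f _) c]
    exact h1.const_smul c

end

theorem isPolyFn_apply (i : ι) : IsPolyFn fun x : ι → ℂ => x i :=
  isPolyFn_iff.2 ⟨MvPolynomial.X i, fun x => by simp⟩

variable {R : Type*} [Ring R] [Algebra ℂ R]

theorem IsPolyFn.mul {f g : (ι → ℂ) → R} (hf : IsPolyFn f) (hg : IsPolyFn g) :
    IsPolyFn fun x => f x * g x := by
  induction hf using Submodule.span_induction with
  | mem f hf =>
    obtain ⟨p, r, rfl⟩ := hf
    have := (isPolyFn_iff.2 ⟨p, fun x => rfl⟩ : IsPolyFn fun x => MvPolynomial.eval x p).smul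
      (hg.map (LinearMap.mulLeft ℂ r))
    simpa using this
  | zero => simpa using isPolyFn_const (0 : R)
  | add f f' _ _ h1 h2 => simpa [add_mul] using h1.add h2
  | smul c f _ h1 => simpa using h1.const_smul c

theorem isPolyFn_list_prod {κ : Type*} {f : κ → (ι → ℂ) → R} (l : List κ)
    (h : ∀ k, IsPolyFn (f k)) : IsPolyFn fun x => (l.map fun k => f k x).prod := by
  induction l with
  | nil => exact isPolyFn_const 1
  | cons k l ih => simpa using (h k).mul ih

theorem isPolyFn_prod {κ : Type*} {s : Finset κ} {f : κ → (ι → ℂ) → ℂ}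
    (h : ∀ k, IsPolyFn (f k)) : IsPolyFn fun x => ∏ k ∈ s, f k x := by
  simpa using isPolyFn_list_prod s.toList h

theorem isPolyFn_fusionSeq {τ : (ι → ℂ) → ℕ → R} {q : (ι → ℂ) → ℕ → ℂ}
    (hτ : ∀ l, IsPolyFn fun x => τ x l) (hq : ∀ l, IsPolyFn fun x => q x l) (l : ℕ) :
    IsPolyFn fun x => fusionSeq (τ x) (q x) l := by
  induction l using Nat.strong_induction_on with
  | _ l ih =>
  match l, ih with
  | 0, _ => exact isPolyFn_const 1
  | 1, _ => exact hτ 0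
  | l + 2, ih =>
    exact ((hτ _).mul (ih (l + 1) (by omega))).sub ((hq _).smul (ih l (by omega)))

theorem isPolyFn_eval {κ : Type*} {f : (ι → ℂ) → κ → ℂ} (hf : ∀ k, IsPolyFn fun x => f x k)
    (P : MvPolynomial κ ℂ) : IsPolyFn fun x => MvPolynomial.eval (f x) P := by
  induction P using MvPolynomial.induction_on with
  | C a => simpa using isPolyFn_const a
  | add p q hp hq => simpa using hp.add hq
  | mul_X p k hp => simpa using hp.mul (hf k)

/-- Reduces every genericity claim below to the exhibition of one point. -/
theorem forAlmostAll_ne_zero {f : (ι → ℂ) → ℂ} (hf : IsPolyFn f) {x₀ : ι → ℂ} (h : f x₀ ≠ 0) :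
    ForAlmostAll fun x => f x ≠ 0 := by
  obtain ⟨p, hp⟩ := isPolyFn_iff.1 hf
  refine ⟨p, ?_, fun x hx => by change f x ≠ 0; rwa [hp]⟩
  rintro rfl
  exact h (by simp [hp])

theorem isPolyFn_det {n : Type*} [Fintype n] [DecidableEq n] {A : (ι → ℂ) → Matrix n n ℂ}
    (hA : ∀ i j, IsPolyFn fun x => A x i j) : IsPolyFn fun x => (A x).det := by
  simp only [Matrix.det_apply]
  refine isPolyFn_sum fun σ _ => ?_
  have := (isPolyFn_prod (s := Finset.univ) fun i => hA (σ i) i)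
  simpa [Units.smul_def, zsmul_eq_mul] using
    (isPolyFn_const ((Equiv.Perm.sign σ : ℤ) : ℂ)).mul this

end Generic

/-! ### Simple spectrum as the nonvanishing of a polynomial in the matrix entries -/

section Discriminant

variable {n : Type*} [Fintype n]

/-- The matrix has a basis of eigenvectors with pairwise different eigenvalues. -/
def HasSimpleEigenbasis (A : Matrix n n ℂ) : Prop :=
  ∃ (v : n → n → ℂ) (μ : n → ℂ), LinearIndependent ℂ v ∧ Function.Injective μ ∧
    ∀ i, A *ᵥ v i = μ i • v i

theorem HasSimpleEigenbasis.smul {A : Matrix n n ℂ} (h : HasSimpleEigenbasis A) {c : ℂ}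
    (hc : c ≠ 0) : HasSimpleEigenbasis (c • A) := by
  obtain ⟨v, μ, hv, hμ, hA⟩ := h
  refine ⟨v, fun i => c * μ i, hv, fun i j hij => hμ (mul_left_cancel₀ hc hij), fun i => ?_⟩
  rw [Matrix.smul_mulVec, hA, smul_smul]

variable [DecidableEq n]

theorem aeval_mulVec {A : Matrix n n ℂ} {v : n → ℂ} {μ : ℂ} (h : A *ᵥ v = μ • v) (p : ℂ[X]) :
    aeval A p *ᵥ v = p.eval μ • v := by
  induction p using Polynomial.induction_on' with
  | add p q hp hq => rw [map_add, Matrix.add_mulVec, hp, hq, eval_add, add_smul]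
  | monomial k a =>
    have hk : A ^ k *ᵥ v = μ ^ k • v := by
      induction k with
      | zero => simp
      | succ k ih =>
        rw [pow_succ', ← Matrix.mulVec_mulVec, ih, Matrix.mulVec_smul, h, smul_smul, pow_succ]
    rw [aeval_monomial, ← Algebra.smul_def, Matrix.smul_mulVec, hk, eval_monomial, smul_smul]

theorem exists_mulVec_eq_smul {A : Matrix n n ℂ} {μ : ℂ} (h : A.charpoly.eval μ = 0) :
    ∃ v ≠ 0, A *ᵥ v = μ • v := by
  rw [Matrix.eval_charpoly] at h
  obtain ⟨v, hv, hAv⟩ := Matrix.exists_mulVec_eq_zero_iff.2 h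
  refine ⟨v, hv, ?_⟩
  rw [Matrix.sub_mulVec, sub_eq_zero] at hAv
  rw [← hAv]
  simp [Matrix.scalar_apply, ← Matrix.smul_one_eq_diagonal, Matrix.smul_mulVec]

theorem eval_charpoly_of_mulVec {A : Matrix n n ℂ} {v : n → ℂ} {μ : ℂ} (hv : v ≠ 0)
    (h : A *ᵥ v = μ • v) : A.charpoly.eval μ = 0 := by
  have h1 := aeval_mulVec h A.charpoly
  rw [Matrix.aeval_self_charpoly, Matrix.zero_mulVec] at h1
  exact (smul_eq_zero.1 h1.symm).resolve_right hv

theorem linearIndependent_of_mulVec {κ : Type*} {A : Matrix n n ℂ} {v : κ → n → ℂ} {μ : κ → ℂ}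
    (hμ : Function.Injective μ) (hv : ∀ i, v i ≠ 0) (h : ∀ i, A *ᵥ v i = μ i • v i) :
    LinearIndependent ℂ v :=
  Module.End.eigenvectors_linearIndependent' (Matrix.toLin' A) μ hμ v fun i =>
    ⟨Module.End.mem_eigenspace_iff.2 (by simpa using h i), hv i⟩

/-- The matrix $\chi_A'(A)$ acts on an eigenvector of eigenvalue $\mu$ by $\chi_A'(\mu)$, which
vanishes exactly when $\mu$ is a multiple root of $\chi_A$. -/
theorem hasSimpleEigenbasis_iff (A : Matrix n n ℂ) :
    HasSimpleEigenbasis A ↔ (aeval A (derivative A.charpoly)).det ≠ 0 := by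
  constructor
  · rintro ⟨v, μ, hv, hμ, hA⟩ h0
    obtain ⟨w, hw, hAw⟩ := Matrix.exists_mulVec_eq_zero_iff.2 h0
    have hspan := hv.span_eq_top_of_card_eq_finrank' (by simp)
    obtain ⟨c, rfl⟩ := (Submodule.mem_span_range_iff_exists_fun ℂ).1
      (hspan ▸ Submodule.mem_top : w ∈ Submodule.span ℂ (Set.range v))
    have h1 : ∑ i, (c i * (derivative A.charpoly).eval (μ i)) • v i = 0 := by
      rw [← hAw, Matrix.mulVec_sum]
      exact Finset.sum_congr rfl fun i _ => by
        rw [Matrix.mulVec_smul, aeval_mulVec (hA i), smul_smul]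
    have h2 := Fintype.linearIndependent_iff.1 hv _ h1
    have hprod : A.charpoly = ∏ i, (X - C (μ i)) := by
      refine Polynomial.eq_of_monic_of_dvd_of_natDegree_le (monic_prod_X_sub_C μ Finset.univ)
        A.charpoly_monic ?_ ?_
      · refine Finset.prod_dvd_of_coprime (fun i _ j _ hij => ?_) fun i _ => ?_
        · exact isCoprime_X_sub_C_of_isUnit_sub (sub_ne_zero.2 (hμ.ne hij)).isUnit
        · exact dvd_iff_isRoot.2 (eval_charpoly_of_mulVec (hv.ne_zero i) (hA i))
      · rw [Matrix.charpoly_natDegree_eq_dim, natDegree_prod_of_monic _ _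
          fun i _ => monic_X_sub_C _]
        simp
    have hsep : A.charpoly.Separable := by
      rw [hprod]
      exact separable_prod_X_sub_C_iff.2 hμ
    refine hw (Finset.sum_eq_zero fun i _ => ?_)
    have h3 := (mul_eq_zero.1 (h2 i)).resolve_right fun h4 => by
      obtain ⟨a, b, hab⟩ := hsep
      have := congrArg (eval (μ i)) hab
      simp [h4, eval_charpoly_of_mulVec (hv.ne_zero i) (hA i)] at this
    rw [h3, zero_smul]
  · intro h
    have hne : A.charpoly ≠ 0 := A.charpoly_monic.ne_zero
    have hnd : A.charpoly.roots.Nodup := by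
      rw [Multiset.nodup_iff_count_le_one]
      intro μ
      by_contra! hlt
      rw [count_roots, one_lt_rootMultiplicity_iff_isRoot hne] at hlt
      obtain ⟨v, hv, hAv⟩ := exists_mulVec_eq_smul hlt.1
      refine h (Matrix.exists_mulVec_eq_zero_iff.1 ⟨v, hv, ?_⟩)
      rw [aeval_mulVec hAv, hlt.2, zero_smul]
    have hcard : A.charpoly.roots.toFinset.card = Fintype.card n := by
      rw [Multiset.toFinset_card_of_nodup hnd, ← A.charpoly_natDegree_eq_dim]
      exact (splits_iff_card_roots.1 (IsAlgClosed.splits _))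
    let e : n ≃ A.charpoly.roots.toFinset := Fintype.equivOfCardEq (by simp [hcard])
    have hroot : ∀ i, A.charpoly.eval (e i : ℂ) = 0 := fun i => by
      have := (e i).2
      rw [Multiset.mem_toFinset, mem_roots hne] at this
      exact this
    choose v hv hAv using fun i => exists_mulVec_eq_smul (hroot i)
    have hinj : Function.Injective fun i => (e i : ℂ) := Subtype.val_injective.comp e.injective
    exact ⟨v, fun i => e i, linearIndependent_of_mulVec hinj hv hAv, hinj, hAv⟩

/-- The expression is formed for the matrix of indeterminates; specialization commutes with
characteristic polynomial, derivative, evaluation and determinant. -/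
theorem exists_discriminant (n : Type*) [Fintype n] [DecidableEq n] :
    ∃ P : MvPolynomial (n × n) ℂ, ∀ A : Matrix n n ℂ,
      MvPolynomial.eval (fun i => A i.1 i.2) P = (aeval A (derivative A.charpoly)).det := by
  refine ⟨(aeval (Matrix.mvPolynomialX n n ℂ)
    (derivative (Matrix.mvPolynomialX n n ℂ).charpoly)).det, fun A => ?_⟩
  set f := MvPolynomial.eval (fun i : n × n => A i.1 i.2)
  have hA : f.mapMatrix (Matrix.mvPolynomialX n n ℂ) = A := by
    ext i j
    simp [f]
  have hf : (algebraMap ℂ (Matrix n n ℂ)).comp f =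
      f.mapMatrix.comp (algebraMap (MvPolynomial (n × n) ℂ) _) := by
    refine RingHom.ext fun x => Matrix.ext fun i j => ?_
    by_cases h : i = j <;> simp [Matrix.algebraMap_matrix_apply, h]
  rw [RingHom.map_det, map_aeval_eq_aeval_map hf, hA, ← derivative_map, ← Matrix.charpoly_map,
    ← RingHom.mapMatrix_apply, hA]

end Discriminant

/-! ### Well separated inhomogeneities -/

section Scaling

theorem list_prod_map_eq_of_forall_ne {M κ : Type*} [Monoid M] {f : κ → M} {l : List κ}
    (hl : l.Nodup) {n : κ} (hn : n ∈ l) (h : ∀ j, j ≠ n → f j = 1) : (l.map f).prod = f n := by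
  induction l with
  | nil => simp at hn
  | cons k l ih =>
    rw [List.nodup_cons] at hl
    rw [List.map_cons, List.prod_cons]
    by_cases hk : k = n
    · subst hk
      rw [List.prod_eq_one, mul_one]
      intro x hx
      obtain ⟨j, hj, rfl⟩ := List.mem_map.1 hx
      exact h j fun e => hl.1 (e ▸ hj)
    · rw [h k hk, one_mul, ih hl.2 ((List.mem_cons.1 hn).resolve_left (Ne.symm hk))]

theorem list_prod_map_smul {R κ : Type*} [Ring R] [Algebra ℂ R] (a : κ → ℂ) (W : κ → R)
    (l : List κ) : (l.map fun j => a j • W j).prod = (l.map a).prod • (l.map W).prod := by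
  induction l with
  | nil => simp
  | cons k l ih =>
    simp only [List.map_cons, List.prod_cons]
    rw [ih, smul_mul_smul_comm]

variable {N : ℕ} (K : Matrix (Fin 2) (Fin 2) ℂ) (η : ℂ) (m : Fin N → ℕ)

/-- Inhomogeneities at distances of order `e⁻¹`. -/
noncomputable def farPoint (e : ℂ) (j : Fin N) : ℂ := (j : ℕ) * e⁻¹

/-- The Lax operators near the inhomogeneity of the site `n`, rescaled by `e` on the other sites. -/
noncomputable def scaledLax (n : Fin N) (c e : ℂ) (j : Fin N) : Matrix (Fin 2) (Fin 2) (Op m) :=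
  if j = n then c • 1 + lax η m n 0
  else (((n : ℕ) : ℂ) - (j : ℕ) + e * c) • 1 + e • lax η m j 0

/-- The rescaled transfer matrix near the inhomogeneity of the site `n`. -/
noncomputable def scaledTransfer (n : Fin N) (c e : ℂ) : Op m :=
  (K.map (algebraMap ℂ (Op m)) *
    ((List.ofFn fun k : Fin N => k.rev).map (scaledLax η m n c e)).prod).trace

/-- The rescaled quantum determinant near the inhomogeneity of the site `n`. -/
noncomputable def scaledQdet (n : Fin N) (c e : ℂ) : ℂ :=
  K.det * ∏ j, ((if j = n then c + (η / 2 + (m j : ℂ) / 2 * η)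
    else ((n : ℕ) : ℂ) - (j : ℕ) + e * (c + (η / 2 + (m j : ℂ) / 2 * η))) *
    (if j = n then c - (η / 2 + (m j : ℂ) / 2 * η)
    else ((n : ℕ) : ℂ) - (j : ℕ) + e * (c - (η / 2 + (m j : ℂ) / 2 * η))))

theorem prod_ite_one_eq_pow (n : Fin N) (x : ℂ) : ∏ j, (if j = n then 1 else x) = x ^ (N - 1) := by
  rw [← Finset.mul_prod_erase _ _ (Finset.mem_univ n), if_pos rfl, one_mul,
    Finset.prod_congr rfl fun j hj => if_neg (Finset.ne_of_mem_erase hj), Finset.prod_const,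
    Finset.card_erase_of_mem (Finset.mem_univ n), Finset.card_univ, Fintype.card_fin]

/-- Each of the $N-1$ other sites is at distance of order $e^{-1}$, and its Lax operator gives up
one factor $e^{-1}$. The rescaled expression makes sense at $e=0$. -/
theorem transfer_farPoint (n : Fin N) (c : ℂ) {e : ℂ} (he : e ≠ 0) :
    transfer K η m (farPoint e) (farPoint e n + c) =
      (e⁻¹) ^ (N - 1) • scaledTransfer K η m n c e := by
  have h : ∀ j, lax η m j (farPoint e n + c - farPoint e j) =
      (if j = n then (1 : ℂ) else e⁻¹) • scaledLax η m n c e j := by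
    intro j
    rw [lax_eq, scaledLax]
    split_ifs with hj
    · subst hj
      rw [one_smul, add_sub_cancel_left]
    · rw [smul_add, smul_smul, smul_smul, inv_mul_cancel₀ he, one_smul, farPoint, farPoint]
      congr 2
      field_simp
      ring
  rw [transfer, monodromy_eq]
  simp only [h]
  rw [list_prod_map_smul, prod_map_ofFn_rev, prod_ite_one_eq_pow, Matrix.mul_smul,
    Matrix.trace_smul]
  rfl

theorem qdet_farPoint (n : Fin N) (c : ℂ) {e : ℂ} (he : e ≠ 0) :
    qdet K η m (farPoint e) (farPoint e n + c) =
      ((e⁻¹) ^ (N - 1)) ^ 2 * scaledQdet K η m n c e := by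
  rw [qdet_eq_prod, scaledQdet, ← prod_ite_one_eq_pow n, ← Finset.prod_pow, mul_left_comm,
    ← Finset.prod_mul_distrib]
  congr 1
  refine Finset.prod_congr rfl fun j _ => ?_
  split_ifs with hj
  · subst hj
    ring
  · rw [farPoint, farPoint]
    field_simp
    ring

/-- The fused transfer matrices at the last node of the site `n`, rescaled. -/
noncomputable def scaledFused (n : Fin N) (l : ℕ) (e : ℂ) : Op m :=
  fusionSeq
    (fun l => scaledTransfer K η m n (-η / 2 + ((m n : ℂ) / 2 - (m n : ℂ)) * η + l * η) e)
    (fun l => scaledQdet K η m n (-η / 2 + ((m n : ℂ) / 2 - (m n : ℂ)) * η + l * η) e) l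

theorem fusedTransfer_farPoint (n : Fin N) (l : ℕ) {e : ℂ} (he : e ≠ 0) :
    fusedTransfer K η m (farPoint e) l (node η m (farPoint e) n (m n)) =
      ((e⁻¹) ^ (N - 1)) ^ l • scaledFused K η m n l e := by
  have h : ∀ l : ℕ, node η m (farPoint e) n (m n) + l * η =
      farPoint e n + (-η / 2 + ((m n : ℂ) / 2 - (m n : ℂ)) * η + l * η) := fun l => by
    rw [node]; ring
  rw [fusedTransfer_eq_fusionSeq, scaledFused, ← fusionSeq_smul]
  simp only [h, transfer_farPoint K η m n _ he, qdet_farPoint K η m n _ he]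

theorem continuous_scaledTransfer (n : Fin N) (c : ℂ) :
    Continuous (scaledTransfer K η m n c) := by
  refine Continuous.matrix_trace ?_
  refine continuous_const.matrix_mul ?_
  refine continuous_list_prod _ fun j _ => ?_
  unfold scaledLax
  split_ifs <;> fun_prop

theorem continuous_scaledQdet (n : Fin N) (c : ℂ) : Continuous (scaledQdet K η m n c) := by
  unfold scaledQdet
  refine continuous_const.mul (continuous_finsetProd _ fun j _ => ?_)
  split_ifs <;> fun_prop

theorem continuous_scaledFused (n : Fin N) (l : ℕ) : Continuous (scaledFused K η m n l) :=
  continuous_fusionSeq (fun _ => continuous_scaledTransfer K η m n _)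
    (fun _ => continuous_scaledQdet K η m n _) l

/-- The element of `sl₂` that corresponds to the twist, in the spin representation. -/
noncomputable def spinOp (m : ℕ) : Matrix (Fin (m + 1)) (Fin (m + 1)) ℂ :=
  (K 0 0 - K 1 1) • spinZ m + K 0 1 • spinPlus m + K 1 0 • spinMinus m

/-- The scalar by which the other sites contribute to the limit of the rescaled transfer matrix. -/
noncomputable def siteScale (n : Fin N) : ℂ :=
  ∏ j : Fin N, if j = n then 1 else ((n : ℕ) : ℂ) - (j : ℕ)

theorem siteScale_ne_zero (n : Fin N) : siteScale n ≠ 0 := by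
  refine Finset.prod_ne_zero_iff.2 fun j _ => ?_
  split_ifs with h
  · exact one_ne_zero
  · rw [sub_ne_zero]
    exact fun e => h (Fin.ext (by exact_mod_cast e.symm))

/-- In the limit the other Lax operators are scalars, so only the trace of $K$ times the local Lax
operator remains, which is affine in `spinOp`. -/
theorem scaledTransfer_zero (n : Fin N) (c : ℂ) : scaledTransfer K η m n c 0 =
    siteHom m n (siteScale n • (((c + η / 2) * K.trace) • 1 + η • spinOp K (m n))) := by
  have h : ∀ j, scaledLax η m n c 0 j = (if j = n then (1 : ℂ) else ((n : ℕ) : ℂ) - (j : ℕ)) •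
      if j = n then lax η m n c else 1 := by
    intro j
    rw [scaledLax]
    split_ifs with hj
    · rw [one_smul, ← lax_eq]
    · simp
  have h2 : scaledLax η m n c 0 = fun j =>
      (if j = n then (1 : ℂ) else ((n : ℕ) : ℂ) - (j : ℕ)) • if j = n then lax η m n c else 1 :=
    funext h
  rw [scaledTransfer, h2, list_prod_map_smul, prod_map_ofFn_rev, Matrix.mul_smul,
    Matrix.trace_smul, map_smul, list_prod_map_eq_of_forall_ne nodup_ofFn_rev
      (List.mem_ofFn.2 ⟨n.rev, Fin.rev_rev n⟩) fun j hj => if_neg hj, if_pos rfl, siteScale]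
  congr 1
  rw [lax_eq_map, Matrix.trace_fin_two, Matrix.mul_apply, Matrix.mul_apply, Fin.sum_univ_two,
    Fin.sum_univ_two]
  simp only [Matrix.map_apply, ← Algebra.smul_def, ← map_smul, ← map_add]
  congr 1
  rw [Matrix.trace_fin_two, spinOp]
  simp [localLax]
  module

/-- The quantum determinant term has degree two less than the product and cannot affect the leading
term. -/
theorem degree_fusionSeq {b : ℂ} (hb : b ≠ 0) (α q : ℕ → ℂ) (l : ℕ) :
    (fusionSeq (fun l => C b * X + C (α l)) q l : ℂ[X]).degree = l := by
  induction l using Nat.strong_induction_on with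
  | _ l ih =>
  match l, ih with
  | 0, _ => exact degree_one
  | 1, _ => exact degree_linear hb
  | l + 2, ih =>
    have h1 := ih (l + 1) (by omega)
    have h2 := ih l (by omega)
    rw [fusionSeq]
    have h3 : ((C b * X + C (α (l + 1))) *
        fusionSeq (fun l => C b * X + C (α l)) q (l + 1) : ℂ[X]).degree = (l + 2 : ℕ) := by
      rw [degree_mul, degree_linear hb, h1]
      norm_cast
      omega
    rw [degree_sub_eq_left_of_degree_lt, h3]
    rw [h3]
    refine (degree_smul_le _ _).trans_lt ?_
    rw [h2]
    exact_mod_cast (by omega : l < l + 2)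

/-- The polynomials in the local operator that the rescaled fused transfer matrices tend to. -/
noncomputable def limitPoly (n : Fin N) (l : ℕ) : ℂ[X] :=
  fusionSeq (fun l => C (siteScale n * η) * X + C (siteScale n *
      ((-η / 2 + ((m n : ℂ) / 2 - (m n : ℂ)) * η + l * η + η / 2) * K.trace)))
    (fun l => scaledQdet K η m n (-η / 2 + ((m n : ℂ) / 2 - (m n : ℂ)) * η + l * η) 0) l

theorem degree_limitPoly {η : ℂ} (hη : η ≠ 0) (n : Fin N) (l : ℕ) :
    (limitPoly K η m n l).degree = l :=
  degree_fusionSeq (mul_ne_zero (siteScale_ne_zero n) hη) _ _ l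

theorem scaledFused_zero (n : Fin N) (l : ℕ) : scaledFused K η m n l 0 =
    siteHom m n (aeval (spinOp K (m n)) (limitPoly K η m n l)) := by
  rw [limitPoly, map_fusionSeq, map_fusionSeq, scaledFused]
  congr 1
  funext l
  rw [scaledTransfer_zero, map_add, map_mul, aeval_C, aeval_X, aeval_C, ← Algebra.smul_def,
    Algebra.algebraMap_eq_smul_one, smul_add, smul_smul, smul_smul]
  exact congrArg _ (add_comm _ _)

end Scaling

/-! ### Cyclic covectors -/

section Cyclic

/-- Each factor moves the support of the first basis covector at most one place to the right, and
the new extreme entry is multiplied by a nonzero superdiagonal entry. This makes the covector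
cyclic. -/
theorem pow_apply_zero_of_hessenberg {m : ℕ} {A : Matrix (Fin (m + 1)) (Fin (m + 1)) ℂ}
    (h0 : ∀ i j : Fin (m + 1), (i : ℕ) + 1 < j → A i j = 0)
    (h1 : ∀ i j : Fin (m + 1), (j : ℕ) = i + 1 → A i j ≠ 0) (d : ℕ) :
    (∀ j : Fin (m + 1), d < j → (A ^ d) 0 j = 0) ∧
      ∀ j : Fin (m + 1), (j : ℕ) = d → (A ^ d) 0 j ≠ 0 := by
  induction d with
  | zero =>
    refine ⟨fun j hj => ?_, fun j hj => ?_⟩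
    · rw [pow_zero, Matrix.one_apply_ne]
      exact fun e => hj.ne (by rw [← e]; rfl)
    · rw [show j = 0 from Fin.ext hj, pow_zero, Matrix.one_apply_eq]
      exact one_ne_zero
  | succ d ih =>
    refine ⟨fun j hj => ?_, fun j hj => ?_⟩
    · rw [pow_succ, Matrix.mul_apply]
      refine Finset.sum_eq_zero fun i _ => ?_
      rcases lt_or_ge d (i : ℕ) with hi | hi
      · rw [ih.1 i hi, zero_mul]
      · rw [h0 i j (by omega), mul_zero]
    · rw [pow_succ, Matrix.mul_apply, Finset.sum_eq_single (⟨d, by omega⟩ : Fin (m + 1))]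
      · exact mul_ne_zero (ih.2 _ rfl) (h1 _ _ hj)
      · intro i _ hi
        have hi' : (i : ℕ) ≠ d := fun e => hi (Fin.ext e)
        rcases lt_or_gt_of_ne hi' with hi | hi
        · rw [h0 i j (by omega), mul_zero]
        · rw [ih.1 i hi, zero_mul]
      · simp

theorem exists_aeval_apply_zero_ne_zero {m : ℕ} {A : Matrix (Fin (m + 1)) (Fin (m + 1)) ℂ}
    (h0 : ∀ i j : Fin (m + 1), (i : ℕ) + 1 < j → A i j = 0)
    (h1 : ∀ i j : Fin (m + 1), (j : ℕ) = i + 1 → A i j ≠ 0) {Q : ℂ[X]} (hQ : Q ≠ 0)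
    (hd : Q.natDegree ≤ m) : ∃ j, aeval A Q 0 j ≠ 0 := by
  refine ⟨⟨Q.natDegree, by omega⟩, ?_⟩
  rw [aeval_eq_sum_range, Matrix.sum_apply, Finset.sum_range_succ, Finset.sum_eq_zero, zero_add]
  · exact mul_ne_zero (leadingCoeff_ne_zero.2 hQ)
      ((pow_apply_zero_of_hessenberg h0 h1 _).2 _ rfl)
  · intro k hk
    rw [Matrix.smul_apply, (pow_apply_zero_of_hessenberg h0 h1 k).1 _ (Finset.mem_range.1 hk),
      smul_zero]

theorem spinPlus_apply_ne_zero {m : ℕ} {i j : Fin (m + 1)} (h : (j : ℕ) = i + 1) :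
    spinPlus m i j ≠ 0 := by
  rw [spinPlus, Matrix.of_apply, if_pos h]
  refine Complex.ofReal_ne_zero.2 (Real.sqrt_pos.2 (mul_pos ?_ ?_)).ne'
  · positivity
  have : ((j : ℕ) : ℝ) < m + 1 := by exact_mod_cast j.2
  rw [h] at this
  push_cast at this ⊢
  linarith

/-- If $K$ is diagonal, its two entries differ, the local operator is diagonal with simple spectrum,
and the covector of ones is cyclic. Otherwise one off-diagonal entry makes the tridiagonal operator
Hessenberg with nonzero superdiagonal, possibly after the basis is reversed. -/
theorem exists_cyclic_covector {K : Matrix (Fin 2) (Fin 2) ℂ} (hK : ∀ α : ℂ, K ≠ α • 1) (m : ℕ) :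
    ∃ S : Fin (m + 1) → ℂ, ∀ Q : ℂ[X], Q.natDegree ≤ m → S ᵥ* aeval (spinOp K m) Q = 0 →
      Q = 0 := by
  by_cases h01 : K 0 1 = 0
  · by_cases h10 : K 1 0 = 0
    · have hd : K 0 0 - K 1 1 ≠ 0 := by
        refine fun h => hK (K 0 0) ?_
        ext i j
        fin_cases i <;> fin_cases j <;> simp [h01, h10, ← sub_eq_zero.1 h]
      refine ⟨fun _ => 1, fun Q hQ h => ?_⟩
      refine Polynomial.eq_zero_of_natDegree_lt_card_of_eval_eq_zero Q
        (f := fun i : Fin (m + 1) => (K 0 0 - K 1 1) * ((m : ℂ) / 2 - (i : ℕ))) ?_ ?_ (by simpa)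
      · intro i j hij
        have := mul_left_cancel₀ hd hij
        exact Fin.ext (by simpa using this)
      · intro i
        have hi : spinOp K m *ᵥ Pi.single i 1 =
            ((K 0 0 - K 1 1) * ((m : ℂ) / 2 - (i : ℕ))) • Pi.single i 1 := by
          rw [spinOp, h01, h10, zero_smul, zero_smul, add_zero, add_zero, Matrix.smul_mulVec,
            spinZ, Matrix.diagonal_mulVec_single, ← smul_smul, mul_one]
          congr 1
          ext k
          simp [Pi.single_apply]
        have h2 := congrArg (· ⬝ᵥ (Pi.single i 1 : Fin (m + 1) → ℂ)) h
        simp only [← Matrix.dotProduct_mulVec, aeval_mulVec hi, zero_dotProduct] at h2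
        simpa using h2
    · refine ⟨Pi.single (Fin.last m) 1, fun Q hQ h => ?_⟩
      by_contra hQ0
      -- The reversal turns the subdiagonal into the superdiagonal and the last basis covector into
      -- the first.
      let r := Matrix.reindexAlgEquiv ℂ ℂ (Fin.revPerm (n := m + 1))
      have h0 : ∀ i j : Fin (m + 1), (i : ℕ) + 1 < j → r (spinOp K m) i j = 0 := by
        intro i j hij
        have h1 : i.rev ≠ j.rev := fun e => by rw [Fin.rev_inj.1 e] at hij; omega
        have h3 : (i.rev : ℕ) ≠ j.rev + 1 := by simp; omega
        simp [r, spinOp, h01, spinZ, spinMinus, spinPlus, h1, h3, -Fin.val_rev]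
      have h1 : ∀ i j : Fin (m + 1), (j : ℕ) = i + 1 → r (spinOp K m) i j ≠ 0 := by
        intro i j hij
        have h3 : (i.rev : ℕ) = j.rev + 1 := by simp; omega
        have h1 : i.rev ≠ j.rev := fun e => by rw [e] at h3; omega
        simp [r, spinOp, h01, spinZ, spinMinus, spinPlus_apply_ne_zero h3, h1, h10]
      obtain ⟨j, hj⟩ := exists_aeval_apply_zero_ne_zero h0 h1 hQ0 hQ
      rw [aeval_algHom_apply] at hj
      refine hj ?_
      have := congrFun h j.rev
      simpa [r] using this
  · refine ⟨Pi.single 0 1, fun Q hQ h => ?_⟩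
    by_contra hQ0
    have h0 : ∀ i j : Fin (m + 1), (i : ℕ) + 1 < j → spinOp K m i j = 0 := by
      intro i j hij
      have h1 : i ≠ j := fun e => by rw [e] at hij; omega
      have h2 : (j : ℕ) ≠ i + 1 := by omega
      have h3 : (i : ℕ) ≠ j + 1 := by omega
      simp [spinOp, spinZ, spinMinus, spinPlus, h1, h2, h3]
    have h1 : ∀ i j : Fin (m + 1), (j : ℕ) = i + 1 → spinOp K m i j ≠ 0 := by
      intro i j hij
      have h1 : i ≠ j := fun e => by rw [e] at hij; omega
      have h3 : (i : ℕ) ≠ j + 1 := by omega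
      have h4 : spinPlus m j i = 0 := by simp [spinPlus, h3]
      simp [spinOp, spinZ, spinMinus, spinPlus_apply_ne_zero hij, h1, h4, h01]
    obtain ⟨j, hj⟩ := exists_aeval_apply_zero_ne_zero h0 h1 hQ0 hQ
    refine hj ?_
    have := congrFun h j
    simpa using this

end Cyclic

/-! ### The separation of variables basis -/

section Tensor

variable {N : ℕ} (m : Fin N → ℕ)

theorem prod_ofFn_siteHom (Y : (n : Fin N) → Matrix (Fin (m n + 1)) (Fin (m n + 1)) ℂ) :
    (List.ofFn fun n => siteHom m n (Y n)).prod = tensor m Y := by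
  let T : ((n : Fin N) → Matrix (Fin (m n + 1)) (Fin (m n + 1)) ℂ) →* Op m :=
    { toFun := tensor m, map_one' := tensor_one m, map_mul' := tensor_mul m }
  have h : (fun n => siteHom m n (Y n)) = T ∘ fun n => Pi.mulSingle n (Y n) :=
    funext fun n => site_eq_tensor m n (Y n)
  rw [h, ← List.map_ofFn, ← map_list_prod]
  refine congrArg (tensor m) (funext fun n => ?_)
  change Pi.evalMonoidHom _ n (List.prod _) = _
  rw [List.ofFn_eq_map, map_list_prod, List.map_map,
    list_prod_map_eq_of_forall_ne (List.nodup_finRange N) (List.mem_finRange n)]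
  · simp
  · intro j hj
    simp [Pi.mulSingle_eq_of_ne hj.symm]

/-- The tensor product of vectors on the factors. -/
def tensorVec (x : (n : Fin N) → Fin (m n + 1) → ℂ) : Conf m → ℂ := fun h => ∏ n, x n (h n)

theorem tensorVec_vecMul (x : (n : Fin N) → Fin (m n + 1) → ℂ)
    (A : (n : Fin N) → Matrix (Fin (m n + 1)) (Fin (m n + 1)) ℂ) :
    tensorVec m x ᵥ* tensor m A = tensorVec m fun n => x n ᵥ* A n := by
  ext h'
  simp only [tensorVec, tensor, Matrix.vecMul, dotProduct, Matrix.of_apply,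
    ← Finset.prod_mul_distrib]
  rw [Finset.prod_univ_sum, Fintype.piFinset_univ]

theorem mulVec_tensorVec (x : (n : Fin N) → Fin (m n + 1) → ℂ)
    (A : (n : Fin N) → Matrix (Fin (m n + 1)) (Fin (m n + 1)) ℂ) :
    tensor m A *ᵥ tensorVec m x = tensorVec m fun n => A n *ᵥ x n := by
  ext h'
  simp only [tensorVec, tensor, Matrix.mulVec, dotProduct, Matrix.of_apply,
    ← Finset.prod_mul_distrib]
  rw [Finset.prod_univ_sum, Fintype.piFinset_univ]

theorem det_tensor_ne_zero {B : (n : Fin N) → Matrix (Fin (m n + 1)) (Fin (m n + 1)) ℂ}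
    (h : ∀ n, IsUnit (B n)) : (tensor m B).det ≠ 0 := by
  have h1 : tensor m B * tensor m (fun n => (B n)⁻¹) = 1 := by
    rw [← tensor_mul, ← tensor_one]
    refine congrArg _ (funext fun n => ?_)
    exact Matrix.mul_nonsing_inv _ ((Matrix.isUnit_iff_isUnit_det _).1 (h n))
  exact (Matrix.isUnit_det_of_right_inverse h1).ne_zero

end Tensor

/-! ### Genericity of the basis property -/

section Basis

theorem exists_ne_zero_of_continuous {f : ℂ → ℂ} (hf : Continuous f) (h : f 0 ≠ 0) :
    ∃ e ≠ 0, f e ≠ 0 := by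
  have h1 : ∀ᶠ e in nhdsWithin (0 : ℂ) {0}ᶜ, f e ≠ 0 :=
    (hf.continuousAt.eventually_ne h).filter_mono nhdsWithin_le_nhds
  obtain ⟨e, he, hfe⟩ := (h1.and self_mem_nhdsWithin).exists
  exact ⟨e, hfe, he⟩

variable {N : ℕ} (K : Matrix (Fin 2) (Fin 2) ℂ) (η : ℂ) (m : Fin N → ℕ)

theorem isPolyFn_transfer {u : (Fin N → ℂ) → ℂ} (hu : IsPolyFn u) :
    IsPolyFn fun ξ => transfer K η m ξ (u ξ) := by
  have h : ∀ n, IsPolyFn fun ξ : Fin N → ℂ => lax η m n (u ξ - ξ n) := fun n => by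
    simp_rw [lax_eq m η n (_ - _)]
    exact ((hu.sub (isPolyFn_apply n)).smul (isPolyFn_const _)).add (isPolyFn_const _)
  have := ((isPolyFn_const (K.map (algebraMap ℂ (Op m)))).mul (isPolyFn_list_prod
    (List.ofFn fun k : Fin N => k.rev) h)).map (Matrix.traceLinearMap (Fin 2) ℂ (Op m))
  simp only [transfer, monodromy_eq]
  exact this

theorem isPolyFn_qdet {u : (Fin N → ℂ) → ℂ} (hu : IsPolyFn u) :
    IsPolyFn fun ξ => qdet K η m ξ (u ξ) := by
  simp_rw [qdet_eq_prod]
  refine (isPolyFn_const _).mul (isPolyFn_prod fun n => ?_)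
  have h := hu.sub (isPolyFn_apply n)
  exact ((h.add (isPolyFn_const _)).add (isPolyFn_const _)).mul
    ((h.sub (isPolyFn_const _)).sub (isPolyFn_const _))

theorem isPolyFn_fusedTransfer (l : ℕ) {u : (Fin N → ℂ) → ℂ} (hu : IsPolyFn u) :
    IsPolyFn fun ξ => fusedTransfer K η m ξ l (u ξ) := by
  simp_rw [fusedTransfer_eq_fusionSeq]
  exact isPolyFn_fusionSeq (fun l => isPolyFn_transfer K η m (hu.add (isPolyFn_const _)))
    (fun l => isPolyFn_qdet K η m (hu.add (isPolyFn_const _))) l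

theorem isPolyFn_node (n : Fin N) (k : ℕ) : IsPolyFn fun ξ => node η m ξ n k :=
  ((isPolyFn_apply n).sub (isPolyFn_const _)).add (isPolyFn_const _)

/-- The products of fused transfer matrices that generate the separation of variables basis. -/
noncomputable def sovOp (ξ : Fin N → ℂ) (h : Conf m) : Op m :=
  (List.ofFn fun n => fusedTransfer K η m ξ (m n - (h n : ℕ)) (node η m ξ n (m n))).prod

/-- The rescaled products of fused transfer matrices. -/
noncomputable def scaledSovOp (e : ℂ) (h : Conf m) : Op m :=
  (List.ofFn fun n => scaledFused K η m n (m n - (h n : ℕ)) e).prod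

theorem isPolyFn_sovOp (h : Conf m) : IsPolyFn fun ξ => sovOp K η m ξ h := by
  simp only [sovOp, List.ofFn_eq_map]
  exact isPolyFn_list_prod (List.finRange N) fun n =>
    isPolyFn_fusedTransfer K η m _ (isPolyFn_node η m n _)

theorem continuous_scaledSovOp (h : Conf m) : Continuous fun e => scaledSovOp K η m e h := by
  simp only [scaledSovOp, List.ofFn_eq_map]
  exact continuous_list_prod _ fun n _ => continuous_scaledFused K η m n _

theorem sovOp_farPoint (h : Conf m) {e : ℂ} (he : e ≠ 0) : sovOp K η m (farPoint e) h =
    (∏ n, ((e⁻¹) ^ (N - 1)) ^ (m n - (h n : ℕ))) • scaledSovOp K η m e h := by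
  rw [sovOp, scaledSovOp, ← prod_ofFn_smul]
  simp_rw [fusedTransfer_farPoint K η m _ _ he]

variable {K η}

/-- Polynomials of degrees $0,\dots,k$ are linearly independent, and cyclicity carries this over to
their actions on the covector. -/
theorem isUnit_of_cyclic {k : ℕ} {s : Fin (k + 1) → ℂ}
    {A : Matrix (Fin (k + 1)) (Fin (k + 1)) ℂ}
    (hs : ∀ Q : ℂ[X], Q.natDegree ≤ k → s ᵥ* aeval A Q = 0 → Q = 0) {p : ℕ → ℂ[X]}
    (hp : ∀ i, (p i).degree = i) :
    IsUnit (Matrix.of fun i : Fin (k + 1) => s ᵥ* aeval A (p (k - (i : ℕ)))) := by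
  have hli := (Polynomial.Sequence.linearIndependent ⟨p, hp⟩).comp
    (fun i : Fin (k + 1) => k - (i : ℕ)) fun i j hij => Fin.ext (by dsimp at hij; omega)
  rw [← Matrix.linearIndependent_rows_iff_isUnit, Fintype.linearIndependent_iff]
  intro g hg
  refine Fintype.linearIndependent_iff.1 hli g (hs _ ?_ ?_)
  · refine natDegree_sum_le_of_forall_le _ _ fun i _ => (natDegree_smul_le _ _).trans ?_
    exact (natDegree_eq_of_degree_eq_some (hp _)).le.trans (Nat.sub_le _ _)
  · rw [map_sum, Matrix.vecMul_sum, ← hg]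
    refine Finset.sum_congr rfl fun i _ => ?_
    rw [map_smul, Matrix.vecMul_smul]
    rfl

/-- For a product covector the matrix of the rescaled family at $e=0$ is a tensor product of
invertible one-site matrices. Continuity moves the nonvanishing to some $e\ne0$, that is, to an
actual point $\xi$. -/
theorem exists_det_sovOp_ne_zero (hη : η ≠ 0) (hK : ∀ α : ℂ, K ≠ α • 1) :
    ∃ S : Conf m → ℂ, ForAlmostAll fun ξ =>
      (Matrix.of fun h => S ᵥ* sovOp K η m ξ h).det ≠ 0 := by
  choose s hs using fun n => exists_cyclic_covector hK (m n)
  refine ⟨tensorVec m s, ?_⟩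
  have h0 : (Matrix.of fun h => tensorVec m s ᵥ* scaledSovOp K η m 0 h).det ≠ 0 := by
    have h1 : (Matrix.of fun h => tensorVec m s ᵥ* scaledSovOp K η m 0 h) = tensor m fun n =>
        Matrix.of fun i : Fin (m n + 1) =>
          s n ᵥ* aeval (spinOp K (m n)) (limitPoly K η m n (m n - (i : ℕ))) := by
      ext h h'
      simp only [Matrix.of_apply, scaledSovOp, scaledFused_zero, prod_ofFn_siteHom,
        tensorVec_vecMul]
      rfl
    rw [h1]
    exact det_tensor_ne_zero m fun n => isUnit_of_cyclic (hs n) (degree_limitPoly K m hη n)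
  obtain ⟨e, he, h⟩ := exists_ne_zero_of_continuous (f := fun e =>
    (Matrix.of fun h => tensorVec m s ᵥ* scaledSovOp K η m e h).det)
    (Continuous.matrix_det (continuous_pi fun h =>
      continuous_const.matrix_vecMul (continuous_scaledSovOp K η m h))) h0
  refine forAlmostAll_ne_zero (isPolyFn_det fun h h' => ?_) (x₀ := farPoint e) ?_
  · let T : Op m →ₗ[ℂ] ℂ :=
      { toFun := fun M => (tensorVec m s ᵥ* M) h'
        map_add' := fun A B => by rw [Matrix.vecMul_add]; rfl
        map_smul' := fun c A => by rw [Matrix.vecMul_smul]; rfl }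
    exact (isPolyFn_sovOp K η m h).map T
  · simp only [sovOp_farPoint K η m _ he, Matrix.vecMul_smul]
    -- Undoing the rescaling multiplies each row by a nonzero power of $e^{-1}$.
    have := Matrix.det_mul_column (fun h : Conf m => ∏ n, ((e⁻¹) ^ (N - 1)) ^ (m n - (h n : ℕ)))
      (Matrix.of fun h => tensorVec m s ᵥ* scaledSovOp K η m e h)
    refine fun h2 => mul_ne_zero (Finset.prod_ne_zero_iff.2 fun h _ => ?_) h (this.symm.trans h2)
    exact Finset.prod_ne_zero_iff.2 fun n _ => pow_ne_zero _ (pow_ne_zero _ (inv_ne_zero he))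

variable {m} {ξ : Fin N → ℂ}

theorem isBasisFamily_sovCovector
    (hdist : ∀ a b : Fin N, a ≠ b → ∀ h ≤ m a, ∀ k ≤ m b, node η m ξ a h ≠ node η m ξ b k)
    (hη : η ≠ 0) {k₂ : ℂ} (hk₂ : k₂ ≠ 0) {S : Conf m → ℂ}
    (hS : (Matrix.of fun h => S ᵥ* sovOp K η m ξ h).det ≠ 0) :
    IsBasisFamily (sovCovector K k₂ η m ξ S) := by
  rw [isBasisFamily_iff]
  have h1 : Matrix.of (sovCovector K k₂ η m ξ S) = Matrix.of fun h h' =>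
      (∏ n, (sovDenominator k₂ η m ξ n (h n))⁻¹) *
        (Matrix.of fun h => S ᵥ* sovOp K η m ξ h) h h' := by
    ext h h'
    rw [Matrix.of_apply, sovCovector_eq_smul]
    rfl
  rw [h1, Matrix.det_mul_column]
  refine mul_ne_zero (Finset.prod_ne_zero_iff.2 fun h _ => Finset.prod_ne_zero_iff.2
    fun n _ => inv_ne_zero ?_) hS
  exact sovDenominator_ne_zero η m ξ hdist hη hk₂ n (by omega)

theorem forAlmostAll_isBasisFamily {k₂ : ℂ} {S : Conf m → ℂ}
    (hS : IsBasisFamily (sovCovector K k₂ η m ξ S)) :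
    ForAlmostAll fun S : Conf m → ℂ => IsBasisFamily (sovCovector K k₂ η m ξ S) := by
  simp only [isBasisFamily_iff] at hS ⊢
  refine forAlmostAll_ne_zero (isPolyFn_det fun h h' => ?_) hS
  simp only [Matrix.of_apply, sovCovector, Matrix.vecMul, dotProduct]
  exact isPolyFn_sum fun i _ => (isPolyFn_apply i).mul (isPolyFn_const _)

end Basis

/-! ### Distinctness of the nodes -/

section Nodes

variable {N : ℕ} (η : ℂ) (m : Fin N → ℕ)

theorem forAlmostAll_node_ne : ForAlmostAll fun ξ : Fin N → ℂ =>
    ∀ a b : Fin N, a ≠ b → ∀ h ≤ m a, ∀ k ≤ m b, node η m ξ a h ≠ node η m ξ b k := by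
  have h1 : ∀ a b : Fin N, a ≠ b → ∀ h k : ℕ,
      ForAlmostAll fun ξ : Fin N → ℂ => node η m ξ a h ≠ node η m ξ b k := by
    intro a b hab h k
    refine (forAlmostAll_ne_zero ((isPolyFn_node η m a h).sub (isPolyFn_node η m b k))
      -- The inhomogeneity of $a$ is shifted so that the two nodes differ by exactly 1.
      (x₀ := Pi.single a (1 + node η m 0 b k - node η m 0 a h)) ?_).mono fun ξ => sub_ne_zero.1
    simp [node, hab.symm]
    ring_nf
    exact one_ne_zero
  have h2 := forAlmostAll_forall_finset (Finset.univ (α := Fin N)) (fun a _ =>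
    forAlmostAll_forall_finset (Finset.univ.erase a) fun b hb =>
    forAlmostAll_forall_finset (Finset.range (m a + 1)) fun h _ =>
    forAlmostAll_forall_finset (Finset.range (m b + 1)) fun k _ =>
      h1 a b (Finset.ne_of_mem_erase hb).symm h k)
  refine h2.mono fun ξ hξ a b hab h hh k hk => ?_
  exact hξ a (by simp) b (by simp [hab.symm]) h (by simp; omega) k (by simp; omega)

end Nodes

/-! ### Diagonalizability -/

section LocalEigenvectors

theorem spinOp_mulVec_toVec (K : Matrix (Fin 2) (Fin 2) ℂ) {m : ℕ} {f : ℂ[X]}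
    (hf : f.natDegree ≤ m) : spinOp K m *ᵥ toVec m f =
      toVec m ((C (K 0 1) - C (K 0 0 - K 1 1) * X - C (K 1 0) * X ^ 2) * derivative f +
        C (m : ℂ) * (C ((K 0 0 - K 1 1) / 2) + C (K 1 0) * X) * f) := by
  rw [spinOp, Matrix.add_mulVec, Matrix.add_mulVec, Matrix.smul_mulVec, Matrix.smul_mulVec,
    Matrix.smul_mulVec, spinZ_mulVec_toVec, spinPlus_mulVec_toVec hf, spinMinus_mulVec_toVec,
    ← (toVec m).map_smul, ← (toVec m).map_smul, ← (toVec m).map_smul, ← (toVec m).map_add,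
    ← (toVec m).map_add]
  congr 1
  simp only [smul_eq_C_mul, div_eq_mul_inv, C_mul, C_sub]
  ring

/-- On polynomials `spinOp` is the first-order operator $q\,\partial+m\,p$, with $q,p$ independent
of $m$. By the Leibniz rule, eigenvectors multiply and eigenvalues add, so products of powers of the
linear forms given by eigenvectors of $K$ serve in every spin. -/
theorem exists_spinOp_mulVec_eq {K : Matrix (Fin 2) (Fin 2) ℂ} {k₁ k₂ : ℂ}
    (hk : K.charpoly = (X - C k₁) * (X - C k₂)) {m i : ℕ} (hi : i ≤ m) :
    ∃ x ≠ 0, spinOp K m *ᵥ x = ((k₁ - k₂) * ((m : ℂ) / 2 - i)) • x := by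
  have htr : K 0 0 + K 1 1 = k₁ + k₂ := by
    have := congrArg (coeff · 1) hk
    simp [Matrix.charpoly_fin_two, sub_mul, mul_sub, coeff_X, coeff_C, Matrix.trace_fin_two] at this
    linear_combination -this
  set q : ℂ[X] := C (K 0 1) - C (K 0 0 - K 1 1) * X - C (K 1 0) * X ^ 2 with hq
  set p : ℂ[X] := C ((K 0 0 - K 1 1) / 2) + C (K 1 0) * X with hp
  have hlin : ∀ {k k' : ℂ}, K 0 0 + K 1 1 = k + k' → K.charpoly.eval k = 0 →
      ∃ f : ℂ[X], f ≠ 0 ∧ f.natDegree ≤ 1 ∧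
        q * derivative f + p * f = C ((k - k') / 2) * f := by
    intro k k' hkk h
    obtain ⟨v, hv, hKv⟩ := exists_mulVec_eq_smul h
    have h0 : K 0 0 * v 0 + K 0 1 * v 1 = k * v 0 := by
      simpa [Matrix.mulVec, dotProduct] using congrFun hKv 0
    have h1 : K 1 0 * v 0 + K 1 1 * v 1 = k * v 1 := by
      simpa [Matrix.mulVec, dotProduct] using congrFun hKv 1
    refine ⟨C (v 1) * X + C (v 0), fun hf => hv ?_, natDegree_linear_le, ?_⟩
    · have e0 := congrArg (coeff · 0) hf
      have e1 := congrArg (coeff · 1) hf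
      simp at e0 e1
      ext j
      fin_cases j <;> simpa
    · have c0 : (K 0 0 - K 1 1) / 2 * v 0 + K 0 1 * v 1 = (k - k') / 2 * v 0 := by
        linear_combination h0 - v 0 / 2 * hkk
      have c1 : K 1 0 * v 0 - (K 0 0 - K 1 1) / 2 * v 1 = (k - k') / 2 * v 1 := by
        linear_combination h1 - v 1 / 2 * hkk
      have e0 := congrArg (C : ℂ → ℂ[X]) c0
      have e1 := congrArg (C : ℂ → ℂ[X]) c1
      have e2 : C (K 0 0 - K 1 1) = 2 * (C ((K 0 0 - K 1 1) / 2) : ℂ[X]) := by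
        rw [show (2 : ℂ[X]) = C 2 from rfl, ← C_mul, mul_div_cancel₀ _ two_ne_zero]
      simp only [C_add, C_mul, C_sub] at e0 e1 ⊢
      rw [hq, hp, e2]
      simp only [derivative_add, derivative_mul, derivative_C, derivative_X]
      linear_combination e0 + X * e1
  have hmul : ∀ {f g : ℂ[X]} {a b : ℕ} {α β : ℂ},
      q * derivative f + C (a : ℂ) * p * f = C α * f →
      q * derivative g + C (b : ℂ) * p * g = C β * g →
      q * derivative (f * g) + C ((a + b : ℕ) : ℂ) * p * (f * g) = C (α + β) * (f * g) := by
    intro f g a b α β h1 h2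
    rw [derivative_mul]
    push_cast
    rw [C_add, C_add]
    linear_combination g * h1 + f * h2
  have hpow : ∀ {f : ℂ[X]} {α : ℂ}, q * derivative f + p * f = C α * f → ∀ a : ℕ,
      q * derivative (f ^ a) + C (a : ℂ) * p * f ^ a = C (a * α) * f ^ a := by
    intro f α h a
    induction a with
    | zero => simp
    | succ a ih =>
      have := hmul ih (b := 1) (by simpa using h)
      rw [pow_succ, this]
      push_cast
      congr 2
      ring
  obtain ⟨f, hf, hf1, hqf⟩ := hlin htr (by simp [hk])
  obtain ⟨g, hg, hg1, hqg⟩ := hlin (htr.trans (add_comm _ _)) (by simp [hk])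
  have hd : (f ^ (m - i) * g ^ i).natDegree ≤ m := by
    refine natDegree_mul_le.trans ?_
    have h1 := natDegree_pow_le_of_le (m - i) hf1
    have h2 := natDegree_pow_le_of_le i hg1
    omega
  refine ⟨toVec m (f ^ (m - i) * g ^ i), fun h => ?_, ?_⟩
  · exact mul_ne_zero (pow_ne_zero _ hf) (pow_ne_zero _ hg) (toVec_injective hd h)
  · have h3 := hmul (hpow hqf (m - i)) (hpow hqg i)
    rw [Nat.sub_add_cancel hi] at h3
    rw [spinOp_mulVec_toVec K hd, ← hq, ← hp, h3, ← smul_eq_C_mul, map_smul]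
    congr 1
    push_cast [Nat.cast_sub hi]
    ring

end LocalEigenvectors

/-! ### Product eigenvectors and mixed radix weights -/

section TensorEigenvectors

variable {N : ℕ} {m : Fin N → ℕ}

theorem siteHom_mulVec_tensorVec {n : Fin N} {Y : Matrix (Fin (m n + 1)) (Fin (m n + 1)) ℂ}
    {x : (n : Fin N) → Fin (m n + 1) → ℂ} {μ : ℂ} (h : Y *ᵥ x n = μ • x n) :
    siteHom m n Y *ᵥ tensorVec m x = μ • tensorVec m x := by
  rw [siteHom_apply, site_eq_tensor, mulVec_tensorVec]
  ext k
  simp only [tensorVec, Pi.smul_apply, smul_eq_mul]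
  rw [← Finset.mul_prod_erase _ _ (Finset.mem_univ n),
    ← Finset.mul_prod_erase Finset.univ (fun j => x j (k j)) (Finset.mem_univ n), ← mul_assoc]
  congr 1
  · rw [Pi.mulSingle_eq_same, h]
    rfl
  · refine Finset.prod_congr rfl fun j hj => ?_
    rw [Pi.mulSingle_eq_of_ne (Finset.ne_of_mem_erase hj), Matrix.one_mulVec]

theorem tensorVec_ne_zero {x : (n : Fin N) → Fin (m n + 1) → ℂ} (h : ∀ n, x n ≠ 0) :
    tensorVec m x ≠ 0 := by
  choose i hi using fun n => Function.ne_iff.1 (h n)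
  exact Function.ne_iff.2 ⟨i, Finset.prod_ne_zero_iff.2 fun n _ => hi n⟩

/-- The place values of the mixed radix representation with the digits `h n ≤ m n`. -/
def placeValue (m : Fin N → ℕ) (n : Fin N) : ℕ := ∏ j : Fin n, (m (Fin.castLE n.is_lt.le j) + 1)

theorem sum_placeValue_injective :
    Function.Injective fun h : Conf m => ∑ n, (h n : ℕ) * placeValue m n := by
  intro h h' e
  refine (finPiFinEquiv (n := fun n => m n + 1)).injective (Fin.ext ?_)
  rw [finPiFinEquiv_apply, finPiFinEquiv_apply]
  exact e

end TensorEigenvectors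

/-! ### A combination of transfer matrices with simple spectrum -/

section Combination

variable {N : ℕ} (K : Matrix (Fin 2) (Fin 2) ℂ) (η : ℂ) (m : Fin N → ℕ)

/-- A combination of transfer matrices with simple spectrum. -/
noncomputable def transferCombination (ξ : Fin N → ℂ) : Op m :=
  ∑ n, ((placeValue m n : ℂ) / siteScale n) • transfer K η m ξ (ξ n)

/-- The rescaled combination of transfer matrices. -/
noncomputable def scaledCombination (e : ℂ) : Op m :=
  ∑ n, ((placeValue m n : ℂ) / siteScale n) • scaledTransfer K η m n 0 e

theorem transferCombination_farPoint {e : ℂ} (he : e ≠ 0) :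
    transferCombination K η m (farPoint e) = (e⁻¹) ^ (N - 1) • scaledCombination K η m e := by
  rw [transferCombination, scaledCombination, Finset.smul_sum]
  refine Finset.sum_congr rfl fun n _ => ?_
  have := transfer_farPoint K η m n 0 he
  rw [add_zero] at this
  rw [this, smul_comm]

variable {K η}

/-- The limit is a sum of commuting one-site operators, weighted by place values. Its eigenvalues
are an affine function of the integers with digits $h_n$, hence distinct. -/
theorem hasSimpleEigenbasis_scaledCombination_zero {k₁ k₂ : ℂ}
    (hk : K.charpoly = (X - C k₁) * (X - C k₂)) (hk₁₂ : k₁ ≠ k₂) (hη : η ≠ 0) :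
    HasSimpleEigenbasis (scaledCombination K η m 0) := by
  choose x hx hKx using fun (n : Fin N) (i : Fin (m n + 1)) =>
    exists_spinOp_mulVec_eq hk (Nat.lt_succ_iff.1 i.2)
  have hμ : Function.Injective fun h : Conf m => ∑ n, (placeValue m n : ℂ) *
      (η / 2 * K.trace + η * ((k₁ - k₂) * ((m n : ℂ) / 2 - (h n : ℕ)))) := by
    intro h h' e
    refine sum_placeValue_injective ?_
    have h1 : ∀ h : Conf m, ∑ n, (placeValue m n : ℂ) *
        (η / 2 * K.trace + η * ((k₁ - k₂) * ((m n : ℂ) / 2 - (h n : ℕ)))) =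
        ∑ n, (placeValue m n : ℂ) * (η / 2 * K.trace + η * ((k₁ - k₂) * ((m n : ℂ) / 2))) -
          (η * (k₁ - k₂)) * ((∑ n, (h n : ℕ) * placeValue m n : ℕ) : ℂ) := by
      intro h
      push_cast
      rw [Finset.mul_sum, ← Finset.sum_sub_distrib]
      exact Finset.sum_congr rfl fun n _ => by ring
    simp only [h1] at e
    exact_mod_cast mul_left_cancel₀ (mul_ne_zero hη (sub_ne_zero.2 hk₁₂)) (sub_right_injective e)
  have hA : ∀ h : Conf m, scaledCombination K η m 0 *ᵥ tensorVec m (fun n => x n (h n)) =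
      (∑ n, (placeValue m n : ℂ) *
        (η / 2 * K.trace + η * ((k₁ - k₂) * ((m n : ℂ) / 2 - (h n : ℕ))))) •
        tensorVec m (fun n => x n (h n)) := by
    intro h
    rw [scaledCombination, Matrix.sum_mulVec, Finset.sum_smul]
    refine Finset.sum_congr rfl fun n _ => ?_
    rw [Matrix.smul_mulVec, scaledTransfer_zero, siteHom_mulVec_tensorVec
      (μ := siteScale n * (η / 2 * K.trace + η * ((k₁ - k₂) * ((m n : ℂ) / 2 - (h n : ℕ)))))]
    · rw [smul_smul, ← mul_assoc, div_mul_cancel₀ _ (siteScale_ne_zero n)]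
    · rw [Matrix.smul_mulVec, Matrix.add_mulVec, Matrix.smul_mulVec, Matrix.smul_mulVec,
        Matrix.one_mulVec, hKx, zero_add, smul_smul, ← add_smul, smul_smul]
  exact ⟨_, _, linearIndependent_of_mulVec hμ
    (fun h => tensorVec_ne_zero fun n => hx n (h n)) hA, hμ, hA⟩

theorem continuous_scaledCombination : Continuous (scaledCombination K η m) := by
  unfold scaledCombination
  refine continuous_finsetSum _ fun n _ => ?_
  have := continuous_scaledTransfer K η m n 0
  fun_prop

theorem isPolyFn_transferCombination : IsPolyFn fun ξ => transferCombination K η m ξ :=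
  isPolyFn_sum fun n _ => (isPolyFn_transfer K η m (isPolyFn_apply n)).const_smul _

theorem exists_hasSimpleEigenbasis {n : Type*} [Fintype n] {B : ℂ → Matrix n n ℂ}
    (hB : Continuous B) (h : HasSimpleEigenbasis (B 0)) : ∃ e ≠ 0, HasSimpleEigenbasis (B e) := by
  classical
  obtain ⟨P, hP⟩ := exists_discriminant n
  rw [hasSimpleEigenbasis_iff, ← hP] at h
  obtain ⟨e, he, h⟩ := exists_ne_zero_of_continuous (f := fun e =>
    MvPolynomial.eval (fun i : n × n => B e i.1 i.2) P)
    ((MvPolynomial.continuous_eval P).comp (continuous_pi fun i => hB.matrix_elem i.1 i.2)) h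
  refine ⟨e, he, ?_⟩
  rwa [hasSimpleEigenbasis_iff, ← hP]

theorem IsPolyFn.forAlmostAll_hasSimpleEigenbasis {ι n : Type*} [Fintype n]
    {A : (ι → ℂ) → Matrix n n ℂ} (hA : IsPolyFn A) {x₀ : ι → ℂ}
    (h : HasSimpleEigenbasis (A x₀)) : ForAlmostAll fun x => HasSimpleEigenbasis (A x) := by
  classical
  obtain ⟨P, hP⟩ := exists_discriminant n
  simp only [hasSimpleEigenbasis_iff, ← hP] at h ⊢
  exact forAlmostAll_ne_zero (isPolyFn_eval (f := fun x (i : n × n) => A x i.1 i.2)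
    (fun i => hA.map (Matrix.entryLinearMap ℂ ℂ i.1 i.2)) P) h

theorem forAlmostAll_hasSimpleEigenbasis_transferCombination {k₁ k₂ : ℂ}
    (hk : K.charpoly = (X - C k₁) * (X - C k₂)) (hk₁₂ : k₁ ≠ k₂) (hη : η ≠ 0) :
    ForAlmostAll fun ξ : Fin N → ℂ => HasSimpleEigenbasis (transferCombination K η m ξ) := by
  obtain ⟨e, he, h⟩ := exists_hasSimpleEigenbasis (continuous_scaledCombination m)
    (hasSimpleEigenbasis_scaledCombination_zero m hk hk₁₂ hη)
  refine (isPolyFn_transferCombination m).forAlmostAll_hasSimpleEigenbasis (x₀ := farPoint e) ?_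
  rw [transferCombination_farPoint K η m he]
  exact h.smul (pow_ne_zero _ (inv_ne_zero he))

/-- Used to see that any operator commuting with $A$ preserves the lines spanned by the
eigenvectors. -/
theorem eq_smul_of_mulVec_eq {ι : Type*} [Fintype ι] {A : Matrix ι ι ℂ} {v : ι → ι → ℂ}
    {μ : ι → ℂ} (hv : LinearIndependent ℂ v) (hμ : Function.Injective μ)
    (hA : ∀ i, A *ᵥ v i = μ i • v i) {i : ι} {w : ι → ℂ} (hw : A *ᵥ w = μ i • w) :
    ∃ c : ℂ, w = c • v i := by
  have hspan := hv.span_eq_top_of_card_eq_finrank' (by simp)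
  obtain ⟨c, rfl⟩ := (Submodule.mem_span_range_iff_exists_fun ℂ).1
    (hspan ▸ Submodule.mem_top : w ∈ Submodule.span ℂ (Set.range v))
  have h1 : ∑ j, (c j * (μ j - μ i)) • v j = 0 := by
    rw [Matrix.mulVec_sum, Finset.smul_sum, ← sub_eq_zero, ← Finset.sum_sub_distrib] at hw
    rw [← hw]
    exact Finset.sum_congr rfl fun j _ => by
      rw [Matrix.mulVec_smul, hA, smul_smul, smul_smul, ← sub_smul]
      ring_nf
  have h2 := Fintype.linearIndependent_iff.1 hv _ h1
  refine ⟨c i, Finset.sum_eq_single i (fun j _ hj => ?_) (by simp)⟩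
  rw [(mul_eq_zero.1 (h2 j)).resolve_right (sub_ne_zero.2 (hμ.ne hj)), zero_smul]

theorem diagonalizableSimple_of_hasSimpleEigenbasis {ξ : Fin N → ℂ}
    (h : HasSimpleEigenbasis (transferCombination K η m ξ)) : DiagonalizableSimple K η m ξ := by
  obtain ⟨v, μ, hv, hμ, hA⟩ := h
  have hT : ∀ i u, ∃ c : ℂ, transfer K η m ξ u *ᵥ v i = c • v i := by
    intro i u
    have hcomm : Commute (transferCombination K η m ξ) (transfer K η m ξ u) :=
      Commute.sum_left _ _ _ fun n _ => (commute_transfer K η m ξ _ u).smul_left _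
    refine eq_smul_of_mulVec_eq hv hμ hA (i := i) ?_
    rw [Matrix.mulVec_mulVec, hcomm.eq, ← Matrix.mulVec_mulVec, hA, Matrix.mulVec_smul]
  choose t ht using hT
  refine ⟨v, t, ⟨hv, hv.span_eq_top_of_card_eq_finrank' (by simp)⟩, fun i j hij => hμ ?_, ht⟩
  -- The eigenvalue of the combination is determined by the function $t_i$, so distinct $\mu_i$
  -- force distinct $t_i$.
  have h1 : ∀ i, μ i = ∑ n, ((placeValue m n : ℂ) / siteScale n) * t i (ξ n) := by
    intro i
    refine smul_left_injective ℂ (hv.ne_zero i) ?_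
    dsimp only
    rw [← hA, transferCombination, Matrix.sum_mulVec, Finset.sum_smul]
    exact Finset.sum_congr rfl fun n _ => by rw [Matrix.smul_mulVec, ht, smul_smul]
  rw [h1, h1, hij]

end Combination

/-! ### The spectrum in a separation of variables basis -/

section Spectrum

theorem mul_eq_det_of_charpoly {K : Matrix (Fin 2) (Fin 2) ℂ} {k₁ k₂ : ℂ}
    (hk : K.charpoly = (X - C k₁) * (X - C k₂)) : k₁ * k₂ = K.det := by
  have := congrArg (eval 0) hk
  rw [Matrix.eval_charpoly] at this
  simpa [Matrix.det_neg] using this.symm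

variable {N : ℕ} {K : Matrix (Fin 2) (Fin 2) ℂ} {η : ℂ} {m : Fin N → ℕ} {ξ : Fin N → ℂ}
  {k₂ : ℂ} {S : Conf m → ℂ}

/-- All eigenvectors of $t$ have the same wavefunction up to the factor $\langle S|v\rangle$. The
form without division also covers $\langle S|v\rangle=0$. -/
theorem eq_smul_of_isBasisFamily (hS : IsBasisFamily (sovCovector K k₂ η m ξ S)) {t : ℂ → ℂ}
    {v w : Conf m → ℂ} (hv : v ∈ eigenspace K η m ξ t) (hw : w ∈ eigenspace K η m ξ t) :
    (S ⬝ᵥ v) • w = (S ⬝ᵥ w) • v := by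
  refine hS.eq_of_dotProduct fun h => ?_
  rw [dotProduct_smul, dotProduct_smul, sovCovector_dotProduct K η m ξ k₂ S hv,
    sovCovector_dotProduct K η m ξ k₂ S hw, smul_eq_mul, smul_eq_mul]
  ring

theorem dotProduct_ne_zero (hS : IsBasisFamily (sovCovector K k₂ η m ξ S)) {t : ℂ → ℂ}
    {v : Conf m → ℂ} (hv : v ∈ eigenspace K η m ξ t) (hv0 : v ≠ 0) : S ⬝ᵥ v ≠ 0 := by
  intro h0
  refine hv0 (hS.eq_of_dotProduct fun h => ?_)
  rw [sovCovector_dotProduct K η m ξ k₂ S hv, h0, mul_zero, dotProduct_zero]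

theorem finrank_eigenspace (hS : IsBasisFamily (sovCovector K k₂ η m ξ S)) {t : ℂ → ℂ}
    (ht : t ∈ spectrumT K η m ξ) : Module.finrank ℂ (eigenspace K η m ξ t) = 1 := by
  obtain ⟨v, hv, hv0⟩ := ht
  have hSv := dotProduct_ne_zero hS hv hv0
  refine finrank_eq_one (⟨v, hv⟩ : eigenspace K η m ξ t) (fun h => hv0 (congrArg Subtype.val h))
    fun w => ⟨(S ⬝ᵥ v)⁻¹ * (S ⬝ᵥ w.1), Subtype.ext ?_⟩
  change ((S ⬝ᵥ v)⁻¹ * (S ⬝ᵥ w.1)) • v = w.1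
  rw [← smul_smul, ← eq_smul_of_isBasisFamily hS hv w.2, smul_smul, inv_mul_cancel₀ hSv, one_smul]

theorem exists_normalized_eigenvector (hS : IsBasisFamily (sovCovector K k₂ η m ξ S))
    {t : ℂ → ℂ} (ht : t ∈ spectrumT K η m ξ) : ∃ v ∈ eigenspace K η m ξ t,
      S ⬝ᵥ v = 1 ∧ ∀ w ∈ eigenspace K η m ξ t, S ⬝ᵥ w = 1 → w = v := by
  obtain ⟨v, hv, hv0⟩ := ht
  have hSv := dotProduct_ne_zero hS hv hv0
  have h1 : S ⬝ᵥ ((S ⬝ᵥ v)⁻¹ • v) = 1 := by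
    rw [dotProduct_smul, smul_eq_mul, inv_mul_cancel₀ hSv]
  have h2 : (S ⬝ᵥ v)⁻¹ • v ∈ eigenspace K η m ξ t := Submodule.smul_mem _ _ hv
  refine ⟨_, h2, h1, fun w hw hSw => ?_⟩
  have := eq_smul_of_isBasisFamily hS h2 hw
  rwa [h1, hSw, one_smul, one_smul] at this

theorem interpolant_mem_spectrumT {k₁ : ℂ} (hk : k₁ * k₂ = K.det)
    (hdist : ∀ a b : Fin N, a ≠ b → ∀ h ≤ m a, ∀ k ≤ m b, node η m ξ a h ≠ node η m ξ b k)
    (hη : η ≠ 0) (hk₂ : k₂ ≠ 0) (hS : IsBasisFamily (sovCovector K k₂ η m ξ S)) {x : Fin N → ℂ}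
    (hx : ∀ n, (discreteMatrix k₁ k₂ η m ξ (interpolant K η m ξ x) n).det = 0) :
    interpolant K η m ξ x ∈ spectrumT K η m ξ := by
  obtain ⟨v, hv⟩ := hS.exists_dotProduct fun h =>
    ∏ n, fusedValue K η m ξ (interpolant K η m ξ x) (m n - (h n : ℕ)) (node η m ξ n (m n)) /
      sovDenominator k₂ η m ξ n (h n)
  refine ⟨v, mem_eigenspace_of_dotProduct K η m ξ hdist hη hk₂ hS (hasLeading_interpolant ..)
    (fun n => ?_) hv, ?_⟩
  · rw [← det_discreteMatrix K η m ξ hk, hx]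
  · rintro rfl
    -- At $h_n=2s_n$ for all $n$ the prescribed wavefunction is an empty product of fused values,
    -- equal to 1, so the vector cannot be zero.
    have := hv fun n => Fin.last (m n)
    simp [fusedValue, sovDenominator] at this

theorem spectrumT_eq {k₁ : ℂ} (hk : k₁ * k₂ = K.det)
    (hdist : ∀ a b : Fin N, a ≠ b → ∀ h ≤ m a, ∀ k ≤ m b, node η m ξ a h ≠ node η m ξ b k)
    (hη : η ≠ 0) (hk₂ : k₂ ≠ 0) (hS : IsBasisFamily (sovCovector K k₂ η m ξ S)) :
    spectrumT K η m ξ = {t | ∃ x : Fin N → ℂ, t = interpolant K η m ξ x ∧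
      ∀ n, (discreteMatrix k₁ k₂ η m ξ t n).det = 0} := by
  have hinj : Function.Injective fun n => node η m ξ n 0 := fun a b hab => by
    by_contra h
    exact hdist a b h 0 (Nat.zero_le _) 0 (Nat.zero_le _) hab
  ext t
  constructor
  · exact fun ht => ⟨_, eq_interpolant_of_mem_spectrumT K η m ξ hinj ht,
      det_discreteMatrix_eq_zero K η m ξ hk ht⟩
  · rintro ⟨x, rfl, hx⟩
    exact interpolant_mem_spectrumT hk hdist hη hk₂ hS hx

end Spectrum

end HigherSpin

theorem theorem4p6 {N : ℕ} (m : Fin N → ℕ) (hm : ∀ n, 1 ≤ m n) (η : ℂ) (hη : η ≠ 0)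
    (K : Matrix (Fin 2) (Fin 2) ℂ) (hKdet : K.det ≠ 0) (hK : ∀ α : ℂ, K ≠ α • 1)
    (k₁ k₂ : ℂ) (hk : K.charpoly = (X - C k₁) * (X - C k₂)) :
    ForAlmostAll fun ξ : Fin N → ℂ =>
      -- the points of different sites are distinct
      (∀ a b : Fin N, a ≠ b → ∀ h ≤ m a, ∀ k ≤ m b, node η m ξ a h ≠ node η m ξ b k) ∧
      -- diagonalizability with simple spectrum
      (k₁ ≠ k₂ → DiagonalizableSimple K η m ξ) ∧
      -- every eigenvalue is simple
      (∀ t ∈ spectrumT K η m ξ, Module.finrank ℂ (eigenspace K η m ξ t) = 1) ∧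
      -- the set of eigenvalues
      spectrumT K η m ξ =
        {t | ∃ x : Fin N → ℂ, t = interpolant K η m ξ x ∧
          ∀ n, (discreteMatrix k₁ k₂ η m ξ t n).det = 0} ∧
      -- almost every covector generates a separation of variables basis
      (ForAlmostAll fun S : Conf m → ℂ => IsBasisFamily (sovCovector K k₂ η m ξ S)) ∧
      -- the eigenvectors in any such basis
      ∀ S : Conf m → ℂ, IsBasisFamily (sovCovector K k₂ η m ξ S) →
        ∀ t ∈ spectrumT K η m ξ, ∃ v ∈ eigenspace K η m ξ t,
          S ⬝ᵥ v = 1 ∧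
          (∀ w ∈ eigenspace K η m ξ t, S ⬝ᵥ w = 1 → w = v) ∧
          (∀ (l : ℕ) (u : ℂ),
            fusedTransfer K η m ξ l u *ᵥ v = fusedValue K η m ξ t l u • v) ∧
          ∀ h : Conf m, sovCovector K k₂ η m ξ S h ⬝ᵥ v =
            ∏ n, fusedValue K η m ξ t (m n - (h n : ℕ)) (node η m ξ n (m n)) /
              sovDenominator k₂ η m ξ n (h n) := by
  have hk12 := mul_eq_det_of_charpoly hk
  have hk₂ : k₂ ≠ 0 := right_ne_zero_of_mul (hk12.trans_ne hKdet)
  have hdiag : ForAlmostAll fun ξ : Fin N → ℂ => k₁ ≠ k₂ → DiagonalizableSimple K η m ξ := by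
    by_cases h : k₁ = k₂
    · exact forAlmostAll_of_forall fun ξ h' => absurd h h'
    · exact (forAlmostAll_hasSimpleEigenbasis_transferCombination m hk h hη).mono fun ξ hξ _ =>
        diagonalizableSimple_of_hasSimpleEigenbasis m hξ
  -- One covector serves almost all $\xi$ at once. It yields the simplicity and the description of
  -- the spectrum, which do not mention $S$; the last two claims then vary $S$ at fixed $\xi$.
  obtain ⟨S₀, hS₀⟩ := exists_det_sovOp_ne_zero m hη hK
  refine ((forAlmostAll_node_ne η m).and (hdiag.and hS₀)).mono fun ξ ⟨hdist, hd, hdet⟩ => ?_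
  have hB := isBasisFamily_sovCovector hdist hη hk₂ hdet
  refine ⟨hdist, hd, fun t ht => finrank_eigenspace hB ht,
    spectrumT_eq hk12 hdist hη hk₂ hB, forAlmostAll_isBasisFamily hB, fun S hS t ht => ?_⟩
  obtain ⟨v, hv, h1, huniq⟩ := exists_normalized_eigenvector hS ht
  refine ⟨v, hv, h1, huniq, fun l u => fusedTransfer_mulVec K η m ξ hv l u, fun h => ?_⟩
  rw [sovCovector_dotProduct K η m ξ k₂ S hv, h1, mul_one]
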